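/- Let $n\ge 1$ and let $B(x_0,r)\subset\mathbb R^n$ denote the open Euclidean ball; for $B=B(x_0,r)$ put $2B=B(x_0,2r)$. All functions are complex valued. Let $\theta:(0,\infty)\to[0,\infty)$ be nondecreasing with $\int_0^1\frac{\theta(t)}{t}\,dt<\infty$. A $\theta$-type kernel is a measurable function $K$ on $\{(x,y)\in\mathbb R^n\times\mathbb R^n: x\ne y\}$ such that, for some constant $C>0$, $|K(x,y)|\le C|x-y|^{-n}$ for all $x\neq y$, and $$|K(x,y)-K(z,y)|+|K(y,x)-K(y,z)|\le \frac{C}{|x-y|^{n}}\,\theta\Big(\frac{|x-z|}{|x-y|}\Big)\qquad\text{for } 0<|x-z|<|x-y|/2 .$$ A $\theta$-type Calderón–Zygmund operator is a linear operator $T_\theta:\mathscr S(\mathbb R^n)\to\mathscr S'(\mathbb R^n)$ that extends to a bounded linear operator on $L^2(\mathbb R^n)$ (also denoted $T_\theta$) and for which there is a $\theta$-type kernel $K$ with $T_\theta f(x)=\int_{\mathbb R^n}K(x,y)f(y)\,dy$ for every $f\in C_0^\infty(\mathbb R^n)$ and almost every $x\notin\operatorname{supp}f$. Let $1<p<\infty$,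 $p'=p/(p-1)$, and $w\in A_p$: that is, $w$ is a nonnegative locally integrable function on $\mathbb R^n$, positive almost everywhere, and for some constant $C$ and every ball $B$, $$\Big(\frac1{|B|}\int_B w\,dx\Big)^{1/p}\Big(\frac1{|B|}\int_B w^{-p'/p}\,dx\Big)^{1/p'}\le C .$$ Write $w(E)=\int_E w\,dx$ and $\|f\|_{L^p_w}=\big(\int_{\mathbb R^n}|f|^pw\,dx\big)^{1/p}$. Let $0\le\kappa<1$ and let $\psi:(0,\infty)\to(0,\infty)$ be nondecreasing and satisfy the $\mathcal D_\kappa$ condition: for some constant $C>0$, $$\frac{\psi(\xi)}{\xi^{\kappa}}\le C\,\frac{\psi(\xi')}{(\xi')^{\kappa}}\qquad\text{for all } 0<\xi'<\xi<\infty .$$ Let $\mathcal M^{p,\psi}(w)$ be the space of all locally integrable $f$ (modulo equality almost everywhere) with $$\|f\|_{\mathcal M^{p,\psi}(w)}=\sup_{B}\Big(\frac1{\psi(w(B))}\int_B|f|^pw\,dx\Big)^{1/p}<\infty ,$$ the supremum being over all balls $B\subset\mathbb R^n$. Theorem. The operator $T_\theta$ is bounded on $\mathcal M^{p,\psi}(w)$.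 Precisely: there are a bounded linear operator $S$ on $L^p_w(\mathbb R^n)$ that agrees with $T_\theta$ on $L^2(\mathbb R^n)\cap L^p_w(\mathbb R^n)$, and a linear operator $\widetilde T$ from $\mathcal M^{p,\psi}(w)$ to itself that agrees with $T_\theta$ on $L^2(\mathbb R^n)\cap\mathcal M^{p,\psi}(w)$, such that for every $f\in\mathcal M^{p,\psi}(w)$ and every ball $B$ one has $f\chi_{2B}\in L^p_w(\mathbb R^n)$ and, for almost every $x\in B$, $$\widetilde Tf(x)=S(f\chi_{2B})(x)+\int_{\mathbb R^n\setminus 2B}K(x,y)f(y)\,dy$$ with an absolutely convergent integral; and there is a constant $C$, independent of $f$, with $$\|\widetilde Tf\|_{\mathcal M^{p,\psi}(w)}\le C\,\|f\|_{\mathcal M^{p,\psi}(w)}\qquad\text{for all } f\in\mathcal M^{p,\psi}(w).$$ -/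

import Mathlib

open MeasureTheory Metric SchwartzMap
open scoped NNReal ENNReal

/-- The Euclidean space `ℝⁿ`. -/
abbrev Eucl (n : ℕ) := EuclideanSpace ℝ (Fin n)

/-- `θ` is nonnegative and nondecreasing on `(0, ∞)`, with `∫₀¹ θ(t)/t dt < ∞`. Only the values of
`θ` on `(0, ∞)` matter. -/
structure IsDini (θ : ℝ → ℝ) : Prop where
  nonneg : ∀ t, 0 < t → 0 ≤ θ t
  mono : MonotoneOn θ (Set.Ioi 0)
  integrable : IntegrableOn (fun t => θ t / t) (Set.Ioo 0 1)

/-- `θ`-type kernels on `ℝⁿ × ℝⁿ` minus the diagonal; the values on the diagonal are irrelevant.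
In the regularity bound the trivial case `x = z` (where `θ` would be evaluated at `0`) is left
out. -/
structure IsThetaKernel {n : ℕ} (θ : ℝ → ℝ) (K : Eucl n → Eucl n → ℂ) : Prop where
  measurable : Measurable fun z : {z : Eucl n × Eucl n // z.1 ≠ z.2} => K z.1.1 z.1.2
  bounds : ∃ C : ℝ, 0 < C ∧
    (∀ x y, x ≠ y → ‖K x y‖ ≤ C / ‖x - y‖ ^ n) ∧
    (∀ x y z, x ≠ z → ‖x - z‖ < ‖x - y‖ / 2 →
      ‖K x y - K z y‖ + ‖K y x - K y z‖ ≤ C / ‖x - y‖ ^ n * θ (‖x - z‖ / ‖x - y‖))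

/-- A `θ`-type Calderón–Zygmund operator: a linear operator `𝓢(ℝⁿ) → 𝓢'(ℝⁿ)` which extends to a
bounded linear operator on `L²(ℝⁿ)` and is given, off the support of a smooth compactly supported
function, by integration against a `θ`-type kernel. (The `L²` extension is unique, by density.) -/
structure ThetaCZO (n : ℕ) (θ : ℝ → ℝ) where
  /-- The operator from the Schwartz space to the tempered distributions. -/
  toLin : 𝓢(Eucl n, ℂ) →ₗ[ℂ] 𝓢'(Eucl n, ℂ)
  /-- Its bounded extension to `L²`. -/
  l2Ext : Lp ℂ 2 (volume : Measure (Eucl n)) →L[ℂ] Lp ℂ 2 (volume : Measure (Eucl n))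
  l2Ext_eq : ∀ f : 𝓢(Eucl n, ℂ), toLin f = Lp.toTemperedDistribution (l2Ext (f.toLp 2 volume))
  /-- Its kernel. -/
  kernel : Eucl n → Eucl n → ℂ
  isThetaKernel : IsThetaKernel θ kernel
  eq_integral : ∀ f : 𝓢(Eucl n, ℂ), HasCompactSupport f →
    ∀ᵐ x : Eucl n, x ∉ tsupport f → l2Ext (f.toLp 2 volume) x = ∫ y, kernel x y * f y

/-- A weight: a nonnegative locally integrable function with values in `(0, ∞)` almost
everywhere. -/
structure IsWeight {n : ℕ} (w : Eucl n → ℝ) : Prop where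
  nonneg : ∀ x, 0 ≤ w x
  locallyIntegrable : LocallyIntegrable w
  pos : ∀ᵐ x, 0 < w x

/-- The Muckenhoupt class `A_p`, `1 < p < ∞`. The averages are taken in `[0, ∞]`, so that their
finiteness is part of the condition. -/
structure IsMuckenhoupt {n : ℕ} (p : ℝ) (w : Eucl n → ℝ) : Prop extends IsWeight w where
  bound : ∃ C : ℝ≥0, ∀ (x₀ : Eucl n) (r : ℝ), 0 < r →
    (⨍⁻ x in ball x₀ r, ENNReal.ofReal (w x) ∂volume) ^ (1 / p) *
      (⨍⁻ x in ball x₀ r, ENNReal.ofReal (w x) ^ (-(p.conjExponent / p)) ∂volume) ^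
          (1 / p.conjExponent)
        ≤ C

/-- The weighted measure `w(E) = ∫_E w(x) dx`. -/
noncomputable def weightMeasure {n : ℕ} (w : Eucl n → ℝ) : Measure (Eucl n) :=
  volume.withDensity fun x => ENNReal.ofReal (w x)

theorem weightMeasure_ac {n : ℕ} (w : Eucl n → ℝ) : weightMeasure w ≪ volume :=
  withDensity_absolutelyContinuous _ _

/-- `ψ` is a positive increasing (that is, nondecreasing) function on `(0, ∞)` which satisfies the
`D_κ` condition. -/
structure IsGrowth (κ : ℝ) (ψ : ℝ → ℝ) : Prop where
  pos : ∀ t, 0 < t → 0 < ψ t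
  mono : MonotoneOn ψ (Set.Ioi 0)
  dcond : ∃ C : ℝ, 0 < C ∧ ∀ s t : ℝ, 0 < s → s < t → ψ t / t ^ κ ≤ C * (ψ s / s ^ κ)

/-- The norm of `L^p_w`, that is `(∫ |f|^p w)^{1/p}` (for `0 < p < ∞`). -/
noncomputable def weightedLpNorm {n : ℕ} (p : ℝ) (w : Eucl n → ℝ) (f : Eucl n → ℂ) : ℝ≥0∞ :=
  eLpNorm f (ENNReal.ofReal p) (weightMeasure w)

/-- The norm of `M^{p,ψ}(w)`, that is `sup_B ((1 / ψ(w(B))) ∫_B |f|^p w)^{1/p}`. -/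
noncomputable def morreyNorm {n : ℕ} (p : ℝ) (ψ : ℝ → ℝ) (w : Eucl n → ℝ) (f : Eucl n → ℂ) :
    ℝ≥0∞ :=
  ⨆ (x₀ : Eucl n) (r : ℝ) (_ : 0 < r),
    eLpNorm f (ENNReal.ofReal p) ((weightMeasure w).restrict (ball x₀ r)) /
      ENNReal.ofReal (ψ ((weightMeasure w).real (ball x₀ r))) ^ (1 / p)

/-- The weighted Lebesgue space `L^p_w(ℝⁿ)`. For a weight `w`, the measures `w dx` and `dx` have the
same null sets, so its elements can be taken as classes modulo Lebesgue null sets. -/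
noncomputable def weightedLp (n : ℕ) (p : ℝ) (w : Eucl n → ℝ) :
    Submodule ℂ (Eucl n →ₘ[volume] ℂ) where
  carrier := {f | weightedLpNorm p w f < ∞}
  zero_mem' := by
    have h := (weightMeasure_ac w).ae_le (AEEqFun.coeFn_zero (μ := volume) (α := Eucl n) (β := ℂ))
    simp only [Set.mem_ofPred_eq, weightedLpNorm]
    rw [eLpNorm_congr_ae h]
    simp
  add_mem' := by
    intro f g hf hg
    have h := (weightMeasure_ac w).ae_le (AEEqFun.coeFn_add f g)
    simp only [Set.mem_ofPred_eq, weightedLpNorm] at hf hg ⊢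
    rw [eLpNorm_congr_ae h]
    exact eLpNorm_add_lt_top ⟨f.aestronglyMeasurable.mono_ac (weightMeasure_ac w), hf⟩
      ⟨g.aestronglyMeasurable.mono_ac (weightMeasure_ac w), hg⟩
  smul_mem' := by
    intro c f hf
    have h := (weightMeasure_ac w).ae_le (AEEqFun.coeFn_smul c f)
    simp only [Set.mem_ofPred_eq, weightedLpNorm] at hf ⊢
    rw [eLpNorm_congr_ae h]
    exact eLpNorm_const_smul_le.trans_lt (ENNReal.mul_lt_top (by simp) hf)

theorem morreyNorm_congr {n : ℕ} (p : ℝ) (ψ : ℝ → ℝ) (w : Eucl n → ℝ) {f g : Eucl n → ℂ}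
    (h : f =ᵐ[volume] g) : morreyNorm p ψ w f = morreyNorm p ψ w g := by
  have h1 (x₀ : Eucl n) (r : ℝ) : f =ᵐ[(weightMeasure w).restrict (ball x₀ r)] g :=
    ae_restrict_of_ae ((weightMeasure_ac w).ae_le h)
  simp only [morreyNorm]
  exact iSup_congr fun x₀ => iSup_congr fun r => by rw [eLpNorm_congr_ae (h1 x₀ r)]

/-- The generalized weighted Morrey space `M^{p,ψ}(w)`: locally integrable functions, modulo
equality almost everywhere, with finite Morrey norm. -/
noncomputable def morreySpace (n : ℕ) (p : ℝ) (ψ : ℝ → ℝ) (w : Eucl n → ℝ) :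
    Submodule ℂ (Eucl n →ₘ[volume] ℂ) where
  carrier := {f | LocallyIntegrable f volume ∧ morreyNorm p ψ w f < ∞}
  zero_mem' := by
    refine ⟨locallyIntegrable_zero.congr AEEqFun.coeFn_zero.symm, ?_⟩
    rw [morreyNorm_congr p ψ w AEEqFun.coeFn_zero]
    simp [morreyNorm]
  add_mem' := by
    rintro f g ⟨hf, hf'⟩ ⟨hg, hg'⟩
    refine ⟨(hf.add hg).congr (AEEqFun.coeFn_add f g).symm, ?_⟩
    rw [morreyNorm_congr p ψ w (AEEqFun.coeFn_add f g)]
    have hm (u : Eucl n →ₘ[volume] ℂ) (x₀ : Eucl n) (r : ℝ) :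
        AEStronglyMeasurable u ((weightMeasure w).restrict (ball x₀ r)) :=
      (u.aestronglyMeasurable.mono_ac (weightMeasure_ac w)).restrict
    refine lt_of_le_of_lt (b := ENNReal.LpAddConst (ENNReal.ofReal p) *
      (morreyNorm p ψ w f + morreyNorm p ψ w g)) ?_
      (ENNReal.mul_lt_top (ENNReal.LpAddConst_lt_top _) (ENNReal.add_lt_top.2 ⟨hf', hg'⟩))
    refine iSup_le fun x₀ => iSup_le fun r => iSup_le fun hr => ?_
    refine (ENNReal.div_le_div_right (eLpNorm_add_le' (hm f x₀ r) (hm g x₀ r) _) _).trans ?_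
    rw [mul_div_assoc, ENNReal.add_div]
    gcongr
    · exact le_iSup_of_le x₀ (le_iSup_of_le r (le_iSup_of_le hr le_rfl))
    · exact le_iSup_of_le x₀ (le_iSup_of_le r (le_iSup_of_le hr le_rfl))
  smul_mem' := by
    rintro c f ⟨hf, hf'⟩
    refine ⟨LocallyIntegrable.congr (hf.smul c) (AEEqFun.coeFn_smul c f).symm, ?_⟩
    rw [morreyNorm_congr p ψ w (AEEqFun.coeFn_smul c f)]
    refine lt_of_le_of_lt (b := ‖c‖ₑ * morreyNorm p ψ w f) ?_ (ENNReal.mul_lt_top (by simp) hf')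
    refine iSup_le fun x₀ => iSup_le fun r => iSup_le fun hr => ?_
    refine (ENNReal.div_le_div_right eLpNorm_const_smul_le _).trans ?_
    rw [mul_div_assoc]
    gcongr
    exact le_iSup_of_le x₀ (le_iSup_of_le r (le_iSup_of_le hr le_rfl))

namespace ThetaCZO

variable {n : ℕ} {θ : ℝ → ℝ} {p : ℝ} {ψ : ℝ → ℝ} {w : Eucl n → ℝ}

/-- `S` is the bounded extension of `T` to `L^p_w`: it is bounded and agrees with `T` on
`L² ∩ L^p_w`, which is dense in `L^p_w`. -/
structure IsWeightedLpExt (T : ThetaCZO n θ) (S : weightedLp n p w →ₗ[ℂ] weightedLp n p w) :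
    Prop where
  bounded : ∃ C : ℝ≥0, ∀ f : weightedLp n p w,
    weightedLpNorm p w (S f : Eucl n →ₘ[volume] ℂ) ≤
      C * weightedLpNorm p w (f : Eucl n →ₘ[volume] ℂ)
  agrees : ∀ (f : weightedLp n p w) (hf : (f : Eucl n →ₘ[volume] ℂ) ∈ Lp ℂ 2 volume),
    (S f : Eucl n →ₘ[volume] ℂ) = T.l2Ext ⟨f, hf⟩

/-- `U` is the action of `T` on `M^{p,ψ}(w)`: it agrees with `T` on `L² ∩ M^{p,ψ}(w)`, and on every
ball `B = B(x₀, r)` it is given by `U f = T (f χ_{2B}) + ∫_{(2B)ᶜ} K(·, y) f(y) dy` with an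
absolutely convergent integral, where `T (f χ_{2B})` is the value at `f χ_{2B} ∈ L^p_w` of the
extension `S` of `T` to `L^p_w`. This determines `U` uniquely. -/
structure IsMorreyExt (T : ThetaCZO n θ) (S : weightedLp n p w →ₗ[ℂ] weightedLp n p w)
    (U : morreySpace n p ψ w →ₗ[ℂ] morreySpace n p ψ w) : Prop where
  agrees : ∀ (f : morreySpace n p ψ w) (hf : (f : Eucl n →ₘ[volume] ℂ) ∈ Lp ℂ 2 volume),
    (U f : Eucl n →ₘ[volume] ℂ) = T.l2Ext ⟨f, hf⟩
  local_eq : ∀ (f : morreySpace n p ψ w) (x₀ : Eucl n) (r : ℝ), 0 < r →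
    ∃ g : weightedLp n p w,
      (g : Eucl n →ₘ[volume] ℂ) =ᵐ[volume]
        (ball x₀ (2 * r)).indicator (f : Eucl n →ₘ[volume] ℂ) ∧
      ∀ᵐ x, x ∈ ball x₀ r →
        IntegrableOn (fun y => T.kernel x y * (f : Eucl n →ₘ[volume] ℂ) y)
          (ball x₀ (2 * r))ᶜ ∧
        (U f : Eucl n →ₘ[volume] ℂ) x = (S g : Eucl n →ₘ[volume] ℂ) x +
          ∫ y in (ball x₀ (2 * r))ᶜ, T.kernel x y * (f : Eucl n →ₘ[volume] ℂ) y

end ThetaCZO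

/-!
A Calderón–Zygmund operator `T` is bounded on `L^p(w)` for a Muckenhoupt weight `w`, and the part of
`f` far from a ball `B` contributes to `T f` on `B` only through a kernel integral, which the Morrey
norm controls. Both facts together bound `T f` on `B` by the Morrey norm of `f`.

*Weighted bound.* Bounding `T` by a sparse operator avoids good-`λ` inequalities and reverse Hölder
inequalities for weights. The Dini condition makes `∑ θ(2 ^ (-j - 1))` finite, and this is
Hörmander's condition for the kernel, `IsThetaKernel.exists_lintegral_diff_le`. With the `L²` bound
and the Calderón–Zygmund decomposition it gives the weak type `(1, 1)` bound
`ThetaCZO.exists_mul_measure_lt_app_le`. The weak type bounds of `T` and of the maximal function `M`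
provide a stopping time argument on dyadic cubes, `ThetaCZO.exists_stopping_cubes`: on a cube `Q`,
the function `T (f χ_{Q*})`, with `Q*` a ball around `Q`, is at most a multiple of the average of
`|f|` over `Q*`, outside of smaller cubes of half the measure; on these the argument starts again.
Summed against a function `g ≥ 0`, the averages over the different generations sit on disjoint sets,
whence `∫ |T f| g ≤ D ∫ M f · M g`, which is `ThetaCZO.exists_lintegral_app_mul_le`.

The dual weight `σ = w ^ (-q / p)` is an `A_q` weight, and `L^q(σ)` is the dual of `L^p(w)` under
the unweighted pairing. Muckenhoupt's theorem for both weights,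
`IsMuckenhouptPair.lintegral_maxFn_rpow_mul_le`, is proved by comparing `M` with the composition of
the maximal functions of the doubling measures `w dx` and `σ dx`. Hölder's inequality and duality
then yield `ThetaCZO.exists_lintegral_app_rpow_mul_le`, and `T` extends by density to an operator
`S` on `L^p(w)`, `ThetaCZO.exists_isWeightedLpExt`, which is still represented by the kernel away
from the support, `ThetaCZO.IsWeightedLpExt.eq_integral`.

*Morrey bound.* For `x ∈ B`, the tail `∫_{(2B)ᶜ} K(x, y) f(y) dy` is split into dyadic annuli. The
`A_p` condition controls the average of `|f|` over `2 ^ j B` by the Morrey norm times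
`(ψ(w(2 ^ j B)) / w(2 ^ j B)) ^ (1 / p)`. Since `κ < 1`, the condition `D_κ` and reverse doubling of
`w dx` make these numbers decay geometrically in `j`; this is `ThetaCZO.exists_lintegral_tail_le`.
The representation of `S` by the kernel shows that the functions
`S (f χ_{2B}) + ∫_{(2B)ᶜ} K(·, y) f(y) dy` for different balls agree where the balls overlap,
`ThetaCZO.morreyAct_ae_eq`, so they glue to the operator of `ThetaCZO.exists_isMorreyExt`.

The definition of a kernel says nothing about the diagonal. `ThetaCZO.offDiag` sets the kernel to
zero there, so that it is jointly measurable, which changes none of the assertions.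
-/

/-! ### The uncentred maximal function of a doubling measure -/

section MaximalFunction

variable {X : Type*} [PseudoMetricSpace X] [MeasurableSpace X]

/-- Balls have positive finite measure, and quadrupling the radius of a ball multiplies its measure
by at most `D`. The factor `4` is large enough for the Vitali covering lemma. -/
structure BallDoubling (μ : Measure X) (D : ℝ≥0) : Prop where
  pos : ∀ c r, 0 < r → μ (ball c r) ≠ 0
  fin : ∀ c r, μ (ball c r) ≠ ∞
  doubling : ∀ c r, 0 < r → μ (ball c (4 * r)) ≤ D * μ (ball c r)

/-- The uncentred Hardy–Littlewood maximal function of `u ≥ 0` with respect to `μ`. -/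
noncomputable def maxFn (μ : Measure X) (u : X → ℝ≥0∞) (x : X) : ℝ≥0∞ :=
  ⨆ (c : X) (r : ℝ) (_ : x ∈ ball c r), (∫⁻ y in ball c r, u y ∂μ) / μ (ball c r)

variable {μ : Measure X} {D : ℝ≥0} {u v : X → ℝ≥0∞}

theorem le_maxFn {x c : X} {r : ℝ} (hx : x ∈ ball c r) :
    (∫⁻ y in ball c r, u y ∂μ) / μ (ball c r) ≤ maxFn μ u x :=
  le_iSup_of_le c (le_iSup_of_le r (le_iSup_of_le hx le_rfl))

theorem BallDoubling.lintegral_ball_le (hμ : BallDoubling μ D) {x c : X} {r : ℝ}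
    (hx : x ∈ ball c r) : ∫⁻ y in ball c r, u y ∂μ ≤ maxFn μ u x * μ (ball c r) := by
  have hr : 0 < r := dist_nonneg.trans_lt (mem_ball.1 hx)
  rw [← ENNReal.div_le_iff (hμ.pos c r hr) (hμ.fin c r)]
  exact le_maxFn hx

theorem maxFn_mono (h : u ≤ᵐ[μ] v) (x : X) : maxFn μ u x ≤ maxFn μ v x :=
  iSup_mono fun c => iSup_mono fun r => iSup_mono fun _ => by
    gcongr ?_ / _
    exact lintegral_mono_ae (ae_restrict_of_ae h)

theorem maxFn_congr (h : u =ᵐ[μ] v) : maxFn μ u = maxFn μ v :=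
  funext fun x => le_antisymm (maxFn_mono h.le x) (maxFn_mono h.symm.le x)

theorem isOpen_lt_maxFn (t : ℝ≥0∞) : IsOpen {x | t < maxFn μ u x} := by
  have : {x | t < maxFn μ u x} = ⋃ (c : X) (r : ℝ)
      (_ : t < (∫⁻ y in ball c r, u y ∂μ) / μ (ball c r)), ball c r := by
    ext x
    simp only [maxFn, Set.mem_ofPred_eq, lt_iSup_iff, Set.mem_iUnion, exists_prop]
    exact exists_congr fun c => exists_congr fun r => and_comm
  rw [this]
  exact isOpen_iUnion fun c => isOpen_iUnion fun r => isOpen_iUnion fun _ => isOpen_ball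

theorem measurable_maxFn [BorelSpace X] : Measurable (maxFn μ u) :=
  measurable_of_Ioi fun t => (isOpen_lt_maxFn t).measurableSet

theorem maxFn_add_le (hu : AEMeasurable u μ) (x : X) :
    maxFn μ (fun y => u y + v y) x ≤ maxFn μ u x + maxFn μ v x := by
  refine iSup_le fun c => iSup_le fun r => iSup_le fun hx => ?_
  rw [lintegral_add_left' hu.restrict, ENNReal.add_div]
  exact add_le_add (le_maxFn hx) (le_maxFn hx)

theorem maxFn_const_le (a : ℝ≥0∞) (x : X) : maxFn μ (fun _ => a) x ≤ a := by
  refine iSup_le fun c => iSup_le fun r => iSup_le fun hx => ?_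
  rw [lintegral_const, Measure.restrict_apply_univ, mul_div_assoc]
  exact mul_le_of_le_one_right (zero_le) ENNReal.div_self_le_one

/-- The weak type `(1, 1)` bound. -/
theorem BallDoubling.mul_measure_lt_maxFn_le [BorelSpace X] [SecondCountableTopology X]
    (hμ : BallDoubling μ D) (u : X → ℝ≥0∞) (t : ℝ≥0∞) :
    t * μ {x | t < maxFn μ u x} ≤ D * ∫⁻ y, u y ∂μ := by
  -- The covering lemma needs bounded radii: only balls of radius at most `R` are used at first.
  set s : ℕ → Set (X × ℝ) := fun R =>
    {b | 0 < b.2 ∧ b.2 ≤ R ∧ t < (∫⁻ y in ball b.1 b.2, u y ∂μ) / μ (ball b.1 b.2)} with hs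
  set S : ℕ → Set X := fun R => ⋃ b ∈ s R, ball b.1 b.2 with hS
  have hmono : Monotone S := fun i j hij => Set.biUnion_subset_biUnion_left fun b hb =>
    ⟨hb.1, hb.2.1.trans (by exact_mod_cast hij), hb.2.2⟩
  have hunion : {x | t < maxFn μ u x} = ⋃ R, S R := by
    ext x
    simp only [maxFn, Set.mem_ofPred_eq, lt_iSup_iff, Set.mem_iUnion, exists_prop, hS, hs]
    constructor
    · rintro ⟨c, r, hx, h⟩
      obtain ⟨R, hR⟩ := exists_nat_ge r
      exact ⟨R, (c, r), ⟨dist_nonneg.trans_lt (mem_ball.1 hx), hR, h⟩, hx⟩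
    · rintro ⟨R, b, ⟨_, _, h⟩, hx⟩
      exact ⟨b.1, b.2, hx, h⟩
  rw [hunion, hmono.measure_iUnion, ENNReal.mul_iSup]
  refine iSup_le fun R => ?_
  obtain ⟨w, hws, hdisj, hcov⟩ := Vitali.exists_disjoint_subfamily_covering_enlargement_ball
    (s R) (fun b => b.1) (fun b => b.2) R (fun b hb => hb.2.1) 4 (by norm_num)
  have hw : w.Countable := hdisj.countable_of_isOpen (fun b _ => isOpen_ball)
    fun b hb => nonempty_ball.2 (hws hb).1
  have := hw.to_subtype
  calc t * μ (S R) ≤ t * ∑' b : w, D * μ (ball b.1.1 b.1.2) := by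
        gcongr
        refine (measure_mono (t := ⋃ b : w, ball b.1.1 (4 * b.1.2)) ?_).trans
          ((measure_iUnion_le _).trans (ENNReal.tsum_le_tsum fun b =>
            hμ.doubling _ _ (hws b.2).1))
        refine Set.iUnion₂_subset fun a ha => ?_
        obtain ⟨b, hb, hab⟩ := hcov a ha
        exact hab.trans (Set.subset_iUnion (fun b : w => ball b.1.1 (4 * b.1.2)) ⟨b, hb⟩)
    _ = D * ∑' b : w, t * μ (ball b.1.1 b.1.2) := by
        rw [ENNReal.tsum_mul_left, ENNReal.tsum_mul_left]; ring
    _ ≤ D * ∑' b : w, ∫⁻ y in ball b.1.1 b.1.2, u y ∂μ := by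
        gcongr with b
        rw [← ENNReal.le_div_iff_mul_le (.inl (hμ.pos _ _ (hws b.2).1)) (.inl (hμ.fin _ _))]
        exact (hws b.2).2.2.le
    _ = D * ∫⁻ y in ⋃ b : w, ball b.1.1 b.1.2, u y ∂μ := by
        rw [lintegral_iUnion (fun b => isOpen_ball.measurableSet)]
        exact fun a b hab => hdisj a.2 b.2 (Subtype.coe_ne_coe.2 hab)
    _ ≤ D * ∫⁻ y, u y ∂μ := by
        gcongr
        exact Measure.restrict_le_self

end MaximalFunction

/-- The layer cake formula for a single number `a ∈ [0, ∞]`. -/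
theorem ENNReal.lintegral_rpow_layer {s : ℝ} (hs : 0 < s) (a : ℝ≥0∞) :
    ∫⁻ t in Set.Ioi (0 : ℝ), {t | ENNReal.ofReal t < a}.indicator
      (fun t => ENNReal.ofReal (s * t ^ (s - 1))) t = a ^ s := by
  have hfin (b : ℝ) (hb : 0 ≤ b) :
      ∫⁻ t in Set.Ioo 0 b, ENNReal.ofReal (s * t ^ (s - 1)) = ENNReal.ofReal b ^ s := by
    rw [ENNReal.ofReal_rpow_of_nonneg hb hs.le, restrict_Ioo_eq_restrict_Ioc,
      ← ofReal_integral_eq_lintegral_ofReal]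
    · rw [← intervalIntegral.integral_of_le hb, intervalIntegral.integral_const_mul,
        integral_rpow (.inl (by linarith))]
      simp only [sub_add_cancel, Real.zero_rpow hs.ne', sub_zero]
      rw [mul_div_cancel₀ _ hs.ne']
    · rw [← IntegrableOn, ← intervalIntegrable_iff_integrableOn_Ioc_of_le hb]
      exact (intervalIntegral.intervalIntegrable_rpow' (by linarith)).const_mul _
    · filter_upwards [ae_restrict_mem measurableSet_Ioc] with t ht
      exact mul_nonneg hs.le (Real.rpow_nonneg ht.1.le _)
  have hms : MeasurableSet {t : ℝ | ENNReal.ofReal t < a} :=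
    measurableSet_lt (by fun_prop) (by fun_prop)
  rw [setLIntegral_indicator hms]
  induction a with
  | top =>
    rw [ENNReal.top_rpow_of_pos hs, eq_top_iff]
    refine ENNReal.le_of_forall_nnreal_lt fun r _ => ?_
    have h1 := hfin ((r : ℝ) ^ s⁻¹) (by positivity)
    rw [ENNReal.ofReal_rpow_of_nonneg (by positivity) hs.le, ← Real.rpow_mul r.coe_nonneg,
      inv_mul_cancel₀ hs.ne', Real.rpow_one, ENNReal.ofReal_coe_nnreal] at h1
    rw [← h1]
    exact lintegral_mono_set fun t ht => ⟨by simp, ht.1⟩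
  | coe a =>
    have : {t : ℝ | ENNReal.ofReal t < a} ∩ Set.Ioi 0 = Set.Ioo 0 (a : ℝ) := by
      ext t
      simp only [Set.mem_inter_iff, Set.mem_ofPred_eq, Set.mem_Ioi, Set.mem_Ioo]
      rw [and_comm]
      refine and_congr_right fun ht => ?_
      rw [← ENNReal.ofReal_coe_nnreal, ENNReal.ofReal_lt_ofReal_iff_of_nonneg ht.le]
    rw [this, hfin _ a.coe_nonneg, ENNReal.ofReal_coe_nnreal]

/-- The layer cake formula, with a weight `ν`. -/
theorem lintegral_rpow_eq_lintegral_measure {X : Type*} [MeasurableSpace X] {μ : Measure X}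
    [SFinite μ] {h : X → ℝ≥0∞} (hh : Measurable h)
    {s : ℝ} (hs : 0 < s) (ν : X → ℝ≥0∞) (hν : Measurable ν) :
    ∫⁻ x, ν x * h x ^ s ∂μ = ∫⁻ t in Set.Ioi (0 : ℝ), ENNReal.ofReal (s * t ^ (s - 1)) *
      ∫⁻ x in {x | ENNReal.ofReal t < h x}, ν x ∂μ := by
  have hm : MeasurableSet {z : X × ℝ | ENNReal.ofReal z.2 < h z.1} :=
    measurableSet_lt (by fun_prop) (by fun_prop)
  calc ∫⁻ x, ν x * h x ^ s ∂μ
      = ∫⁻ x, (∫⁻ t in Set.Ioi (0 : ℝ), {z : X × ℝ | ENNReal.ofReal z.2 < h z.1}.indicator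
          (fun z => ν z.1 * ENNReal.ofReal (s * z.2 ^ (s - 1))) (x, t)) ∂μ := by
        refine lintegral_congr fun x => ?_
        rw [← ENNReal.lintegral_rpow_layer hs, ← lintegral_const_mul]
        · refine lintegral_congr fun t => ?_
          simp only [Set.indicator_apply, Set.mem_ofPred_eq]
          split_ifs <;> simp
        · exact Measurable.indicator (by fun_prop)
            (measurableSet_lt (by fun_prop) (by fun_prop))
    _ = ∫⁻ t in Set.Ioi (0 : ℝ), ∫⁻ x, {z : X × ℝ | ENNReal.ofReal z.2 < h z.1}.indicator
          (fun z => ν z.1 * ENNReal.ofReal (s * z.2 ^ (s - 1))) (x, t) ∂μ := by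
        refine lintegral_lintegral_swap ?_
        exact (Measurable.indicator (by fun_prop) hm).aemeasurable
    _ = _ := by
        refine lintegral_congr fun t => ?_
        rw [← lintegral_const_mul _ hν,
          ← lintegral_indicator (measurableSet_lt (by fun_prop) (by fun_prop))]
        refine lintegral_congr fun x => ?_
        simp only [Set.indicator_apply, Set.mem_ofPred_eq]
        split_ifs <;> simp [mul_comm]

/-- The maximal function of a doubling measure is bounded on `L^q` for `1 < q < ∞`: interpolation
between the weak type bound and the trivial `L^∞` bound. -/
theorem BallDoubling.lintegral_maxFn_rpow_le {X : Type*} [PseudoMetricSpace X]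
    [MeasurableSpace X] [BorelSpace X] [SecondCountableTopology X] {μ : Measure X} [SFinite μ]
    {D : ℝ≥0}
    (hμ : BallDoubling μ D) {q : ℝ} (hq : 1 < q) :
    ∃ C : ℝ≥0, ∀ u : X → ℝ≥0∞, AEMeasurable u μ →
      ∫⁻ x, maxFn μ u x ^ q ∂μ ≤ C * ∫⁻ x, u x ^ q ∂μ := by
  have hq1 : 0 < q - 1 := by linarith
  have hq0 : 0 < q := by linarith
  set A : ℝ := 2 * q / (q - 1)
  have hA : 0 ≤ A := by positivity
  refine ⟨D * A.toNNReal * (2 : ℝ≥0) ^ (q - 1), fun u hu => ?_⟩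
  wlog hum : Measurable u generalizing u
  · have := this _ hu.measurable_mk.aemeasurable hu.measurable_mk
    rw [maxFn_congr hu.ae_eq_mk]
    refine this.trans_eq ?_
    congr 1
    refine lintegral_congr_ae ?_
    filter_upwards [hu.ae_eq_mk] with x hx
    rw [hx]
  -- The part of `u` below `t / 2` contributes at most `t / 2` to the maximal function, so the weak
  -- type bound is needed only for the part above.
  have key (t : ℝ) (ht : 0 < t) : μ {x | ENNReal.ofReal t < maxFn μ u x} ≤
      ENNReal.ofReal (2 / t) * D * ∫⁻ x in {x | ENNReal.ofReal t < 2 * u x}, u x ∂μ := by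
    have hm : MeasurableSet {x | ENNReal.ofReal t < 2 * u x} :=
      measurableSet_lt (by fun_prop) (by fun_prop)
    have hsub : {x | ENNReal.ofReal t < maxFn μ u x} ⊆ {x | ENNReal.ofReal (t / 2) <
        maxFn μ ({x | ENNReal.ofReal t < 2 * u x}.indicator u) x} := by
      intro x hx
      simp only [Set.mem_ofPred_eq] at hx ⊢
      have h1 : maxFn μ u x ≤ maxFn μ (fun y => {x | ENNReal.ofReal t < 2 * u x}.indicator u y +
          ENNReal.ofReal (t / 2)) x := by
        refine maxFn_mono (.of_forall fun y => ?_) x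
        by_cases hy : ENNReal.ofReal t < 2 * u y
        · simp [hy]
        · simp only [Set.indicator_apply, Set.mem_ofPred_eq, hy, if_false, zero_add]
          rw [ENNReal.ofReal_div_of_pos two_pos, ENNReal.le_div_iff_mul_le (by simp) (by simp)]
          simpa [mul_comm] using hy
      have h2 := h1.trans ((maxFn_add_le (hum.indicator hm).aemeasurable x).trans
        (add_le_add le_rfl (maxFn_const_le (μ := μ) (ENNReal.ofReal (t / 2)) x)))
      have h3 := hx.trans_le h2
      have h4 : ENNReal.ofReal t = ENNReal.ofReal (t / 2) + ENNReal.ofReal (t / 2) := by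
        rw [← ENNReal.ofReal_add (by positivity) (by positivity)]; congr 1; ring
      exact (ENNReal.add_lt_add_iff_right ENNReal.ofReal_ne_top).1 (h4.symm.trans_lt h3)
    have hw := hμ.mul_measure_lt_maxFn_le ({x | ENNReal.ofReal t < 2 * u x}.indicator u)
      (ENNReal.ofReal (t / 2))
    rw [lintegral_indicator hm] at hw
    calc μ {x | ENNReal.ofReal t < maxFn μ u x}
        ≤ ENNReal.ofReal (2 / t) * (ENNReal.ofReal (t / 2) * μ {x | ENNReal.ofReal (t / 2) <
        maxFn μ ({x | ENNReal.ofReal t < 2 * u x}.indicator u) x}) := by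
          rw [← mul_assoc, ← ENNReal.ofReal_mul (by positivity)]
          rw [show 2 / t * (t / 2) = 1 by field_simp, ENNReal.ofReal_one, one_mul]
          exact measure_mono hsub
      _ ≤ _ := by rw [mul_assoc]; gcongr
  have e1 := lintegral_rpow_eq_lintegral_measure (μ := μ) (measurable_maxFn (μ := μ) (u := u)) hq0
    (fun _ => 1) measurable_const
  simp only [one_mul, lintegral_const, Measure.restrict_apply_univ] at e1
  have e2 := lintegral_rpow_eq_lintegral_measure (μ := μ) (h := fun x => 2 * u x) (by fun_prop) hq1
    u hum
  rw [e1]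
  calc _ ≤ ∫⁻ t in Set.Ioi (0 : ℝ), (D * ENNReal.ofReal A) * (ENNReal.ofReal ((q - 1) *
          t ^ (q - 1 - 1)) * ∫⁻ x in {x | ENNReal.ofReal t < 2 * u x}, u x ∂μ) := by
        refine setLIntegral_mono' measurableSet_Ioi fun t ht => ?_
        have ht' : 0 < t := ht
        refine (mul_le_mul_right (key t ht) _).trans_eq ?_
        have : ENNReal.ofReal (q * t ^ (q - 1)) * ENNReal.ofReal (2 / t) =
            ENNReal.ofReal A * ENNReal.ofReal ((q - 1) * t ^ (q - 1 - 1)) := by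
          rw [← ENNReal.ofReal_mul (mul_nonneg hq0.le (Real.rpow_nonneg (le_of_lt ht) _)),
            ← ENNReal.ofReal_mul hA]
          congr 1
          rw [Real.rpow_sub_one ht'.ne' (q - 1)]
          simp only [A]
          have := ht'.ne'
          field_simp
        calc _ = (ENNReal.ofReal (q * t ^ (q - 1)) * ENNReal.ofReal (2 / t)) * D *
              ∫⁻ x in {x | ENNReal.ofReal t < 2 * u x}, u x ∂μ := by ring
          _ = _ := by rw [this]; ring
    _ = (D * ENNReal.ofReal A) * ∫⁻ x, u x * (2 * u x) ^ (q - 1) ∂μ := by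
        rw [lintegral_const_mul' _ _ (ENNReal.mul_ne_top (by simp) (by simp)), e2]
    _ = _ := by
        have (x : X) : u x * (2 * u x) ^ (q - 1) = 2 ^ (q - 1) * u x ^ q := by
          rw [ENNReal.mul_rpow_of_nonneg _ _ hq1.le]
          calc _ = 2 ^ (q - 1) * (u x ^ (1 : ℝ) * u x ^ (q - 1)) := by rw [ENNReal.rpow_one]; ring
            _ = _ := by
              rw [← ENNReal.rpow_add_of_nonneg _ _ zero_le_one hq1.le, add_sub_cancel]
        simp_rw [this]
        rw [lintegral_const_mul' _ _ (ENNReal.rpow_ne_top_of_nonneg hq1.le (by simp))]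
        push_cast
        rw [ENNReal.coe_rpow_of_nonneg _ hq1.le]
        rw [← mul_assoc]; rfl

/-! ### Muckenhoupt weights -/

theorem Eucl.volume_ball_mul {n : ℕ} (c : Eucl n) {a : ℝ} (ha : 0 < a) (r : ℝ) :
    volume (ball c (a * r)) = ENNReal.ofReal (a ^ n) * volume (ball c r) := by
  rw [Measure.addHaar_ball_mul_of_pos _ c ha, ← Measure.addHaar_ball_center _ c r,
    finrank_euclideanSpace, Fintype.card_fin]

theorem Eucl.ballDoubling_volume (n : ℕ) :
    BallDoubling (volume : Measure (Eucl n)) ((4 : ℝ) ^ n).toNNReal where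
  pos _ _ hr := (measure_ball_pos _ _ hr).ne'
  fin _ _ := measure_ball_lt_top.ne
  doubling c r _ := (Eucl.volume_ball_mul c four_pos r).le

/-- An `A_p` weight `w` together with its dual weight `σ = w ^ (-q / p)`, where `1 / p + 1 / q = 1`.
Written as `w ^ (1 / p) * σ ^ (1 / q) = 1`, the relation between the two is symmetric under
`(p, w) ↔ (q, σ)`, so every statement about `w` has a twin about `σ`. -/
structure IsMuckenhouptPair {n : ℕ} (p q : ℝ) (w σ : Eucl n → ℝ≥0∞) (A : ℝ≥0) : Prop where
  conj : p.HolderConjugate q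
  aemeasurable_left : AEMeasurable w
  aemeasurable_right : AEMeasurable σ
  mul_eq_one : ∀ᵐ x, w x ^ (1 / p) * σ x ^ (1 / q) = 1
  ne_top_left : ∀ c r, ∫⁻ x in ball c r, w x ≠ ∞
  ne_top_right : ∀ c r, ∫⁻ x in ball c r, σ x ≠ ∞
  bound : ∀ c r, 0 < r → (∫⁻ x in ball c r, w x) ^ (1 / p) * (∫⁻ x in ball c r, σ x) ^ (1 / q) ≤
    A * volume (ball c r)

/-- The pointwise relation between a weight and its dual weight, in both of its forms. -/
theorem ENNReal.pair_aux {p q : ℝ} (h : p.HolderConjugate q) {a b : ℝ≥0∞}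
    (hab : a ^ (1 / p) * b ^ (1 / q) = 1) :
    a ≠ 0 ∧ a ≠ ∞ ∧ a⁻¹ ^ q * a = b := by
  have hp := h.pos
  have hq := h.symm.pos
  have ha0 : a ≠ 0 := by
    rintro rfl
    rw [ENNReal.zero_rpow_of_pos (by positivity), zero_mul] at hab
    exact zero_ne_one hab
  have hb0 : b ≠ 0 := by
    rintro rfl
    rw [ENNReal.zero_rpow_of_pos (by positivity), mul_zero] at hab
    exact zero_ne_one hab
  have hat : a ≠ ∞ := by
    rintro rfl
    rw [ENNReal.top_rpow_of_pos (by positivity), ENNReal.top_mul] at hab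
    · exact ENNReal.top_ne_one hab
    · simp [ENNReal.rpow_eq_zero_iff, hb0, hq.le, hq]
  refine ⟨ha0, hat, ?_⟩
  have h1 : b ^ (1 / q) = a ^ (-(1 / p)) := by
    rw [ENNReal.rpow_neg]
    exact (ENNReal.eq_inv_of_mul_eq_one_left (by rwa [mul_comm] at hab))
  have h2 : b = a ^ (-(q / p)) := by
    calc b = (b ^ (1 / q)) ^ q := by
          rw [← ENNReal.rpow_mul, one_div_mul_cancel hq.ne', ENNReal.rpow_one]
      _ = _ := by rw [h1, ← ENNReal.rpow_mul]; congr 1; ring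
  have h3 : -q + 1 = -(q / p) := by
    have := h.inv_add_inv_eq_one
    have e : q / p = q * p⁻¹ := rfl
    rw [e, show p⁻¹ = 1 - q⁻¹ by linarith]
    field_simp
    ring
  rw [h2, ENNReal.inv_rpow, ← ENNReal.rpow_neg, ← h3, ENNReal.rpow_add _ _ ha0 hat,
    ENNReal.rpow_one]

namespace IsMuckenhouptPair

variable {n : ℕ} {p q : ℝ} {w σ : Eucl n → ℝ≥0∞} {A : ℝ≥0}

theorem symm (h : IsMuckenhouptPair p q w σ A) : IsMuckenhouptPair q p σ w A where
  conj := h.conj.symm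
  aemeasurable_left := h.aemeasurable_right
  aemeasurable_right := h.aemeasurable_left
  mul_eq_one := h.mul_eq_one.mono fun x hx => by rwa [mul_comm]
  ne_top_left := h.ne_top_right
  ne_top_right := h.ne_top_left
  bound c r hr := by rw [mul_comm]; exact h.bound c r hr

/-- Hölder's inequality, for an integral against Lebesgue measure. -/
theorem lintegral_le (h : IsMuckenhouptPair p q w σ A) {u : Eucl n → ℝ≥0∞} (hu : AEMeasurable u)
    (s : Set (Eucl n)) :
    ∫⁻ x in s, u x ≤ (∫⁻ x in s, u x ^ p * w x) ^ (1 / p) * (∫⁻ x in s, σ x) ^ (1 / q) := by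
  have hp := h.conj.pos
  have hq := h.conj.symm.pos
  have h1 := ENNReal.lintegral_mul_le_Lp_mul_Lq (volume.restrict s) h.conj
    (f := fun x => u x * w x ^ (1 / p)) (g := fun x => σ x ^ (1 / q))
    (hu.mul (h.aemeasurable_left.pow_const _)).restrict (h.aemeasurable_right.pow_const _).restrict
  refine le_trans (le_of_eq ?_) (h1.trans_eq ?_)
  · refine lintegral_congr_ae (ae_restrict_of_ae (h.mul_eq_one.mono fun x hx => ?_))
    simp only [Pi.mul_apply]
    rw [mul_assoc, hx, mul_one]
  · congr 2
    · refine lintegral_congr fun x => ?_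
      rw [ENNReal.mul_rpow_of_nonneg _ _ hp.le, ← ENNReal.rpow_mul, one_div_mul_cancel hp.ne',
        ENNReal.rpow_one]
    · refine lintegral_congr fun x => ?_
      rw [← ENNReal.rpow_mul, one_div_mul_cancel hq.ne', ENNReal.rpow_one]

/-- The average of `u` over a ball is controlled by its weighted `L^p` average. -/
theorem lintegral_ball_mul_le (h : IsMuckenhouptPair p q w σ A) {u : Eucl n → ℝ≥0∞}
    (hu : AEMeasurable u) (c : Eucl n) {r : ℝ} (hr : 0 < r) :
    (∫⁻ x in ball c r, u x) * (∫⁻ x in ball c r, w x) ^ (1 / p) ≤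
      A * volume (ball c r) * (∫⁻ x in ball c r, u x ^ p * w x) ^ (1 / p) :=
  calc _ ≤ (∫⁻ x in ball c r, u x ^ p * w x) ^ (1 / p) * (∫⁻ x in ball c r, σ x) ^ (1 / q) *
        (∫⁻ x in ball c r, w x) ^ (1 / p) := by gcongr; exact h.lintegral_le hu _
    _ = (∫⁻ x in ball c r, u x ^ p * w x) ^ (1 / p) * ((∫⁻ x in ball c r, w x) ^ (1 / p) *
        (∫⁻ x in ball c r, σ x) ^ (1 / q)) := by ring
    _ ≤ (∫⁻ x in ball c r, u x ^ p * w x) ^ (1 / p) * (A * volume (ball c r)) := by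
        exact mul_le_mul_right (h.bound c r hr) _
    _ = _ := by ring

theorem lintegral_ball_ne_zero (h : IsMuckenhouptPair p q w σ A) (c : Eucl n) {r : ℝ}
    (hr : 0 < r) : ∫⁻ x in ball c r, w x ≠ 0 := by
  intro h0
  have h1 := h.lintegral_le (u := fun _ => 1) aemeasurable_const (ball c r)
  simp only [ENNReal.one_rpow, one_mul, h0, lintegral_const, Measure.restrict_apply_univ] at h1
  rw [ENNReal.zero_rpow_of_pos (by have := h.conj.pos; positivity), zero_mul] at h1
  exact (measure_ball_pos volume c hr).ne' (le_antisymm h1 (zero_le))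

/-- The quantitative absolute continuity of Lebesgue measure with respect to an `A_p` weight. -/
theorem mul_measure_rpow_le (h : IsMuckenhouptPair p q w σ A) {s : Set (Eucl n)}
    (hs : MeasurableSet s) {c : Eucl n} {r : ℝ} (hr : 0 < r) (hsub : s ⊆ ball c r) :
    volume s ^ p * (∫⁻ x in ball c r, w x) ≤
      (A * volume (ball c r)) ^ p * ∫⁻ x in s, w x := by
  have hp := h.conj.pos
  have h1 := h.lintegral_ball_mul_le (u := s.indicator 1)
    (aemeasurable_one.indicator hs) c hr
  have e (x : Eucl n) : s.indicator (1 : Eucl n → ℝ≥0∞) x ^ p * w x = s.indicator w x := by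
    by_cases hx : x ∈ s <;> simp [hx, hp]
  simp_rw [e] at h1
  rw [lintegral_indicator hs, lintegral_indicator hs, Measure.restrict_restrict hs,
    Set.inter_eq_left.2 hsub, Pi.one_def, setLIntegral_one] at h1
  have h2 := ENNReal.rpow_le_rpow h1 hp.le
  rwa [ENNReal.mul_rpow_of_nonneg _ _ hp.le, ENNReal.mul_rpow_of_nonneg (_ * _) _ hp.le,
    ← ENNReal.rpow_mul, ← ENNReal.rpow_mul, one_div_mul_cancel hp.ne', ENNReal.rpow_one,
    ENNReal.rpow_one] at h2

theorem ballDoubling (h : IsMuckenhouptPair p q w σ A) :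
    ∃ D : ℝ≥0, BallDoubling (volume.withDensity w) D := by
  have hp := h.conj.pos
  refine ⟨(A * ((4 : ℝ) ^ n).toNNReal) ^ p, fun c r hr => ?_, fun c r => ?_, fun c r hr => ?_⟩
  · rw [withDensity_apply _ measurableSet_ball]; exact h.lintegral_ball_ne_zero c hr
  · rw [withDensity_apply _ measurableSet_ball]; exact h.ne_top_left c r
  · rw [withDensity_apply _ measurableSet_ball, withDensity_apply _ measurableSet_ball]
    have h1 := h.mul_measure_rpow_le (measurableSet_ball (x := c) (ε := r)) (c := c)
      (r := 4 * r) (by positivity) (ball_subset_ball (by linarith))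
    have h0 := (measure_ball_pos (volume : Measure (Eucl n)) c hr).ne'
    have ht := (measure_ball_lt_top (μ := (volume : Measure (Eucl n))) (x := c) (r := r)).ne
    rw [Eucl.volume_ball_mul c four_pos, ← mul_assoc, ENNReal.mul_rpow_of_nonneg _ _ hp.le,
      mul_comm _ (volume (ball c r) ^ p), mul_assoc, ENNReal.mul_le_mul_iff_right
        (by simp [ENNReal.rpow_eq_zero_iff, h0, ht])
        (ENNReal.rpow_ne_top_of_nonneg hp.le ht)] at h1
    rw [ENNReal.coe_rpow_of_nonneg _ hp.le]
    exact h1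

theorem lintegral_withDensity (h : IsMuckenhouptPair p q w σ A) (u : Eucl n → ℝ≥0∞)
    (s : Set (Eucl n)) (hs : MeasurableSet s) :
    ∫⁻ x in s, u x ∂(volume.withDensity w) = ∫⁻ x in s, u x * w x := by
  rw [restrict_withDensity hs, lintegral_withDensity_eq_lintegral_mul_non_measurable₀ _
    h.aemeasurable_left.restrict]
  · simp [mul_comm]
  · refine ae_restrict_of_ae (h.mul_eq_one.mono fun x hx => ?_)
    exact (ENNReal.pair_aux h.conj hx).2.1.lt_top

/-- The Hardy–Littlewood maximal function `M` to the power `p - 1` is controlled by the composition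
of the maximal functions of the weight and of its dual weight. -/
theorem maxFn_rpow_le (h : IsMuckenhouptPair p q w σ A) (u : Eucl n → ℝ≥0∞) (x : Eucl n) :
    maxFn volume u x ^ (p - 1) ≤ A ^ p * maxFn (volume.withDensity w)
      (fun y => maxFn (volume.withDensity σ) (fun z => u z * (σ z)⁻¹) y ^ (p - 1) * (w y)⁻¹) x := by
  have hp := h.conj.pos
  have hp1 : 0 < p - 1 := h.conj.sub_one_pos
  obtain ⟨D₁, hw⟩ := h.ballDoubling
  obtain ⟨D₂, hσ⟩ := h.symm.ballDoubling
  set N := maxFn (volume.withDensity σ) (fun z => u z * (σ z)⁻¹) with hN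
  have hiso : maxFn volume u x ^ (p - 1) = ⨆ (c : Eucl n) (r : ℝ) (_ : x ∈ ball c r),
      ((∫⁻ y in ball c r, u y) / volume (ball c r)) ^ (p - 1) := by
    simp only [maxFn, ← ENNReal.orderIsoRpow_apply (p - 1) hp1, OrderIso.map_iSup]
  rw [hiso]
  refine iSup_le fun c => iSup_le fun r => iSup_le fun hx => ?_
  have hr : 0 < r := dist_nonneg.trans_lt (mem_ball.1 hx)
  refine le_trans ?_ (mul_le_mul_right (le_maxFn hx) _)
  set B := ball c r with hB
  have hB0 : volume B ≠ 0 := (measure_ball_pos volume c hr).ne'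
  have hBt : volume B ≠ ∞ := measure_ball_lt_top.ne
  have hwB : volume.withDensity w B = ∫⁻ y in B, w y := withDensity_apply _ measurableSet_ball
  have hσB : volume.withDensity σ B = ∫⁻ y in B, σ y := withDensity_apply _ measurableSet_ball
  -- The average `m` of `u / σ` over `B` with respect to `σ dx` is at most `N` at every point of
  -- `B`.
  set m := (∫⁻ y in B, u y) / volume.withDensity σ B with hm
  have hmN (y : Eucl n) (hy : y ∈ B) : m ≤ N y := by
    have : ∫⁻ y in B, u y = ∫⁻ y in B, u y * (σ y)⁻¹ ∂(volume.withDensity σ) := by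
      rw [h.symm.lintegral_withDensity _ _ measurableSet_ball]
      refine lintegral_congr_ae (ae_restrict_of_ae (h.symm.mul_eq_one.mono fun x hx => ?_))
      have := ENNReal.pair_aux h.conj.symm hx
      simp only
      rw [mul_assoc, ENNReal.inv_mul_cancel this.1 this.2.1, mul_one]
    rw [hm, this]
    exact le_maxFn hy
  have h1 : m ^ (p - 1) * volume B ≤
      ∫⁻ y in B, N y ^ (p - 1) * (w y)⁻¹ ∂(volume.withDensity w) := by
    rw [h.lintegral_withDensity _ _ measurableSet_ball, ← setLIntegral_const]
    refine lintegral_mono_ae ?_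
    filter_upwards [ae_restrict_of_ae h.mul_eq_one, ae_restrict_mem measurableSet_ball]
      with y hy hyB
    have := ENNReal.pair_aux h.conj hy
    rw [mul_assoc, ENNReal.inv_mul_cancel this.1 this.2.1, mul_one]
    exact ENNReal.rpow_le_rpow (hmN y hyB) hp1.le
  -- The `A_p` condition to the power `p`, as `p / q = p - 1`.
  have h2 : volume.withDensity σ B ^ (p - 1) * volume.withDensity w B ≤
      A ^ p * volume B ^ p := by
    have := ENNReal.rpow_le_rpow (h.bound c r hr) hp.le
    rw [ENNReal.mul_rpow_of_nonneg _ _ hp.le, ENNReal.mul_rpow_of_nonneg _ _ hp.le,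
      ← ENNReal.rpow_mul, ← ENNReal.rpow_mul, one_div_mul_cancel hp.ne', ENNReal.rpow_one] at this
    rw [mul_comm, hwB, hσB]
    have hq := h.conj.symm.pos
    have e : p - 1 = 1 / q * p := by
      rw [one_div, show q⁻¹ = 1 - p⁻¹ by linarith [h.conj.inv_add_inv_eq_one]]
      field_simp
    rwa [e]
  have hσ0 := hσ.pos c r hr
  have hσt := hσ.fin c r
  have hw0 := hw.pos c r hr
  have hwt := hw.fin c r
  have h3 : ∫⁻ y in B, u y = m * volume.withDensity σ B :=
    (ENNReal.div_mul_cancel hσ0 hσt).symm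
  rw [h3, ENNReal.div_rpow_of_nonneg _ _ hp1.le, ENNReal.mul_rpow_of_nonneg _ _ hp1.le,
    ENNReal.div_le_iff_le_mul (.inl (by simp [ENNReal.rpow_eq_zero_iff, hB0, hBt]))
      (.inl (ENNReal.rpow_ne_top_of_nonneg hp1.le hBt)), mul_div_assoc', mul_comm (_ / _),
      mul_div_assoc', ENNReal.le_div_iff_mul_le (.inl hw0) (.inl hwt)]
  calc m ^ (p - 1) * volume.withDensity σ B ^ (p - 1) * volume.withDensity w B
      = m ^ (p - 1) * (volume.withDensity σ B ^ (p - 1) * volume.withDensity w B) := by ring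
    _ ≤ m ^ (p - 1) * (A ^ p * volume B ^ p) := by gcongr
    _ = volume B ^ (p - 1) * (A ^ p * (m ^ (p - 1) * volume B)) := by
        have : volume B ^ p = volume B ^ (p - 1) * volume B := by
          conv_rhs => rw [← ENNReal.rpow_one (volume B), ← ENNReal.rpow_mul, one_mul,
            ← ENNReal.rpow_add _ _ hB0 hBt, sub_add_cancel]
        rw [this]; ring
    _ ≤ _ := by gcongr

/-- **Muckenhoupt's theorem**: the maximal function is bounded on `L^p(w)`. -/
theorem lintegral_maxFn_rpow_mul_le (h : IsMuckenhouptPair p q w σ A) :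
    ∃ C : ℝ≥0, ∀ u : Eucl n → ℝ≥0∞, AEMeasurable u →
      ∫⁻ x, maxFn volume u x ^ p * w x ≤ C * ∫⁻ x, u x ^ p * w x := by
  have hp := h.conj.pos
  have hq := h.conj.symm.pos
  have hp1 : 0 < p - 1 := h.conj.sub_one_pos
  have hpq : (p - 1) * q = p := h.conj.sub_one_mul_conj
  obtain ⟨D₁, hw⟩ := h.ballDoubling
  obtain ⟨D₂, hσ⟩ := h.symm.ballDoubling
  obtain ⟨C₁, hC₁⟩ := hw.lintegral_maxFn_rpow_le h.conj.symm.lt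
  obtain ⟨C₂, hC₂⟩ := hσ.lintegral_maxFn_rpow_le h.conj.lt
  have hac₁ : volume.withDensity w ≪ volume := withDensity_absolutelyContinuous _ _
  have hac₂ : volume.withDensity σ ≪ volume := withDensity_absolutelyContinuous _ _
  have hwd (u : Eucl n → ℝ≥0∞) : ∫⁻ x, u x ∂(volume.withDensity w) = ∫⁻ x, u x * w x := by
    simpa using h.lintegral_withDensity u Set.univ .univ
  have hσd (u : Eucl n → ℝ≥0∞) : ∫⁻ x, u x ∂(volume.withDensity σ) = ∫⁻ x, u x * σ x := by
    simpa using h.symm.lintegral_withDensity u Set.univ .univ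
  refine ⟨(A ^ p) ^ q * C₁ * C₂, fun u hu => ?_⟩
  set N := maxFn (volume.withDensity σ) (fun z => u z * (σ z)⁻¹) with hN
  calc ∫⁻ x, maxFn volume u x ^ p * w x
      = ∫⁻ x, (maxFn volume u x ^ (p - 1)) ^ q ∂(volume.withDensity w) := by
        rw [hwd]; simp_rw [← ENNReal.rpow_mul, hpq]
    _ ≤ ∫⁻ x, (A ^ p) ^ q * maxFn (volume.withDensity w)
          (fun y => N y ^ (p - 1) * (w y)⁻¹) x ^ q ∂(volume.withDensity w) := by
        refine lintegral_mono fun x => ?_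
        simp only
        rw [← ENNReal.mul_rpow_of_nonneg _ _ hq.le]
        exact ENNReal.rpow_le_rpow (h.maxFn_rpow_le u x) hq.le
    _ = (A ^ p) ^ q * ∫⁻ x, maxFn (volume.withDensity w)
          (fun y => N y ^ (p - 1) * (w y)⁻¹) x ^ q ∂(volume.withDensity w) := by
        rw [lintegral_const_mul' _ _ (by finiteness)]
    _ ≤ (A ^ p) ^ q * (C₁ * ∫⁻ x, (N x ^ (p - 1) * (w x)⁻¹) ^ q ∂(volume.withDensity w)) := by
        gcongr
        exact hC₁ _ (((measurable_maxFn.pow_const _).aemeasurable.mul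
          h.aemeasurable_left.inv).mono_ac hac₁)
    _ = (A ^ p) ^ q * (C₁ * ∫⁻ x, N x ^ p ∂(volume.withDensity σ)) := by
        rw [hwd, hσd]
        congr 2
        refine lintegral_congr_ae (h.mul_eq_one.mono fun x hx => ?_)
        simp only
        rw [ENNReal.mul_rpow_of_nonneg _ _ hq.le, ← ENNReal.rpow_mul, hpq, mul_assoc,
          (ENNReal.pair_aux h.conj hx).2.2]
    _ ≤ (A ^ p) ^ q * (C₁ * (C₂ * ∫⁻ x, (u x * (σ x)⁻¹) ^ p ∂(volume.withDensity σ))) := by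
        gcongr
        exact hC₂ _ ((hu.mul h.aemeasurable_right.inv).mono_ac hac₂)
    _ = (A ^ p) ^ q * (C₁ * (C₂ * ∫⁻ x, u x ^ p * w x)) := by
        rw [hσd]
        congr 3
        refine lintegral_congr_ae (h.symm.mul_eq_one.mono fun x hx => ?_)
        simp only
        rw [ENNReal.mul_rpow_of_nonneg _ _ hp.le, mul_assoc,
          (ENNReal.pair_aux h.conj.symm hx).2.2]
    _ = _ := by
        push_cast [← ENNReal.coe_rpow_of_nonneg _ hp.le, ← ENNReal.coe_rpow_of_nonneg _ hq.le]
        ring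

end IsMuckenhouptPair

/-- A Muckenhoupt weight and its dual weight form a pair. -/
theorem IsMuckenhoupt.exists_pair {n : ℕ} {p : ℝ} (hp : 1 < p) {w : Eucl n → ℝ}
    (hw : IsMuckenhoupt p w) : ∃ A : ℝ≥0, IsMuckenhouptPair p p.conjExponent
      (fun x => ENNReal.ofReal (w x)) (fun x => ENNReal.ofReal (w x) ^ (-(p.conjExponent / p)))
      A := by
  have hpq := Real.HolderConjugate.conjExponent hp
  have hp0 := hpq.pos
  have hq0 := hpq.symm.pos
  set q := p.conjExponent
  obtain ⟨A, hA⟩ := hw.bound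
  have hmeas : AEMeasurable (fun x => ENNReal.ofReal (w x)) :=
    hw.locallyIntegrable.aestronglyMeasurable.aemeasurable.ennreal_ofReal
  have hfin (c : Eucl n) (r : ℝ) : ∫⁻ x in ball c r, ENNReal.ofReal (w x) ≠ ∞ := by
    have := (hw.locallyIntegrable.integrableOn_isCompact (isCompact_closedBall c r)).mono_set
      ball_subset_closedBall
    exact this.lintegral_lt_top.ne
  have hb (c : Eucl n) (r : ℝ) (hr : 0 < r) : (∫⁻ x in ball c r, ENNReal.ofReal (w x)) ^ (1 / p) *
      (∫⁻ x in ball c r, ENNReal.ofReal (w x) ^ (-(q / p))) ^ (1 / q) ≤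
      A * volume (ball c r) := by
    have h0 := (measure_ball_pos (volume : Measure (Eucl n)) c hr).ne'
    have ht := (measure_ball_lt_top (μ := (volume : Measure (Eucl n))) (x := c) (r := r)).ne
    have h1 := hA c r hr
    rw [setLAverage_eq, setLAverage_eq, ENNReal.div_rpow_of_nonneg _ _ (by positivity),
      ENNReal.div_rpow_of_nonneg _ _ (by positivity)] at h1
    have e : volume (ball c r) = volume (ball c r) ^ (1 / p) * volume (ball c r) ^ (1 / q) := by
      rw [← ENNReal.rpow_add _ _ h0 ht, one_div, one_div, hpq.inv_add_inv_eq_one, ENNReal.rpow_one]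
    have hne (s : ℝ) : volume (ball c r) ^ s ≠ 0 := by simp [ENNReal.rpow_eq_zero_iff, h0, ht]
    have hnt (s : ℝ) : volume (ball c r) ^ s ≠ ∞ := by simp [ENNReal.rpow_eq_top_iff, h0, ht]
    calc _ = (∫⁻ x in ball c r, ENNReal.ofReal (w x)) ^ (1 / p) / volume (ball c r) ^ (1 / p) *
          ((∫⁻ x in ball c r, ENNReal.ofReal (w x) ^ (-(q / p))) ^ (1 / q) /
            volume (ball c r) ^ (1 / q)) *
          (volume (ball c r) ^ (1 / p) * volume (ball c r) ^ (1 / q)) := by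
          rw [mul_mul_mul_comm (_ / _), ENNReal.div_mul_cancel (hne _) (hnt _),
            ENNReal.div_mul_cancel (hne _) (hnt _)]
      _ ≤ _ := by rw [← e]; gcongr
  refine ⟨A, hpq, hmeas, hmeas.pow_const _, ?_, hfin, fun c r => ?_, hb⟩
  · filter_upwards [hw.pos] with x hx
    have h0 : ENNReal.ofReal (w x) ≠ 0 := by simpa using hx
    rw [← ENNReal.rpow_mul, ← ENNReal.rpow_add _ _ h0 ENNReal.ofReal_ne_top,
      show 1 / p + -(q / p) * (1 / q) = 0 by field_simp; ring, ENNReal.rpow_zero]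
  · rcases le_or_gt r 0 with hr | hr
    · simp [ball_eq_empty.2 hr]
    intro htop
    have h0 : ∫⁻ x in ball c r, ENNReal.ofReal (w x) ≠ 0 := by
      intro h0
      rw [lintegral_eq_zero_iff' hmeas.restrict, Filter.EventuallyEq,
        ae_restrict_iff' measurableSet_ball] at h0
      refine (measure_ball_pos (volume : Measure (Eucl n)) c hr).ne' ?_
      refine measure_eq_zero_iff_ae_notMem.2 ?_
      filter_upwards [h0, hw.pos] with x hx hpos hxB
      have := hx hxB
      simp only [Pi.zero_apply, ENNReal.ofReal_eq_zero] at this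
      exact this.not_gt hpos
    have h1 := hb c r hr
    rw [htop, ENNReal.top_rpow_of_pos (by positivity), ENNReal.mul_top, top_le_iff] at h1
    · exact ENNReal.mul_ne_top ENNReal.coe_ne_top measure_ball_lt_top.ne h1
    · simp [ENNReal.rpow_eq_zero_iff, h0, hp0.le]

/-! ### Dyadic cubes -/

/-- The half-open dyadic cube of side `2 ^ (-k)` whose lowest corner is `2 ^ (-k) * m`, for
`k : ℤ` and `m : ℤⁿ`. As a fibre of `x ↦ (⌊2 ^ k * x i⌋)ᵢ` it is part of a partition. -/
def dyadicCube {n : ℕ} (P : ℤ × (Fin n → ℤ)) : Set (Eucl n) :=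
  {x | ∀ i, ⌊(2 : ℝ) ^ P.1 * x i⌋ = P.2 i}

/-- The side of a dyadic cube. -/
noncomputable def dyadicSide {n : ℕ} (P : ℤ × (Fin n → ℤ)) : ℝ := (2 : ℝ) ^ (-P.1)

/-- The lowest corner of a dyadic cube. -/
noncomputable def dyadicCorner {n : ℕ} (P : ℤ × (Fin n → ℤ)) : Eucl n :=
  WithLp.toLp 2 fun i => (2 : ℝ) ^ (-P.1) * P.2 i

/-- The index of the dyadic cube of side `2 ^ (-k)` around `x`. -/
noncomputable def dyadicAt {n : ℕ} (k : ℤ) (x : Eucl n) : ℤ × (Fin n → ℤ) :=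
  (k, fun i => ⌊(2 : ℝ) ^ k * x i⌋)

variable {n : ℕ}

theorem mem_dyadicCube_dyadicAt (k : ℤ) (x : Eucl n) : x ∈ dyadicCube (dyadicAt k x) :=
  fun _ => rfl

theorem dyadicAt_eq {P : ℤ × (Fin n → ℤ)} {x : Eucl n} (hx : x ∈ dyadicCube P) :
    dyadicAt P.1 x = P :=
  Prod.ext rfl (funext hx)

theorem dyadicSide_pos (P : ℤ × (Fin n → ℤ)) : 0 < dyadicSide P := zpow_pos two_pos _

theorem mem_dyadicCube_iff {P : ℤ × (Fin n → ℤ)} {x : Eucl n} :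
    x ∈ dyadicCube P ↔
      ∀ i, x i ∈ Set.Ico (dyadicSide P * P.2 i) (dyadicSide P * (P.2 i + 1)) := by
  refine forall_congr' fun i => ?_
  have h : (0 : ℝ) < 2 ^ P.1 := zpow_pos two_pos _
  rw [Int.floor_eq_iff, dyadicSide, zpow_neg, Set.mem_Ico, inv_mul_le_iff₀ h, lt_inv_mul_iff₀ h]

theorem floor_two_zpow_mul_le {j k : ℤ} (hjk : j ≤ k) {a b : ℝ}
    (h : ⌊(2 : ℝ) ^ k * a⌋ = ⌊(2 : ℝ) ^ k * b⌋) : ⌊(2 : ℝ) ^ j * a⌋ ≤ ⌊(2 : ℝ) ^ j * b⌋ := by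
  obtain ⟨d, rfl⟩ := Int.le.dest hjk
  have hd : (0 : ℝ) < 2 ^ d := by positivity
  have e (c : ℝ) : (2 : ℝ) ^ (j + d) * c = 2 ^ d * (2 ^ j * c) := by
    rw [zpow_add₀ two_ne_zero, zpow_natCast]; ring
  have h1 : 2 ^ d * ⌊(2 : ℝ) ^ j * a⌋ ≤ ⌊(2 : ℝ) ^ (j + d) * a⌋ := by
    rw [Int.le_floor, e]
    push_cast
    gcongr
    exact Int.floor_le _
  rw [h, Int.le_floor, e] at h1
  push_cast at h1
  exact Int.le_floor.2 (le_of_mul_le_mul_left h1 hd)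

/-- Dyadic cubes are nested. -/
theorem dyadicCube_subset {P R : ℤ × (Fin n → ℤ)} {x : Eucl n} (hP : x ∈ dyadicCube P)
    (hR : x ∈ dyadicCube R) (h : R.1 ≤ P.1) : dyadicCube P ⊆ dyadicCube R := by
  intro y hy i
  rw [← hR i]
  have : ⌊(2 : ℝ) ^ P.1 * y i⌋ = ⌊(2 : ℝ) ^ P.1 * x i⌋ := (hy i).trans (hP i).symm
  exact le_antisymm (floor_two_zpow_mul_le h this) (floor_two_zpow_mul_le h this.symm)

theorem measurableSet_dyadicCube (P : ℤ × (Fin n → ℤ)) : MeasurableSet (dyadicCube P) := by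
  simp only [dyadicCube, Set.ofPred_forall]
  refine MeasurableSet.iInter fun i => ?_
  have : Measurable fun x : Eucl n => ⌊(2 : ℝ) ^ P.1 * x i⌋ := by fun_prop
  exact this (measurableSet_singleton _)

theorem volume_dyadicCube (P : ℤ × (Fin n → ℤ)) :
    volume (dyadicCube P) = ENNReal.ofReal (dyadicSide P ^ n) := by
  have : dyadicCube P = (fun x : Eucl n => (WithLp.ofLp x : Fin n → ℝ)) ⁻¹' Set.univ.pi fun i =>
      Set.Ico (dyadicSide P * P.2 i) (dyadicSide P * (P.2 i + 1)) := by
    ext x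
    simp [mem_dyadicCube_iff]
  rw [this, (PiLp.volume_preserving_ofLp (Fin n)).measure_preimage
    (MeasurableSet.univ_pi fun i => measurableSet_Ico).nullMeasurableSet, Real.volume_pi_Ico]
  have e (i : Fin n) : dyadicSide P * (P.2 i + 1) - dyadicSide P * P.2 i = dyadicSide P := by ring
  simp_rw [e]
  rw [Finset.prod_const, Finset.card_univ, Fintype.card_fin,
    ENNReal.ofReal_pow (dyadicSide_pos P).le]

theorem volume_dyadicCube_ne_zero (P : ℤ × (Fin n → ℤ)) : volume (dyadicCube P) ≠ 0 := by
  rw [volume_dyadicCube]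
  simpa using pow_pos (dyadicSide_pos P) n

theorem volume_dyadicCube_ne_top (P : ℤ × (Fin n → ℤ)) : volume (dyadicCube P) ≠ ∞ := by
  rw [volume_dyadicCube]; exact ENNReal.ofReal_ne_top

/-- The radius of a ball around the lowest corner of a dyadic cube which contains the cube. -/
noncomputable def dyadicRadius (P : ℤ × (Fin n → ℤ)) : ℝ := (n + 1) * dyadicSide P

theorem dyadicRadius_pos (P : ℤ × (Fin n → ℤ)) : 0 < dyadicRadius P :=
  mul_pos (by positivity) (dyadicSide_pos P)

theorem dyadicCube_subset_ball (P : ℤ × (Fin n → ℤ)) :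
    dyadicCube P ⊆ ball (dyadicCorner P) (dyadicRadius P) := by
  intro x hx
  rw [mem_dyadicCube_iff] at hx
  have hs := dyadicSide_pos P
  rw [mem_ball, EuclideanSpace.dist_eq]
  have h1 (i : Fin n) : dist (x i) (dyadicCorner P i) ^ 2 ≤ dyadicSide P ^ 2 := by
    have e : dyadicCorner P i = dyadicSide P * P.2 i := rfl
    rw [e, Real.dist_eq, sq_abs]
    have := (hx i).1
    have := (hx i).2
    apply pow_le_pow_left₀ <;> nlinarith
  calc √(∑ i, dist (x i) (dyadicCorner P i) ^ 2) ≤ √(n * dyadicSide P ^ 2) := by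
        apply Real.sqrt_le_sqrt
        refine (Finset.sum_le_sum fun i _ => h1 i).trans_eq ?_
        simp
    _ < dyadicRadius P := by
        rw [dyadicRadius, Real.sqrt_lt' (by positivity), mul_pow]
        gcongr
        nlinarith [(Nat.cast_nonneg n : (0 : ℝ) ≤ n)]

theorem dyadicCorner_mem_dyadicCube (P : ℤ × (Fin n → ℤ)) : dyadicCorner P ∈ dyadicCube P := by
  rw [mem_dyadicCube_iff]
  intro i
  have hs := dyadicSide_pos P
  have e : dyadicCorner P i = dyadicSide P * P.2 i := rfl
  rw [e]
  exact ⟨le_rfl, by gcongr; linarith⟩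

/-- Balls around the corner of a cube, with radius proportional to its side, have measure
proportional to that of the cube. -/
theorem volume_ball_dyadicRadius (P : ℤ × (Fin n → ℤ)) (c : Eucl n) {a : ℝ} (ha : 0 < a) :
    volume (ball c (a * dyadicRadius P)) =
      ENNReal.ofReal ((a * (n + 1)) ^ n) * volume (ball (0 : Eucl n) 1) *
        volume (dyadicCube P) := by
  have e : a * dyadicRadius P = (a * (n + 1) * dyadicSide P) * 1 := by
    rw [dyadicRadius]; ring
  have hs := dyadicSide_pos P
  rw [e, Eucl.volume_ball_mul c (by positivity), Measure.addHaar_ball_center, mul_pow,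
    ENNReal.ofReal_mul (by positivity), volume_dyadicCube]
  ring

/-- The cubes of a given side form a partition. -/
theorem iUnion_dyadicCube (k : ℤ) : ⋃ m : Fin n → ℤ, dyadicCube (k, m) = Set.univ :=
  Set.eq_univ_of_forall fun x => Set.mem_iUnion.2 ⟨_, mem_dyadicCube_dyadicAt k x⟩

theorem pairwise_disjoint_dyadicCube (k : ℤ) :
    Pairwise (Function.onFun Disjoint fun m : Fin n → ℤ => dyadicCube (k, m)) := by
  intro m m' hm
  refine Set.disjoint_left.2 fun x hx hx' => hm ?_
  have := (dyadicAt_eq (P := (k, m)) hx).symm.trans (dyadicAt_eq (P := (k, m')) hx')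
  exact congrArg Prod.snd this

/-- An open set of finite measure is covered by disjoint dyadic cubes, each of which has a fixed
part of its measure inside the open set and at least half of it outside: these are the maximal
cubes `P` with `|P| ≤ 2 ^ (n + 1) |P ∩ U|`. -/
theorem exists_dyadic_cover (hn : 1 ≤ n) {U : Set (Eucl n)} (hU : IsOpen U)
    (hfin : volume U ≠ ∞) : ∃ F : Set (ℤ × (Fin n → ℤ)), F.PairwiseDisjoint dyadicCube ∧
      U ⊆ ⋃ P ∈ F, dyadicCube P ∧
      ∀ P ∈ F, volume (dyadicCube P) ≤ 2 ^ (n + 1) * volume (dyadicCube P ∩ U) ∧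
        2 * volume (dyadicCube P ∩ U) ≤ volume (dyadicCube P) := by
  set sel : ℤ × (Fin n → ℤ) → Prop := fun P =>
    volume (dyadicCube P) ≤ 2 ^ (n + 1) * volume (dyadicCube P ∩ U) with hsel
  refine ⟨{P | sel P ∧ ∀ x ∈ dyadicCube P, ∀ j < P.1, ¬ sel (dyadicAt j x)}, ?_, ?_, ?_⟩
  · intro P hP R hR hPR
    refine Set.disjoint_left.2 fun x hxP hxR => hPR ?_
    have h1 : ¬ P.1 < R.1 := fun h => hR.2 x hxR _ h (by rw [dyadicAt_eq hxP]; exact hP.1)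
    have h2 : ¬ R.1 < P.1 := fun h => hP.2 x hxP _ h (by rw [dyadicAt_eq hxR]; exact hR.1)
    rw [← dyadicAt_eq hxP, ← dyadicAt_eq hxR, show P.1 = R.1 by omega]
  · intro x hx
    obtain ⟨ε, hε, hball⟩ := Metric.isOpen_iff.1 hU x hx
    obtain ⟨N, hN⟩ := exists_nat_gt ((2 * (n + 1)) / ε)
    -- The small cubes around a point of `U` lie in `U`, so they have the property.
    have hex : sel (dyadicAt N x) := by
      have : dyadicCube (dyadicAt N x) ⊆ U := by
        intro y hy
        apply hball
        have h1 := dyadicCube_subset_ball _ hy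
        have h2 := dyadicCube_subset_ball _ (mem_dyadicCube_dyadicAt N x)
        rw [mem_ball] at h1 h2 ⊢
        have h3 : 2 * dyadicRadius (dyadicAt N x) < ε := by
          have h4 : (N : ℝ) < 2 ^ N := by exact_mod_cast Nat.lt_two_pow_self
          have h5 : dyadicSide (dyadicAt N x) = ((2 : ℝ) ^ N)⁻¹ := by
            simp [dyadicSide, dyadicAt]
          have h6 : (0 : ℝ) < 2 ^ N := by positivity
          rw [dyadicRadius, h5, ← mul_assoc, ← div_eq_mul_inv, div_lt_iff₀ h6]
          rw [div_lt_iff₀ hε] at hN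
          nlinarith
        linarith [dist_triangle_right y x (dyadicCorner (dyadicAt N x))]
      simp only [hsel]
      rw [Set.inter_eq_left.2 this]
      exact le_mul_of_one_le_left (zero_le) (one_le_pow₀ (by norm_num))
    -- The large cubes fail it, since `U` has finite measure. So there is a maximal cube around `x`.
    have hbdd : ∃ b : ℤ, ∀ k : ℤ, sel (dyadicAt k x) → b ≤ k := by
      obtain ⟨M, hM⟩ := exists_nat_gt ((2 ^ (n + 1) * volume U).toReal)
      refine ⟨-M, fun k hk => ?_⟩
      by_contra! hlt
      have h1 : volume (dyadicCube (dyadicAt k x)) ≤ 2 ^ (n + 1) * volume U :=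
        hk.trans (by gcongr; exact Set.inter_subset_right)
      have hne : 2 ^ (n + 1) * volume U ≠ ∞ := by finiteness
      rw [volume_dyadicCube, ENNReal.ofReal_le_iff_le_toReal hne] at h1
      have h2 : (M : ℝ) ≤ dyadicSide (dyadicAt k x) ^ n := by
        have h4 : (M : ℝ) ≤ 2 ^ M := by exact_mod_cast Nat.lt_two_pow_self.le
        have h5 : (2 : ℝ) ^ M ≤ dyadicSide (dyadicAt k x) := by
          rw [← zpow_natCast]
          exact zpow_le_zpow_right₀ one_le_two (by simp only [dyadicAt]; omega)
        have h6 : (1 : ℝ) ≤ dyadicSide (dyadicAt k x) := (one_le_pow₀ one_le_two).trans h5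
        exact (h4.trans h5).trans (le_self_pow₀ h6 (by omega))
      linarith
    obtain ⟨k, hk, hmin⟩ := Int.exists_least_of_bdd hbdd ⟨N, hex⟩
    refine Set.mem_biUnion (x := dyadicAt k x) ⟨hk, ?_⟩ (mem_dyadicCube_dyadicAt k x)
    intro y hy j hj hsely
    have : dyadicAt j y = dyadicAt j x := by
      refine (dyadicAt_eq (P := dyadicAt j x) ?_)
      exact dyadicCube_subset (mem_dyadicCube_dyadicAt k x) (mem_dyadicCube_dyadicAt j x) hj.le hy
    rw [this] at hsely
    exact absurd (hmin j hsely) (not_le.2 hj)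
  · rintro P ⟨hP, hmax⟩
    refine ⟨hP, ?_⟩
    set c := dyadicCorner P
    have hc : c ∈ dyadicCube P := dyadicCorner_mem_dyadicCube P
    -- The parent `R` of a maximal cube `P` fails: `2 ^ (n + 1) |R ∩ U| < |R| = 2 ^ n |P|`.
    have h1 := hmax c hc (P.1 - 1) (by omega)
    simp only [hsel, not_le] at h1
    set R := dyadicAt (P.1 - 1) c
    have hPR : dyadicCube P ⊆ dyadicCube R :=
      dyadicCube_subset hc (mem_dyadicCube_dyadicAt _ c) (by simp [R, dyadicAt])
    have h2 : volume (dyadicCube R) = 2 ^ n * volume (dyadicCube P) := by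
      have : dyadicSide R = 2 * dyadicSide P := by
        simp only [dyadicSide, R, dyadicAt]
        rw [neg_sub, sub_eq_add_neg, zpow_add₀ two_ne_zero, zpow_one]
      rw [volume_dyadicCube, volume_dyadicCube, this, mul_pow, ENNReal.ofReal_mul (by positivity),
        ENNReal.ofReal_pow zero_le_two, ENNReal.ofReal_ofNat]
    rw [h2, pow_succ, mul_assoc] at h1
    have h3 : 2 * volume (dyadicCube R ∩ U) ≤ volume (dyadicCube P) :=
      ((ENNReal.mul_lt_mul_iff_right (by simp) (by finiteness)).1 h1).le
    exact (mul_le_mul_right (measure_mono (Set.inter_subset_inter_left _ hPR)) _).trans h3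

/-! ### Estimates for the kernel -/

/-- Splitting the exterior of a ball into dyadic annuli. -/
theorem lintegral_compl_ball_mul_le {n : ℕ} (c : Eucl n) {r : ℝ} (hr : 0 < r)
    {k u : Eucl n → ℝ≥0∞} {a : ℕ → ℝ≥0∞} (ha : ∀ j, a j ≠ ∞)
    (hk : ∀ j y, 2 ^ j * r ≤ dist y c → dist y c < 2 ^ (j + 1) * r → k y ≤ a j) :
    ∫⁻ y in (ball c r)ᶜ, k y * u y ≤ ∑' j, a j * ∫⁻ y in ball c (2 ^ (j + 1) * r), u y := by
  set S : ℕ → Set (Eucl n) := fun j => ball c (2 ^ (j + 1) * r) \ ball c (2 ^ j * r)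
  have hS (j : ℕ) : MeasurableSet (S j) := measurableSet_ball.diff measurableSet_ball
  have hsub : (ball c r)ᶜ ⊆ ⋃ j, S j := by
    intro y hy
    have h1 : 1 ≤ dist y c / r := by
      rw [le_div_iff₀ hr, one_mul]; simpa using hy
    obtain ⟨j, hj, hj'⟩ := exists_nat_pow_near h1 one_lt_two
    rw [le_div_iff₀ hr] at hj
    rw [div_lt_iff₀ hr] at hj'
    exact Set.mem_iUnion.2 ⟨j, by simpa using hj', by simpa using hj⟩
  calc _ ≤ ∫⁻ y in ⋃ j, S j, k y * u y := lintegral_mono_set hsub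
    _ ≤ ∑' j, ∫⁻ y in S j, k y * u y := lintegral_iUnion_le _ _
    _ ≤ ∑' j, ∫⁻ y in S j, a j * u y := by
        refine ENNReal.tsum_le_tsum fun j => ?_
        refine setLIntegral_mono' (hS j) fun y hy => ?_
        gcongr
        exact hk j y (by simpa using hy.2) (by simpa using hy.1)
    _ ≤ ∑' j, a j * ∫⁻ y in ball c (2 ^ (j + 1) * r), u y := by
        gcongr with j
        refine (lintegral_mono_set Set.sdiff_subset).trans ?_
        rw [lintegral_const_mul' _ _ (ha j)]

/-- For a function `θ` with the Dini property, the dyadic sum `∑ θ(2 ^ (-j - 1))` is finite. -/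
theorem IsDini.tsum_ne_top {θ : ℝ → ℝ} (hθ : IsDini θ) :
    ∑' j : ℕ, ENNReal.ofReal (θ ((1 / 2) ^ (j + 1))) ≠ ∞ := by
  set S : ℕ → Set ℝ := fun j => Set.Ico ((1 / 2) ^ (j + 1)) ((1 / 2) ^ j)
  have hfin : ∫⁻ t in Set.Ioo (0 : ℝ) 1, ENNReal.ofReal (θ t / t) ≠ ∞ :=
    hθ.integrable.lintegral_lt_top.ne
  have hdisj : Pairwise (Function.onFun Disjoint S) := by
    have h : Antitone fun j : ℕ => (1 / 2 : ℝ) ^ j :=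
      pow_right_anti₀ (by norm_num) (by norm_num)
    exact h.pairwise_disjoint_on_Ico_succ
  have hsub : ⋃ j, S j ⊆ Set.Ico (0 : ℝ) 1 := by
    refine Set.iUnion_subset fun j t ht => ⟨?_, ?_⟩
    · exact (by positivity : (0 : ℝ) ≤ (1 / 2) ^ (j + 1)).trans ht.1
    · exact ht.2.trans_le (pow_le_one₀ (by norm_num) (by norm_num))
  -- On `S j`, monotonicity gives `θ(t) / t ≥ θ(2 ^ (-j - 1)) / 2 ^ (-j)`, and `|S j| = 2 ^ (-j -
  -- 1)`.
  have key (j : ℕ) : ENNReal.ofReal (θ ((1 / 2) ^ (j + 1))) ≤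
      2 * ∫⁻ t in S j, ENNReal.ofReal (θ t / t) := by
    have hpos : (0 : ℝ) < (1 / 2) ^ (j + 1) := by positivity
    have hθ0 := hθ.nonneg _ hpos
    calc ENNReal.ofReal (θ ((1 / 2) ^ (j + 1)))
        = 2 * (ENNReal.ofReal (θ ((1 / 2) ^ (j + 1)) / (1 / 2) ^ j) * volume (S j)) := by
          rw [Real.volume_Ico, ← ENNReal.ofReal_mul (by positivity),
            show (2 : ℝ≥0∞) = ENNReal.ofReal 2 by simp, ← ENNReal.ofReal_mul (zero_le_two (α := ℝ))]
          congr 1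
          rw [pow_succ]
          field_simp
          ring
      _ ≤ 2 * ∫⁻ t in S j, ENNReal.ofReal (θ t / t) := by
          rw [← setLIntegral_const]
          gcongr 2 * ?_
          refine setLIntegral_mono' measurableSet_Ico fun t ht => ENNReal.ofReal_le_ofReal ?_
          have ht0 := hpos.trans_le ht.1
          have h1 := hθ.mono hpos ht0 ht.1
          exact div_le_div₀ (hθ0.trans h1) h1 ht0 ht.2.le
  refine ne_top_of_le_ne_top (ENNReal.mul_ne_top (a := 2) (by simp) hfin) ?_
  calc _ ≤ ∑' j, 2 * ∫⁻ t in S j, ENNReal.ofReal (θ t / t) := ENNReal.tsum_le_tsum key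
    _ = 2 * ∫⁻ t in ⋃ j, S j, ENNReal.ofReal (θ t / t) := by
        rw [ENNReal.tsum_mul_left, lintegral_iUnion (fun j => measurableSet_Ico) hdisj]
    _ ≤ 2 * ∫⁻ t in Set.Ioo (0 : ℝ) 1, ENNReal.ofReal (θ t / t) := by
        rw [setLIntegral_congr (Ioo_ae_eq_Ico (a := (0 : ℝ)) (b := 1) (μ := volume))]
        gcongr

/-- The volume of a ball is comparable to the power of the radius in the kernel bounds. -/
theorem ofReal_div_mul_volume_ball {n : ℕ} (c : Eucl n) {C r : ℝ} (hC : 0 ≤ C) (hr : 0 < r)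
    (j : ℕ) :
    ENNReal.ofReal (C / (2 ^ j * r) ^ n) * volume (ball c (2 ^ (j + 1) * r)) =
      ENNReal.ofReal (C * 2 ^ n) * volume (ball (0 : Eucl n) 1) := by
  rw [show (2 : ℝ) ^ (j + 1) * r = (2 * (2 ^ j * r)) * 1 by rw [pow_succ]; ring,
    Eucl.volume_ball_mul c (by positivity), Measure.addHaar_ball_center, ← mul_assoc,
    ← ENNReal.ofReal_mul (by positivity)]
  congr 2
  rw [mul_pow 2]
  field_simp

namespace IsThetaKernel

variable {n : ℕ} {θ : ℝ → ℝ} {K : Eucl n → Eucl n → ℂ}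

theorem exists_enorm_le (hK : IsThetaKernel θ K) :
    ∃ C : ℝ, 0 < C ∧ ∀ x y, x ≠ y → ‖K x y‖ₑ ≤ ENNReal.ofReal (C / dist x y ^ n) := by
  obtain ⟨C, hC, h, _⟩ := hK.bounds
  refine ⟨C, hC, fun x y hxy => ?_⟩
  rw [← ofReal_norm, dist_eq_norm]
  exact ENNReal.ofReal_le_ofReal (h x y hxy)

/-- Hörmander's condition, in either variable and against an arbitrary function `u ≥ 0` whose
averages over the large concentric balls are bounded by `M`. -/
theorem exists_lintegral_diff_le (hθ : IsDini θ) (hK : IsThetaKernel θ K) :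
    ∃ H : ℝ≥0, ∀ (c z : Eucl n) (ρ : ℝ), dist z c < ρ → ∀ (u : Eucl n → ℝ≥0∞) (M : ℝ≥0∞),
      (∀ r, ρ < r → ∫⁻ y in ball c r, u y ≤ M * volume (ball c r)) →
      ∫⁻ y in (ball c (2 * ρ))ᶜ, (‖K c y - K z y‖ₑ + ‖K y c - K y z‖ₑ) * u y ≤ H * M := by
  obtain ⟨C, hC, -, hreg⟩ := hK.bounds
  set s := ∑' j : ℕ, ENNReal.ofReal (θ ((1 / 2) ^ (j + 1)))
  set V := ENNReal.ofReal (C * 2 ^ n) * volume (ball (0 : Eucl n) 1)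
  have hV : V ≠ ∞ := ENNReal.mul_ne_top ENNReal.ofReal_ne_top measure_ball_lt_top.ne
  refine ⟨(V * s).toNNReal, fun c z ρ hz u M hM => ?_⟩
  rw [ENNReal.coe_toNNReal (ENNReal.mul_ne_top hV hθ.tsum_ne_top)]
  have hρ : 0 < ρ := dist_nonneg.trans_lt hz
  rcases eq_or_ne c z with rfl | hcz
  · simp
  have hdpos : 0 < ‖c - z‖ := norm_pos_iff.2 (sub_ne_zero.2 hcz)
  refine (lintegral_compl_ball_mul_le c (r := 2 * ρ) (by positivity)
    (a := fun j => ENNReal.ofReal (C / (2 ^ j * (2 * ρ)) ^ n) *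
      ENNReal.ofReal (θ ((1 / 2) ^ (j + 1)))) (fun j => ENNReal.mul_ne_top ENNReal.ofReal_ne_top
      ENNReal.ofReal_ne_top) ?_).trans ?_
  · intro j y hy _
    have e : ‖c - y‖ = dist y c := by rw [dist_comm, dist_eq_norm]
    have e' : ‖c - z‖ = dist z c := by rw [dist_comm, dist_eq_norm]
    have h2 : (1 : ℝ) ≤ 2 ^ j := one_le_pow₀ one_le_two
    have hpos : 0 < dist y c := by
      refine lt_of_lt_of_le ?_ hy; positivity
    have h1 := hreg c y z hcz (by rw [e, e']; nlinarith)
    rw [← ofReal_norm, ← ofReal_norm, ← ENNReal.ofReal_add (norm_nonneg _)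
      (norm_nonneg _), ← ENNReal.ofReal_mul (by positivity)]
    refine ENNReal.ofReal_le_ofReal (h1.trans ?_)
    rw [e]
    have hq : ‖c - z‖ / dist y c ≤ (1 / 2) ^ (j + 1) := by
      rw [div_le_iff₀ hpos, one_div, inv_pow, ← div_eq_inv_mul, le_div_iff₀ (by positivity),
        pow_succ, e']
      nlinarith
    have hq0 : 0 < ‖c - z‖ / dist y c := by positivity
    exact mul_le_mul (by gcongr) (hθ.mono hq0 (by simp) hq) (hθ.nonneg _ hq0) (by positivity)
  · calc _ ≤ ∑' j : ℕ, V * M * ENNReal.ofReal (θ ((1 / 2) ^ (j + 1))) := by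
          refine ENNReal.tsum_le_tsum fun j => ?_
          have h2 : (1 : ℝ) ≤ 2 ^ (j + 1) := one_le_pow₀ one_le_two
          calc _ ≤ ENNReal.ofReal (C / (2 ^ j * (2 * ρ)) ^ n) *
                ENNReal.ofReal (θ ((1 / 2) ^ (j + 1))) *
                (M * volume (ball c (2 ^ (j + 1) * (2 * ρ)))) := by
                gcongr
                exact hM _ (by nlinarith)
            _ = (ENNReal.ofReal (C / (2 ^ j * (2 * ρ)) ^ n) *
                volume (ball c (2 ^ (j + 1) * (2 * ρ)))) * M *
                ENNReal.ofReal (θ ((1 / 2) ^ (j + 1))) := by ring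
            _ = _ := by
                rw [ofReal_div_mul_volume_ball c hC.le (by positivity)]
      _ = _ := by rw [ENNReal.tsum_mul_left]; ring

theorem lintegral_sq_ne_top (hn : 1 ≤ n) (hK : IsThetaKernel θ K) (x : Eucl n) {r : ℝ}
    (hr : 0 < r) : ∫⁻ y in (ball x r)ᶜ, ‖K x y‖ₑ ^ 2 ≠ ∞ := by
  obtain ⟨C, hC, hsize⟩ := hK.exists_enorm_le
  set V := ENNReal.ofReal (C * 2 ^ n) * volume (ball (0 : Eucl n) 1)
  have hV : V ≠ ∞ := ENNReal.mul_ne_top ENNReal.ofReal_ne_top measure_ball_lt_top.ne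
  have h1 := lintegral_compl_ball_mul_le x hr (k := fun y => ‖K x y‖ₑ ^ 2) (u := fun _ => 1)
    (a := fun j => ENNReal.ofReal (C / (2 ^ j * r) ^ n) ^ 2)
    (fun j => ENNReal.pow_ne_top ENNReal.ofReal_ne_top) ?_
  · simp only [mul_one, setLIntegral_one] at h1
    refine ne_top_of_le_ne_top ?_ h1
    have h2 (j : ℕ) : ENNReal.ofReal (C / (2 ^ j * r) ^ n) ^ 2 *
        volume (ball x (2 ^ (j + 1) * r)) ≤ ENNReal.ofReal (C / r ^ n) * V * (1 / 2) ^ j := by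
      rw [sq, mul_assoc, ofReal_div_mul_volume_ball x hC.le hr]
      have : ENNReal.ofReal (C / (2 ^ j * r) ^ n) ≤ ENNReal.ofReal (C / r ^ n) * (1 / 2) ^ j := by
        have e : (1 / 2 : ℝ≥0∞) ^ j = ENNReal.ofReal ((1 / 2) ^ j) := by
          rw [ENNReal.ofReal_pow (by norm_num), ENNReal.ofReal_div_of_pos two_pos]
          simp
        rw [e, ← ENNReal.ofReal_mul (by positivity)]
        apply ENNReal.ofReal_le_ofReal
        rw [mul_pow, one_div, inv_pow, ← div_eq_mul_inv, div_div, mul_comm (r ^ n)]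
        have h3 : (2 : ℝ) ^ j ≤ (2 ^ j) ^ n := le_self_pow₀ (one_le_pow₀ one_le_two) (by omega)
        gcongr
      calc _ ≤ ENNReal.ofReal (C / r ^ n) * (1 / 2) ^ j * V := by gcongr
        _ = _ := by ring
    refine ne_top_of_le_ne_top ?_ (ENNReal.tsum_le_tsum h2)
    rw [ENNReal.tsum_mul_left, ENNReal.tsum_geometric]
    refine ENNReal.mul_ne_top (ENNReal.mul_ne_top ENNReal.ofReal_ne_top hV) ?_
    simp
  · intro j y hy _
    have h0 : 0 < 2 ^ j * r := by positivity
    have hxy : x ≠ y := by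
      rintro rfl
      rw [dist_self] at hy
      linarith
    gcongr
    refine (hsize x y hxy).trans (ENNReal.ofReal_le_ofReal ?_)
    rw [dist_comm]
    gcongr

end IsThetaKernel

/-! ### The action of the operator on square integrable functions -/

open Filter Topology in
/-- `L^p` convergence, for functions, gives almost everywhere convergence of a subsequence. -/
theorem exists_subseq_ae_tendsto {α : Type*} [MeasurableSpace α] {μ : Measure α} {p : ℝ≥0∞}
    (hp : p ≠ 0) {f : ℕ → α → ℂ} {g : α → ℂ} (hf : ∀ k, AEStronglyMeasurable (f k) μ)
    (hg : AEStronglyMeasurable g μ) (h : Tendsto (fun k => eLpNorm (f k - g) p μ) atTop (𝓝 0)) :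
    ∃ ns : ℕ → ℕ, StrictMono ns ∧
      ∀ᵐ x ∂μ, Tendsto (fun k => f (ns k) x) atTop (𝓝 (g x)) :=
  (tendstoInMeasure_of_tendsto_eLpNorm hp hf hg h).exists_seq_tendsto_ae

namespace ThetaCZO

variable {n : ℕ} {θ : ℝ → ℝ}

/-- The action of `T` on functions: a representative of `T f` if `f` is square integrable, and the
junk value `0` otherwise. -/
noncomputable def app (T : ThetaCZO n θ) (f : Eucl n → ℂ) : Eucl n → ℂ :=
  open Classical in if h : MemLp f 2 volume then T.l2Ext (h.toLp f) else 0

variable (T : ThetaCZO n θ) {f g : Eucl n → ℂ}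

theorem app_eq (hf : MemLp f 2 volume) : T.app f = T.l2Ext (hf.toLp f) := by
  rw [app, dif_pos hf]

theorem memLp_app (f : Eucl n → ℂ) : MemLp (T.app f) 2 volume := by
  by_cases hf : MemLp f 2 volume
  · rw [app_eq T hf]; exact Lp.memLp _
  · rw [app, dif_neg hf]; exact MemLp.zero'

theorem aestronglyMeasurable_app (f : Eucl n → ℂ) : AEStronglyMeasurable (T.app f) :=
  (T.memLp_app f).1

theorem app_coe (f : Lp ℂ 2 (volume : Measure (Eucl n))) : T.app f = T.l2Ext f := by
  rw [T.app_eq (Lp.memLp f), Lp.toLp_coeFn]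

theorem app_congr (h : f =ᵐ[volume] g) : T.app f = T.app g := by
  by_cases hf : MemLp f 2 volume
  · have hg := hf.ae_eq h
    rw [T.app_eq hf, T.app_eq hg, (MemLp.toLp_eq_toLp_iff hf hg).2 h]
  · rw [app, app, dif_neg hf, dif_neg fun hg => hf (hg.ae_eq h.symm)]

theorem app_add (hf : MemLp f 2 volume) (hg : MemLp g 2 volume) :
    T.app (f + g) =ᵐ[volume] T.app f + T.app g := by
  rw [T.app_eq hf, T.app_eq hg, T.app_eq (hf.add hg), MemLp.toLp_add hf hg, map_add]
  exact Lp.coeFn_add _ _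

theorem app_sub (hf : MemLp f 2 volume) (hg : MemLp g 2 volume) :
    T.app (f - g) =ᵐ[volume] T.app f - T.app g := by
  rw [T.app_eq hf, T.app_eq hg, T.app_eq (hf.sub hg), MemLp.toLp_sub hf hg, map_sub]
  exact Lp.coeFn_sub _ _

theorem app_zero : T.app 0 =ᵐ[volume] 0 := by
  rw [T.app_eq MemLp.zero, MemLp.toLp_zero, map_zero]
  exact Lp.coeFn_zero _ _ _

theorem app_sum {ι : Type*} (s : Finset ι) {b : ι → Eucl n → ℂ} (hb : ∀ i, MemLp (b i) 2 volume) :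
    T.app (∑ i ∈ s, b i) =ᵐ[volume] ∑ i ∈ s, T.app (b i) := by
  classical
  induction s using Finset.induction_on with
  | empty => simpa using T.app_zero
  | insert i s hi ih =>
    rw [Finset.sum_insert hi, Finset.sum_insert hi]
    exact (T.app_add (hb i) (memLp_finsetSum' s fun i _ => hb i)).trans
      (Filter.EventuallyEq.rfl.add ih)

theorem eLpNorm_app_le (f : Eucl n → ℂ) :
    eLpNorm (T.app f) 2 volume ≤ ‖T.l2Ext‖ₑ * eLpNorm f 2 volume := by
  by_cases h : MemLp f 2 volume
  · have h1 := T.l2Ext.le_opENorm (h.toLp f)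
    rwa [Lp.enorm_def, Lp.enorm_def, ← T.app_eq h, eLpNorm_congr_ae h.coeFn_toLp] at h1
  · rw [app, dif_neg h]; simp

open Filter Topology in
/-- If `f k → g` in `L²` then `T (f k) → T g` almost everywhere along a subsequence. -/
theorem exists_subseq_app_tendsto {f : ℕ → Eucl n → ℂ} (hf : ∀ k, MemLp (f k) 2 volume)
    (hg : MemLp g 2 volume) (h : Tendsto (fun k => eLpNorm (f k - g) 2 volume) atTop (𝓝 0)) :
    ∃ ns : ℕ → ℕ, StrictMono ns ∧
      ∀ᵐ x, Tendsto (fun k => T.app (f (ns k)) x) atTop (𝓝 (T.app g x)) := by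
  refine exists_subseq_ae_tendsto (p := 2) (f := fun k => T.app (f k)) (g := T.app g) (by simp)
    (fun k => T.aestronglyMeasurable_app _) (T.aestronglyMeasurable_app _) ?_
  have h1 (k : ℕ) : eLpNorm (T.app (f k) - T.app g) 2 volume ≤
      ‖T.l2Ext‖ₑ * eLpNorm (f k - g) 2 volume := by
    rw [← eLpNorm_congr_ae (T.app_sub (hf k) hg)]
    exact T.eLpNorm_app_le _
  refine tendsto_of_tendsto_of_tendsto_of_le_of_le tendsto_const_nhds ?_ (fun _ => zero_le) h1
  simpa using ENNReal.Tendsto.const_mul h (.inr (enorm_ne_top))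

section Kernel

theorem measurable_kernel_left (hK : Measurable (Function.uncurry T.kernel)) (x : Eucl n) :
    Measurable (T.kernel x) :=
  hK.comp measurable_prodMk_left

theorem measurable_kernel_right (hK : Measurable (Function.uncurry T.kernel)) (y : Eucl n) :
    Measurable (fun x => T.kernel x y) :=
  hK.comp measurable_prodMk_right

theorem memLp_indicator_kernel (hn : 1 ≤ n) (hK : Measurable (Function.uncurry T.kernel))
    (x : Eucl n) {r : ℝ} (hr : 0 < r) :
    MemLp ((ball x r)ᶜ.indicator (T.kernel x)) 2 volume := by
  refine ⟨((T.measurable_kernel_left hK x).indicator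
    measurableSet_ball.compl).aestronglyMeasurable, ?_⟩
  rw [eLpNorm_indicator_eq_eLpNorm_restrict measurableSet_ball.compl,
    eLpNorm_lt_top_iff_lintegral_rpow_enorm_lt_top two_ne_zero ENNReal.ofNat_ne_top]
  simpa using (T.isThetaKernel.lintegral_sq_ne_top hn x hr).lt_top

/-- The kernel integral of a function vanishing near `x` is the integral of a product of two square
integrable functions. -/
theorem indicator_kernel_mul {x : Eucl n} {r : ℝ} (h0 : ∀ᵐ y, y ∈ ball x r → f y = 0) :
    (fun y => T.kernel x y * f y) =ᵐ[volume] (ball x r)ᶜ.indicator (T.kernel x) • f := by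
  filter_upwards [h0] with y hy
  by_cases hyb : y ∈ ball x r
  · simp [hyb, hy hyb]
  · rw [Pi.smul_apply', Set.indicator_of_mem (show y ∈ (ball x r)ᶜ from hyb), smul_eq_mul]

theorem integrable_kernel_mul (hn : 1 ≤ n) (hK : Measurable (Function.uncurry T.kernel))
    (hf : MemLp f 2 volume) {x : Eucl n} {r : ℝ} (hr : 0 < r)
    (h0 : ∀ᵐ y, y ∈ ball x r → f y = 0) : Integrable (fun y => T.kernel x y * f y) := by
  rw [integrable_congr (T.indicator_kernel_mul h0), ← memLp_one_iff_integrable]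
  exact hf.smul (T.memLp_indicator_kernel hn hK x hr)

open Filter Topology in
/-- The kernel represents `T` on square integrable functions vanishing on a ball, inside a smaller
ball. They are `L²` limits of smooth functions vanishing on a ball in between. -/
theorem app_eq_integral_of_ball (hn : 1 ≤ n) (hK : Measurable (Function.uncurry T.kernel))
    (hf : MemLp f 2 volume) (x₀ : Eucl n) {r R : ℝ} (hr : 0 < r) (hrR : r < R)
    (h0 : ∀ᵐ x, x ∈ ball x₀ R → f x = 0) :
    ∀ᵐ x, x ∈ ball x₀ r → T.app f x = ∫ y, T.kernel x y * f y := by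
  set ρ := (r + R) / 2 with hρ
  have hrρ : r < ρ := by rw [hρ]; linarith
  have hρR : ρ < R := by rw [hρ]; linarith
  let φ : ContDiffBump x₀ := ⟨ρ, R, hr.trans hrρ, hρR⟩
  have hex (k : ℕ) : ∃ h : Eucl n → ℂ, HasCompactSupport h ∧ ContDiff ℝ (⊤ : ℕ∞) h ∧
      (∀ x ∈ ball x₀ ρ, h x = 0) ∧ eLpNorm (h - f) 2 volume ≤ ENNReal.ofReal (1 / (k + 1)) := by
    obtain ⟨g, hg1, hg2, hg3⟩ := hf.exist_eLpNorm_sub_le (by simp) (by norm_num)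
      (ε := 1 / (k + 1)) (by positivity)
    refine ⟨fun x => ((1 - φ x : ℝ) : ℂ) * g x, hg1.mul_left, ?_, ?_, ?_⟩
    · refine ContDiff.mul ?_ hg2
      exact Complex.ofRealCLM.contDiff.comp (contDiff_const.sub φ.contDiff)
    · intro x hx
      simp only
      rw [φ.one_of_mem_closedBall (ball_subset_closedBall hx)]
      simp
    · refine le_trans (eLpNorm_mono_ae ?_) hg3
      filter_upwards [h0] with x hx
      have e : (((1 - φ x : ℝ) : ℂ) * f x) = f x := by
        by_cases hxR : x ∈ ball x₀ R
        · rw [hx hxR, mul_zero]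
        · rw [φ.zero_of_le_dist (by simpa using hxR)]; simp
      rw [Pi.sub_apply, Pi.sub_apply, ← norm_neg (f x - g x), neg_sub]
      nth_rw 1 [← e]
      rw [← mul_sub, norm_mul, Complex.norm_real, Real.norm_eq_abs,
        abs_of_nonneg (sub_nonneg.2 φ.le_one)]
      exact mul_le_of_le_one_left (norm_nonneg _) (by linarith [φ.nonneg' x])
  choose h hcs hsm hzero hle using hex
  have hmem (k : ℕ) : MemLp (h k) 2 volume :=
    (hsm k).continuous.memLp_of_hasCompactSupport (hcs k)
  have hlim : Tendsto (fun k => eLpNorm (h k - f) 2 volume) atTop (𝓝 0) := by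
    refine tendsto_of_tendsto_of_tendsto_of_le_of_le tendsto_const_nhds ?_ (fun _ => zero_le) hle
    rw [← ENNReal.ofReal_zero]
    exact (ENNReal.continuous_ofReal.tendsto 0).comp tendsto_one_div_add_atTop_nhds_zero_nat
  obtain ⟨ns, hns, hae⟩ := T.exists_subseq_app_tendsto hmem hf hlim
  have hrep (k : ℕ) : ∀ᵐ x, x ∉ tsupport (h k) → T.app (h k) x = ∫ y, T.kernel x y * h k y := by
    have := T.eq_integral ((hcs k).toSchwartzMap (hsm k)) (hcs k)
    rw [T.app_eq (hmem k)]
    exact this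
  filter_upwards [hae, ae_all_iff.2 hrep] with x hx hxrep hxr
  have hsupp (k : ℕ) : x ∉ tsupport (h k) := by
    intro hxk
    have : tsupport (h k) ⊆ (ball x₀ ρ)ᶜ :=
      closure_minimal (fun y hy hyb => hy (hzero k y hyb)) isOpen_ball.isClosed_compl
    exact this hxk (ball_subset_ball hrρ.le hxr)
  have hsub : ball x (ρ - r) ⊆ ball x₀ ρ := by
    intro y hy
    rw [mem_ball] at hy hxr ⊢
    linarith [dist_triangle y x x₀]
  have hkz (k : ℕ) : ∀ᵐ y, y ∈ ball x (ρ - r) → h k y = 0 :=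
    .of_forall fun y hy => hzero k y (hsub hy)
  have hfz : ∀ᵐ y, y ∈ ball x (ρ - r) → f y = 0 :=
    h0.mono fun y hy hyb => hy (ball_subset_ball hρR.le (hsub hyb))
  have hpos : 0 < ρ - r := by linarith
  refine tendsto_nhds_unique hx ?_
  have e (k : ℕ) : T.app (h (ns k)) x = ∫ y, T.kernel x y * h (ns k) y := hxrep _ (hsupp _)
  simp_rw [e]
  have hKm := T.memLp_indicator_kernel hn hK x hpos
  have hlim1 : Tendsto (fun k => ∫ y, T.kernel x y * h k y) atTop
      (𝓝 (∫ y, T.kernel x y * f y)) := by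
    refine tendsto_integral_of_L1 _ (T.integrable_kernel_mul hn hK hf hpos hfz).1
      (.of_forall fun k => T.integrable_kernel_mul hn hK (hmem k) hpos (hkz k)) ?_
    have hb (k : ℕ) : ∫⁻ y, ‖T.kernel x y * h k y - T.kernel x y * f y‖ₑ ≤
        eLpNorm ((ball x (ρ - r))ᶜ.indicator (T.kernel x)) 2 volume *
          eLpNorm (h k - f) 2 volume := by
      refine le_trans (le_of_eq ?_) (eLpNorm_smul_le_mul_eLpNorm (r := 1) ((hmem k).sub hf).1 hKm.1)
      rw [eLpNorm_one_eq_lintegral_enorm]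
      refine lintegral_congr_ae ?_
      filter_upwards [T.indicator_kernel_mul (f := h k - f) (x := x) (r := ρ - r) (by
        filter_upwards [hfz] with y hy hyb
        simp [hy hyb, hzero k y (hsub hyb)])] with y hy
      rw [← hy, Pi.sub_apply, mul_sub]
    refine tendsto_of_tendsto_of_tendsto_of_le_of_le tendsto_const_nhds ?_ (fun _ => zero_le) hb
    simpa using ENNReal.Tendsto.const_mul hlim (.inr hKm.eLpNorm_ne_top)
  exact hlim1.comp hns.tendsto_atTop

/-- The kernel represents `T f` on every open set where `f` vanishes. -/
theorem app_eq_integral (hn : 1 ≤ n) (hK : Measurable (Function.uncurry T.kernel))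
    (hf : MemLp f 2 volume) {V : Set (Eucl n)} (hV : IsOpen V) (h0 : ∀ᵐ x, x ∈ V → f x = 0) :
    ∀ᵐ x, x ∈ V → T.app f x = ∫ y, T.kernel x y * f y := by
  have h1 : volume {x | x ∈ V ∧ ¬ T.app f x = ∫ y, T.kernel x y * f y} = 0 := by
    refine measure_null_of_locally_null _ fun x hx => ?_
    obtain ⟨R, hR, hRV⟩ := Metric.isOpen_iff.1 hV x hx.1
    refine ⟨ball x (R / 2) ∩ {x | x ∈ V ∧ ¬ T.app f x = ∫ y, T.kernel x y * f y},
      Filter.inter_mem (mem_nhdsWithin_of_mem_nhds (ball_mem_nhds x (half_pos hR)))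
        self_mem_nhdsWithin, ?_⟩
    have h2 := T.app_eq_integral_of_ball hn hK hf x (half_pos hR) (half_lt_self hR)
      (h0.mono fun y hy hyb => hy (hRV hyb))
    refine measure_mono_null ?_ (ae_iff.1 h2)
    exact fun y hy h => hy.2.2 (h hy.1)
  rw [ae_iff]
  refine measure_mono_null (fun x hx => ?_) h1
  simpa using hx

end Kernel

end ThetaCZO

/-! ### The weak type `(1, 1)` bound -/

open Filter Topology in
theorem ae_le_maxFn {n : ℕ} {u : Eucl n → ℝ≥0∞} (hu : AEMeasurable u) (hfin : ∫⁻ y, u y ≠ ∞) :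
    ∀ᵐ x, u x ≤ maxFn volume u x := by
  filter_upwards [(Besicovitch.vitaliFamily (volume : Measure (Eucl n))).ae_tendsto_lintegral_div
    hu hfin] with x hx
  refine le_of_tendsto (hx.comp (Besicovitch.tendsto_filterAt volume x)) ?_
  filter_upwards [self_mem_nhdsWithin] with r hr
  have h1 : volume (closedBall x r) = volume (ball x r) := by
    rw [Measure.addHaar_closedBall _ x (le_of_lt hr), Measure.addHaar_ball_of_pos _ x hr]
  have h2 : ball x r =ᵐ[volume] closedBall x r :=
    ae_eq_of_subset_of_measure_ge ball_subset_closedBall h1.le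
      measurableSet_ball.nullMeasurableSet measure_closedBall_lt_top.ne
  simp only [Function.comp_apply]
  rw [h1, ← setLIntegral_congr h2]
  exact le_maxFn (mem_ball_self hr)

/-- The constant in the comparison of averages over a dyadic cube and over the ball with `a` times
its radius. -/
noncomputable def cubeConst (n : ℕ) (a : ℝ) : ℝ≥0 :=
  (ENNReal.ofReal ((a * (n + 1)) ^ n) * volume (ball (0 : Eucl n) 1)).toNNReal

theorem volume_ball_eq_cubeConst_mul {n : ℕ} (P : ℤ × (Fin n → ℤ)) (c : Eucl n) {a : ℝ}
    (ha : 0 < a) :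
    volume (ball c (a * dyadicRadius P)) = cubeConst n a * volume (dyadicCube P) := by
  rw [volume_ball_dyadicRadius P c ha, cubeConst, ENNReal.coe_toNNReal]
  exact ENNReal.mul_ne_top ENNReal.ofReal_ne_top measure_ball_lt_top.ne

/-- The integral over a ball around a dyadic cube is controlled by the value of the maximal function
at any point of the cube. -/
theorem lintegral_ball_le_maxFn {n : ℕ} (P : ℤ × (Fin n → ℤ)) {u : Eucl n → ℝ≥0∞} {x : Eucl n}
    (hx : x ∈ dyadicCube P) {a : ℝ} (ha : 1 ≤ a) :
    ∫⁻ y in ball (dyadicCorner P) (a * dyadicRadius P), u y ≤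
      cubeConst n a * volume (dyadicCube P) * maxFn volume u x := by
  rw [← volume_ball_eq_cubeConst_mul P (dyadicCorner P) (by linarith),
    mul_comm (volume _)]
  refine (Eucl.ballDoubling_volume n).lintegral_ball_le ?_
  refine ball_subset_ball ?_ (dyadicCube_subset_ball P hx)
  exact le_mul_of_one_le_left (dyadicRadius_pos P).le ha

theorem lintegral_dyadicCube_le_maxFn {n : ℕ} (P : ℤ × (Fin n → ℤ)) {u : Eucl n → ℝ≥0∞}
    {x : Eucl n} (hx : x ∈ dyadicCube P) :
    ∫⁻ y in dyadicCube P, u y ≤ cubeConst n 1 * volume (dyadicCube P) * maxFn volume u x := by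
  refine le_trans (lintegral_mono_set ?_) (lintegral_ball_le_maxFn P hx le_rfl)
  simpa using dyadicCube_subset_ball P

theorem exists_mem_dyadicCube_notMem {n : ℕ} {P : ℤ × (Fin n → ℤ)} {U : Set (Eucl n)}
    (h : 2 * volume (dyadicCube P ∩ U) ≤ volume (dyadicCube P)) : ∃ x ∈ dyadicCube P, x ∉ U := by
  by_contra! hc
  rw [Set.inter_eq_left.2 hc, two_mul] at h
  have h0 := volume_dyadicCube_ne_zero P
  have ht := volume_dyadicCube_ne_top P
  exact h.not_gt (ENNReal.lt_add_right ht h0)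

namespace ThetaCZO

variable {n : ℕ} {θ : ℝ → ℝ} (T : ThetaCZO n θ)

/-- The cancellation of `b` and the smoothness of the kernel make `T b` integrable away from the
support of `b`. -/
theorem lintegral_app_le_of_integral_eq_zero (hn : 1 ≤ n)
    (hK : Measurable (Function.uncurry T.kernel)) {H : ℝ≥0}
    (hH : ∀ (c z : Eucl n) (ρ : ℝ), dist z c < ρ →
      ∫⁻ x in (ball c (2 * ρ))ᶜ, ‖T.kernel x c - T.kernel x z‖ₑ ≤ H)
    {b : Eucl n → ℂ} (hb : MemLp b 2 volume) (hb1 : Integrable b) (hint : ∫ y, b y = 0)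
    {c : Eucl n} {ρ : ℝ} (hρ : 0 < ρ) (hsupp : ∀ y ∉ ball c ρ, b y = 0) :
    ∫⁻ x in (ball c (2 * ρ))ᶜ, ‖T.app b x‖ₑ ≤ H * ∫⁻ y, ‖b y‖ₑ := by
  have hV : IsOpen (closedBall c ρ)ᶜ := isClosed_closedBall.isOpen_compl
  have h0 : ∀ y, y ∈ (closedBall c ρ)ᶜ → b y = 0 :=
    fun y hy => hsupp y fun h => hy (ball_subset_closedBall h)
  have hrep := T.app_eq_integral hn hK hb hV (.of_forall h0)
  have hm : Measurable fun z : Eucl n × Eucl n => T.kernel z.1 c - T.kernel z.1 z.2 :=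
    ((T.measurable_kernel_right hK c).comp measurable_fst).sub hK
  calc ∫⁻ x in (ball c (2 * ρ))ᶜ, ‖T.app b x‖ₑ
      ≤ ∫⁻ x in (ball c (2 * ρ))ᶜ, ∫⁻ y, ‖T.kernel x c - T.kernel x y‖ₑ * ‖b y‖ₑ := by
        refine lintegral_mono_ae ?_
        filter_upwards [ae_restrict_of_ae hrep, ae_restrict_mem measurableSet_ball.compl]
          with x hx hxc
        have hxd : 2 * ρ ≤ dist x c := by simpa using hxc
        rw [hx (by simp only [Set.mem_compl_iff, mem_closedBall, not_le]; linarith)]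
        have hi1 : Integrable fun y => T.kernel x y * b y := by
          refine T.integrable_kernel_mul hn hK hb hρ (.of_forall fun y hy => hsupp y fun hyc => ?_)
          rw [mem_ball] at hy hyc
          linarith [dist_triangle_left x c y]
        have hi2 : Integrable fun y => T.kernel x c * b y := hb1.const_mul _
        -- As `b` has mean zero, the constant `K(x, c)` may be subtracted from the kernel.
        have e : ∫ y, T.kernel x y * b y = -∫ y, (T.kernel x c - T.kernel x y) * b y := by
          simp_rw [sub_mul]
          rw [integral_sub hi2 hi1, integral_const_mul, hint]
          ring
        rw [e, enorm_neg]
        refine (enorm_integral_le_lintegral_enorm _).trans_eq ?_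
        simp_rw [enorm_mul]
    _ = ∫⁻ y, (∫⁻ x in (ball c (2 * ρ))ᶜ, ‖T.kernel x c - T.kernel x y‖ₑ) * ‖b y‖ₑ := by
        rw [lintegral_lintegral_swap]
        · refine lintegral_congr fun y => ?_
          rw [lintegral_mul_const]
          exact (hm.comp (measurable_prodMk_right (y := y))).enorm
        · exact hm.enorm.aemeasurable.mul hb.1.enorm.comp_snd
    _ ≤ ∫⁻ y, H * ‖b y‖ₑ := by
        refine lintegral_mono fun y => ?_
        by_cases hy : y ∈ ball c ρ
        · exact mul_le_mul_left (hH c y ρ hy) _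
        · simp [hsupp y hy]
    _ = H * ∫⁻ y, ‖b y‖ₑ := lintegral_const_mul' _ _ (by simp)

end ThetaCZO

open Filter Topology in
/-- Cutting an `L^p` function off to sets which exhaust the space approximates it in `L^p`. -/
theorem tendsto_eLpNorm_indicator_sub {α : Type*} [MeasurableSpace α] {μ : Measure α} {p : ℝ≥0∞}
    (hp0 : p ≠ 0) (hp : p ≠ ∞) {f : α → ℂ} (hf : MemLp f p μ) {G : ℕ → Set α}
    (hG : ∀ k, MeasurableSet (G k)) (hex : ∀ x, ∀ᶠ k in atTop, x ∈ G k) :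
    Tendsto (fun k => eLpNorm ((G k).indicator f - f) p μ) atTop (𝓝 0) := by
  have hp' := ENNReal.toReal_pos hp0 hp
  have h1 : Tendsto (fun k => ∫⁻ x, ‖((G k).indicator f - f) x‖ₑ ^ p.toReal ∂μ) atTop
      (𝓝 (∫⁻ _, 0 ∂μ)) := by
    refine tendsto_lintegral_of_dominated_convergence' (fun x => ‖f x‖ₑ ^ p.toReal) (fun k =>
      ((hf.1.indicator (hG k)).sub hf.1).enorm.pow_const _) (fun k => .of_forall fun x => ?_) ?_
      (.of_forall fun x => ?_)
    · by_cases hx : x ∈ G k <;> simp [hx, hp']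
    · exact (lintegral_rpow_enorm_lt_top_of_eLpNorm_lt_top hp0 hp hf.2).ne
    · refine tendsto_const_nhds.congr' ?_
      filter_upwards [hex x] with k hk
      simp [hk, hp']
  simp_rw [eLpNorm_eq_lintegral_rpow_enorm_toReal hp0 hp]
  have h2 := h1.ennrpow_const (1 / p.toReal)
  simpa [hp'] using h2

/-- Chebyshev's inequality in `L²` at height `t / 2`, divided by `t`. -/
theorem ENNReal.mul_le_of_sq {t m a : ℝ≥0∞} (ht : t ≠ 0) (ht' : t ≠ ∞)
    (h : (t / 2) ^ 2 * m ≤ t * a) : t * m ≤ 4 * a := by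
  have e : (t / 2) ^ 2 * m * 4 = t * (t * m) := by
    rw [div_eq_mul_inv, mul_pow]
    calc t ^ 2 * 2⁻¹ ^ 2 * m * 4 = (2⁻¹ * 2) ^ 2 * (t * (t * m)) := by ring
      _ = _ := by rw [ENNReal.inv_mul_cancel two_ne_zero ENNReal.ofNat_ne_top]; simp
  have h2 := mul_le_mul_left h 4
  rw [e, mul_assoc, ENNReal.mul_le_mul_iff_right ht ht', mul_comm a] at h2
  exact h2

namespace ThetaCZO

variable {n : ℕ} {θ : ℝ → ℝ} (T : ThetaCZO n θ)

/-- The mean-free part of a function on a dyadic cube, extended by zero. -/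
noncomputable def badPart (f : Eucl n → ℂ) (P : ℤ × (Fin n → ℤ)) : Eucl n → ℂ :=
  (dyadicCube P).indicator fun y => f y - ⨍ z in dyadicCube P, f z

theorem enorm_setAverage_mul_le (f : Eucl n → ℂ) (P : ℤ × (Fin n → ℤ)) :
    ‖⨍ z in dyadicCube P, f z‖ₑ * volume (dyadicCube P) ≤ ∫⁻ z in dyadicCube P, ‖f z‖ₑ := by
  have h0 := volume_dyadicCube_ne_zero P
  have ht := volume_dyadicCube_ne_top P
  rw [setAverage_eq, enorm_smul, Measure.real, enorm_inv (ENNReal.toReal_ne_zero.2 ⟨h0, ht⟩),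
    Real.enorm_eq_ofReal ENNReal.toReal_nonneg, ENNReal.ofReal_toReal ht]
  rw [mul_comm, ← mul_assoc, ENNReal.mul_inv_cancel h0 ht, one_mul]
  exact enorm_integral_le_lintegral_enorm _

variable {f : Eucl n → ℂ}

theorem memLp_const_indicator (P : ℤ × (Fin n → ℤ)) (a : ℂ) (q : ℝ≥0∞) :
    MemLp ((dyadicCube P).indicator fun _ => a) q (volume : Measure (Eucl n)) :=
  memLp_indicator_const q (measurableSet_dyadicCube P) a (.inr (volume_dyadicCube_ne_top P))

theorem badPart_eq (f : Eucl n → ℂ) (P : ℤ × (Fin n → ℤ)) : badPart f P =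
    (dyadicCube P).indicator f - (dyadicCube P).indicator fun _ => ⨍ z in dyadicCube P, f z := by
  rw [← Set.indicator_sub']; rfl

theorem memLp_badPart {q : ℝ≥0∞} (hf : MemLp f q volume) (P : ℤ × (Fin n → ℤ)) :
    MemLp (badPart f P) q volume := by
  rw [badPart_eq]
  exact (hf.indicator (measurableSet_dyadicCube P)).sub (memLp_const_indicator P _ q)

theorem lintegral_badPart_le (f : Eucl n → ℂ) (P : ℤ × (Fin n → ℤ)) :
    ∫⁻ y, ‖badPart f P y‖ₑ ≤ 2 * ∫⁻ y in dyadicCube P, ‖f y‖ₑ := by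
  have hm := measurableSet_dyadicCube P
  have e (y : Eucl n) : ‖badPart f P y‖ₑ =
      (dyadicCube P).indicator (fun y => ‖f y - ⨍ z in dyadicCube P, f z‖ₑ) y := by
    by_cases hy : y ∈ dyadicCube P <;> simp [badPart, hy]
  simp_rw [e]
  rw [lintegral_indicator hm]
  calc _ ≤ ∫⁻ y in dyadicCube P, (‖f y‖ₑ + ‖⨍ z in dyadicCube P, f z‖ₑ) :=
        lintegral_mono fun y => enorm_sub_le
    _ ≤ _ := by
        rw [lintegral_add_right _ measurable_const, setLIntegral_const, two_mul]
        exact add_le_add le_rfl (enorm_setAverage_mul_le f P)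

theorem integral_badPart (f : Eucl n → ℂ) (P : ℤ × (Fin n → ℤ)) :
    ∫ y, badPart f P y = 0 := by
  rw [badPart, integral_indicator (measurableSet_dyadicCube P)]
  have : IsFiniteMeasure (volume.restrict (dyadicCube P)) :=
    ⟨by simpa using (volume_dyadicCube_ne_top P).lt_top⟩
  exact integral_sub_average _ _

/-- The weak type bound, for a function which outside of an open set `U` is at most `t`, and inside
of it lives on finitely many of the cubes that cover `U`. -/
theorem mul_measure_lt_app_le_of_finset (hn : 1 ≤ n)
    (hK : Measurable (Function.uncurry T.kernel)) {H : ℝ≥0}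
    (hH : ∀ (c z : Eucl n) (ρ : ℝ), dist z c < ρ →
      ∫⁻ x in (ball c (2 * ρ))ᶜ, ‖T.kernel x c - T.kernel x z‖ₑ ≤ H)
    (hf : MemLp f 2 volume) (hf1 : Integrable f) {t : ℝ≥0∞} (ht0 : t ≠ 0) (ht : t ≠ ∞)
    {E : Set (Eucl n)} (hE : MeasurableSet E) {s : Finset (ℤ × (Fin n → ℤ))}
    (hdisj : (s : Set (ℤ × (Fin n → ℤ))).PairwiseDisjoint dyadicCube)
    (hEs : ∀ P ∈ s, Disjoint E (dyadicCube P))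
    {A V : ℝ≥0} (hfE : ∀ᵐ x, x ∈ E → ‖f x‖ₑ ≤ t)
    (hfs : ∀ P ∈ s, ∫⁻ y in dyadicCube P, ‖f y‖ₑ ≤ A * volume (dyadicCube P) * t)
    (hvol : t * ∑ P ∈ s, volume (dyadicCube P) ≤ V * ∫⁻ y, ‖f y‖ₑ) :
    t * volume {x | t < ‖T.app (E.indicator f + ∑ P ∈ s, (dyadicCube P).indicator f) x‖ₑ} ≤
      (4 * ‖T.l2Ext‖₊ ^ 2 * (A + 1) + cubeConst n 2 * V + 4 * H : ℝ≥0) * ∫⁻ y, ‖f y‖ₑ := by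
  set N := ∫⁻ y, ‖f y‖ₑ with hN
  set a : ℤ × (Fin n → ℤ) → ℂ := fun P => ⨍ z in dyadicCube P, f z with ha
  -- The good part `g` is bounded by a multiple of `t` and handled in `L²`, the bad part `b` is a
  -- sum of mean-free pieces.
  set g : Eucl n → ℂ := E.indicator f + ∑ P ∈ s, (dyadicCube P).indicator fun _ => a P with hg
  set b : Eucl n → ℂ := ∑ P ∈ s, badPart f P with hb
  have hmP := fun P : ℤ × (Fin n → ℤ) => measurableSet_dyadicCube P
  have hgb : E.indicator f + ∑ P ∈ s, (dyadicCube P).indicator f = g + b := by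
    rw [hg, hb, add_assoc, ← Finset.sum_add_distrib]
    congr 1
    refine Finset.sum_congr rfl fun P _ => ?_
    rw [badPart_eq]; abel
  have hg2 : MemLp g 2 volume :=
    (hf.indicator hE).add (memLp_finsetSum' s fun P _ => memLp_const_indicator P _ 2)
  have hb2 : MemLp b 2 volume := memLp_finsetSum' s fun P _ => memLp_badPart hf P
  have hsumle : (∫⁻ y in E, ‖f y‖ₑ) + ∑ P ∈ s, ∫⁻ y in dyadicCube P, ‖f y‖ₑ ≤ N := by
    rw [← lintegral_biUnion_finset hdisj (fun P _ => hmP P), ← lintegral_union]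
    · exact setLIntegral_le_lintegral _ _
    · exact s.measurableSet_biUnion fun P _ => hmP P
    · exact Set.disjoint_iUnion₂_right.2 hEs
  have hgval (x : Eucl n) : ‖g x‖ₑ = E.indicator (fun y => ‖f y‖ₑ) x +
      ∑ P ∈ s, (dyadicCube P).indicator (fun _ => ‖a P‖ₑ) x := by
    simp only [hg, Pi.add_apply, Finset.sum_apply]
    by_cases hxE : x ∈ E
    · have hx (P) (hP : P ∈ s) : x ∉ dyadicCube P := Set.disjoint_left.1 (hEs P hP) hxE
      rw [Finset.sum_eq_zero fun P hP => Set.indicator_of_notMem (hx P hP) _,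
        Finset.sum_eq_zero fun P hP => Set.indicator_of_notMem (hx P hP) _]
      simp [hxE]
    · simp only [Set.indicator_of_notMem hxE, zero_add]
      by_cases hex : ∃ P ∈ s, x ∈ dyadicCube P
      · obtain ⟨P, hP, hxP⟩ := hex
        have hx (R) (hR : R ∈ s) (hRP : R ≠ P) : x ∉ dyadicCube R :=
          fun h => Set.disjoint_left.1 (hdisj hR hP hRP) h hxP
        rw [Finset.sum_eq_single_of_mem P hP fun R hR hRP =>
            Set.indicator_of_notMem (hx R hR hRP) _,
          Finset.sum_eq_single_of_mem P hP fun R hR hRP =>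
            Set.indicator_of_notMem (hx R hR hRP) _]
        simp [hxP]
      · push Not at hex
        rw [Finset.sum_eq_zero fun P hP => Set.indicator_of_notMem (hex P hP) _,
          Finset.sum_eq_zero fun P hP => Set.indicator_of_notMem (hex P hP) _]
        simp
  have ha_le (P) (hP : P ∈ s) : ‖a P‖ₑ ≤ A * t := by
    have h0 := volume_dyadicCube_ne_zero P
    have htop := volume_dyadicCube_ne_top P
    have := (enorm_setAverage_mul_le f P).trans (hfs P hP)
    rw [mul_right_comm] at this
    exact (ENNReal.mul_le_mul_iff_left h0 htop).1 this
  have hg_le : ∀ᵐ x, ‖g x‖ₑ ≤ ((A + 1 : ℝ≥0) : ℝ≥0∞) * t := by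
    filter_upwards [hfE] with x hx
    rw [hgval]
    push_cast
    by_cases hxE : x ∈ E
    · rw [Finset.sum_eq_zero fun P hP => Set.indicator_of_notMem
        (Set.disjoint_left.1 (hEs P hP) hxE) _]
      simp only [hxE, Set.indicator_of_mem, add_zero]
      exact (hx hxE).trans (le_mul_of_one_le_left (zero_le) le_add_self)
    · simp only [Set.indicator_of_notMem hxE, zero_add]
      refine le_trans ?_ (mul_le_mul_left (le_self_add : (A : ℝ≥0∞) ≤ A + 1) t)
      by_cases hex : ∃ P ∈ s, x ∈ dyadicCube P
      · obtain ⟨P, hP, hxP⟩ := hex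
        rw [Finset.sum_eq_single_of_mem P hP fun R hR hRP => Set.indicator_of_notMem
            (fun h => Set.disjoint_left.1 (hdisj hR hP hRP) h hxP) _]
        simpa [hxP] using ha_le P hP
      · push Not at hex
        rw [Finset.sum_eq_zero fun P hP => Set.indicator_of_notMem (hex P hP) _]
        exact zero_le
  have hg1 : ∫⁻ x, ‖g x‖ₑ ≤ N := by
    simp_rw [hgval]
    rw [lintegral_add_left' (hf.1.enorm.indicator hE), lintegral_indicator hE,
      lintegral_finsetSum _ fun P _ => measurable_const.indicator (hmP P)]
    refine le_trans (add_le_add le_rfl (Finset.sum_le_sum fun P _ => ?_)) hsumle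
    rw [lintegral_indicator_const (hmP P)]
    exact enorm_setAverage_mul_le f P
  have hg22 : ∫⁻ x, ‖g x‖ₑ ^ 2 ≤ t * ((A + 1 : ℝ≥0) * N) :=
    calc ∫⁻ x, ‖g x‖ₑ ^ 2 ≤ ∫⁻ x, ((A + 1 : ℝ≥0) : ℝ≥0∞) * t * ‖g x‖ₑ := by
          refine lintegral_mono_ae (hg_le.mono fun x hx => ?_)
          rw [sq]; gcongr
      _ = ((A + 1 : ℝ≥0) : ℝ≥0∞) * t * ∫⁻ x, ‖g x‖ₑ :=
          lintegral_const_mul' _ _ (ENNReal.mul_ne_top ENNReal.coe_ne_top ht)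
      _ ≤ ((A + 1 : ℝ≥0) : ℝ≥0∞) * t * N := by gcongr
      _ = _ := by ring
  have hgood : t * volume {x | t / 2 ≤ ‖T.app g x‖ₑ} ≤
      4 * (‖T.l2Ext‖₊ ^ 2 * ((A + 1 : ℝ≥0) * N)) := by
    refine ENNReal.mul_le_of_sq ht0 ht ?_
    have h1 := mul_meas_ge_le_pow_eLpNorm' (volume : Measure (Eucl n)) (p := 2) two_ne_zero
      ENNReal.ofNat_ne_top (T.aestronglyMeasurable_app g) (t / 2)
    have h2 : eLpNorm g 2 volume ^ (2 : ℝ) = ∫⁻ x, ‖g x‖ₑ ^ 2 := by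
      rw [eLpNorm_eq_lintegral_rpow_enorm_toReal two_ne_zero ENNReal.ofNat_ne_top]
      simp only [ENNReal.toReal_ofNat]
      rw [← ENNReal.rpow_mul]
      norm_num
    simp only [ENNReal.toReal_ofNat] at h1
    rw [ENNReal.rpow_two] at h1
    refine h1.trans ((ENNReal.rpow_le_rpow (T.eLpNorm_app_le g) zero_le_two).trans ?_)
    rw [ENNReal.mul_rpow_of_nonneg _ _ zero_le_two, h2, ENNReal.rpow_two]
    calc _ ≤ ‖T.l2Ext‖ₑ ^ 2 * (t * ((A + 1 : ℝ≥0) * N)) := by gcongr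
      _ = _ := by rw [enorm_eq_nnnorm]; ring
  -- The bad part is estimated by the smoothness of the kernel, outside of the set `O` whose measure
  -- is under control.
  set O : Set (Eucl n) := ⋃ P ∈ s, ball (dyadicCorner P) (2 * dyadicRadius P) with hO
  have hOm : MeasurableSet O := s.measurableSet_biUnion fun P _ => measurableSet_ball
  have hOvol : t * volume O ≤ cubeConst n 2 * V * N := by
    calc t * volume O ≤ t * ∑ P ∈ s, volume (ball (dyadicCorner P) (2 * dyadicRadius P)) := by
          gcongr; exact measure_biUnion_finset_le _ _
      _ = cubeConst n 2 * (t * ∑ P ∈ s, volume (dyadicCube P)) := by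
          simp_rw [volume_ball_eq_cubeConst_mul _ _ two_pos, ← Finset.mul_sum]; ring
      _ ≤ cubeConst n 2 * (V * N) := by gcongr
      _ = _ := by ring
  have hbO : ∫⁻ x in Oᶜ, ‖T.app b x‖ₑ ≤ 2 * H * N := by
    calc ∫⁻ x in Oᶜ, ‖T.app b x‖ₑ ≤ ∫⁻ x in Oᶜ, ∑ P ∈ s, ‖T.app (badPart f P) x‖ₑ := by
          refine lintegral_mono_ae (ae_restrict_of_ae ?_)
          filter_upwards [T.app_sum s fun P => memLp_badPart hf P] with x hx
          rw [hb, hx, Finset.sum_apply]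
          exact enorm_sum_le _ _
      _ = ∑ P ∈ s, ∫⁻ x in Oᶜ, ‖T.app (badPart f P) x‖ₑ :=
          lintegral_finsetSum' _ fun P _ => (T.aestronglyMeasurable_app _).enorm.restrict
      _ ≤ ∑ P ∈ s, H * (2 * ∫⁻ y in dyadicCube P, ‖f y‖ₑ) := by
          refine Finset.sum_le_sum fun P hP => ?_
          refine (lintegral_mono_set (t := (ball (dyadicCorner P) (2 * dyadicRadius P))ᶜ) ?_).trans
            ((T.lintegral_app_le_of_integral_eq_zero hn hK hH (memLp_badPart hf P)
            (memLp_one_iff_integrable.1 (memLp_badPart (memLp_one_iff_integrable.2 hf1) P))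
            (integral_badPart f P) (dyadicRadius_pos P) ?_).trans ?_)
          · exact Set.compl_subset_compl.2 (Set.subset_biUnion_of_mem
              (u := fun P => ball (dyadicCorner P) (2 * dyadicRadius P)) hP)
          · intro y hy
            exact Set.indicator_of_notMem (fun h => hy (dyadicCube_subset_ball P h)) _
          · gcongr
            exact lintegral_badPart_le f P
      _ = 2 * H * ∑ P ∈ s, ∫⁻ y in dyadicCube P, ‖f y‖ₑ := by
          rw [← Finset.mul_sum, ← Finset.mul_sum]; ring
      _ ≤ 2 * H * N := by gcongr; exact le_add_self.trans hsumle
  have hbad : t * volume ({x | t / 2 ≤ ‖T.app b x‖ₑ} ∩ Oᶜ) ≤ 4 * H * N := by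
    have h1 := mul_meas_ge_le_lintegral₀ (μ := volume.restrict Oᶜ)
      (T.aestronglyMeasurable_app b).enorm.restrict (t / 2)
    rw [Measure.restrict_apply' hOm.compl] at h1
    have h2 := mul_le_mul_right (h1.trans hbO) 2
    rw [← mul_assoc, ENNReal.mul_div_cancel two_ne_zero ENNReal.ofNat_ne_top] at h2
    refine h2.trans_eq ?_
    ring
  have hsub : ∀ᵐ x, x ∈ {x | t < ‖T.app (g + b) x‖ₑ} → x ∈ {x | t / 2 ≤ ‖T.app g x‖ₑ} ∪
      (O ∪ ({x | t / 2 ≤ ‖T.app b x‖ₑ} ∩ Oᶜ)) := by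
    filter_upwards [T.app_add hg2 hb2] with x hx hxt
    by_contra hcon
    simp only [Set.mem_union, Set.mem_inter_iff, not_or, not_and, Set.mem_ofPred_eq, not_le,
      Set.mem_compl_iff] at hcon
    have h1 := hcon.1
    have h2 : ‖T.app b x‖ₑ < t / 2 := by
      by_contra! h
      exact hcon.2.2 h hcon.2.1
    have h3 : t < ‖T.app (g + b) x‖ₑ := hxt
    rw [hx, Pi.add_apply] at h3
    have h4 := (h3.trans_le (enorm_add_le _ _)).trans (ENNReal.add_lt_add h1 h2)
    rw [ENNReal.add_halves] at h4
    exact lt_irrefl _ h4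
  rw [hgb]
  calc t * volume {x | t < ‖T.app (g + b) x‖ₑ}
      ≤ t * (volume {x | t / 2 ≤ ‖T.app g x‖ₑ} + (volume O +
        volume ({x | t / 2 ≤ ‖T.app b x‖ₑ} ∩ Oᶜ))) := by
        gcongr
        exact (measure_mono_ae hsub).trans ((measure_union_le _ _).trans
          (add_le_add le_rfl (measure_union_le _ _)))
    _ = t * volume {x | t / 2 ≤ ‖T.app g x‖ₑ} + (t * volume O +
        t * volume ({x | t / 2 ≤ ‖T.app b x‖ₑ} ∩ Oᶜ)) := by ring
    _ ≤ 4 * (‖T.l2Ext‖₊ ^ 2 * ((A + 1 : ℝ≥0) * N)) + (cubeConst n 2 * V * N + 4 * H * N) := by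
        gcongr
    _ = _ := by push_cast; ring

open Filter Topology in
/-- `T` is of weak type `(1, 1)`. -/
theorem exists_mul_measure_lt_app_le (hn : 1 ≤ n) (hθ : IsDini θ)
    (hK : Measurable (Function.uncurry T.kernel)) :
    ∃ W : ℝ≥0, ∀ f : Eucl n → ℂ, MemLp f 2 volume → Integrable f → ∀ t : ℝ≥0∞,
      t * volume {x | t < ‖T.app f x‖ₑ} ≤ W * ∫⁻ y, ‖f y‖ₑ := by
  obtain ⟨H, hH'⟩ := T.isThetaKernel.exists_lintegral_diff_le hθ
  have hH (c z : Eucl n) (ρ : ℝ) (hz : dist z c < ρ) :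
      ∫⁻ x in (ball c (2 * ρ))ᶜ, ‖T.kernel x c - T.kernel x z‖ₑ ≤ H := by
    have := hH' c z ρ hz (fun _ => 1) 1 (fun r _ => by simp)
    simp only [mul_one] at this
    exact (lintegral_mono fun x => le_add_self).trans this
  set D : ℝ≥0 := ((4 : ℝ) ^ n).toNNReal
  set V : ℝ≥0 := 2 ^ (n + 1) * D
  set W : ℝ≥0 := 4 * ‖T.l2Ext‖₊ ^ 2 * (cubeConst n 1 + 1) + cubeConst n 2 * V + 4 * H
  refine ⟨W, fun f hf hf1 t => ?_⟩
  rcases eq_or_ne t 0 with rfl | ht0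
  · simp
  rcases eq_or_ne t ∞ with rfl | ht
  · simp
  set N := ∫⁻ y, ‖f y‖ₑ with hN
  have hNt : N ≠ ∞ := hf1.2.ne
  set U := {x | t < maxFn volume (fun y => ‖f y‖ₑ) x} with hU
  have hUopen : IsOpen U := isOpen_lt_maxFn t
  have hUvol : t * volume U ≤ D * N := (Eucl.ballDoubling_volume n).mul_measure_lt_maxFn_le _ t
  have hUfin : volume U ≠ ∞ := by
    intro h
    rw [h, ENNReal.mul_top ht0, top_le_iff] at hUvol
    exact ENNReal.mul_ne_top ENNReal.coe_ne_top hNt hUvol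
  obtain ⟨F, hdisj, hcov, hF⟩ := exists_dyadic_cover hn hUopen hUfin
  set E : Set (Eucl n) := (⋃ P ∈ F, dyadicCube P)ᶜ with hEdef
  have hE : MeasurableSet E :=
    (MeasurableSet.biUnion F.to_countable fun P _ => measurableSet_dyadicCube P).compl
  have hEF (P) (hP : P ∈ F) : Disjoint E (dyadicCube P) :=
    (Set.disjoint_compl_left_iff_subset.2 (Set.subset_biUnion_of_mem (u := dyadicCube) hP))
  have hfE : ∀ᵐ x, x ∈ E → ‖f x‖ₑ ≤ t := by
    filter_upwards [ae_le_maxFn hf1.1.enorm hNt] with x hx hxE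
    exact hx.trans (not_lt.1 fun h => hxE (hcov h))
  have hfF (P) (hP : P ∈ F) :
      ∫⁻ y in dyadicCube P, ‖f y‖ₑ ≤ cubeConst n 1 * volume (dyadicCube P) * t := by
    obtain ⟨x, hxP, hxU⟩ := exists_mem_dyadicCube_notMem (hF P hP).2
    exact (lintegral_dyadicCube_le_maxFn P hxP).trans (mul_le_mul_right (not_lt.1 hxU) _)
  have hvol (s : Finset (ℤ × (Fin n → ℤ))) (hs : (s : Set (ℤ × (Fin n → ℤ))) ⊆ F) :
      t * ∑ P ∈ s, volume (dyadicCube P) ≤ V * N := by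
    calc t * ∑ P ∈ s, volume (dyadicCube P)
        ≤ t * ∑ P ∈ s, 2 ^ (n + 1) * volume (dyadicCube P ∩ U) := by
          gcongr with P hP; exact (hF P (hs hP)).1
      _ = 2 ^ (n + 1) * (t * volume (⋃ P ∈ s, dyadicCube P ∩ U)) := by
          rw [measure_biUnion_finset, Finset.mul_sum, Finset.mul_sum, Finset.mul_sum]
          · exact Finset.sum_congr rfl fun _ _ => by ring
          · exact fun P hP R hR hPR => (hdisj (hs hP) (hs hR) hPR).mono Set.inter_subset_left
              Set.inter_subset_left
          · exact fun P _ => (measurableSet_dyadicCube P).inter hUopen.measurableSet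
      _ ≤ 2 ^ (n + 1) * (D * N) := by
          refine mul_le_mul_right (le_trans ?_ hUvol) _
          gcongr
          exact Set.iUnion₂_subset fun P _ => Set.inter_subset_right
      _ = V * N := by simp only [V]; push_cast; ring
  -- The function is approximated by its restrictions to the complement of the cubes together with
  -- finitely many cubes.
  let _ := Encodable.ofCountable (ℤ × (Fin n → ℤ))
  have hfinite (k : ℕ) : (F ∩ {P | Encodable.encode P < k}).Finite :=
    ((Set.finite_Iio k).preimage Encodable.encode_injective.injOn).inter_of_right F
  set s : ℕ → Finset (ℤ × (Fin n → ℤ)) := fun k => (hfinite k).toFinset with hs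
  have hsF (k : ℕ) : (s k : Set (ℤ × (Fin n → ℤ))) ⊆ F := by
    simp only [hs, Set.Finite.coe_toFinset]; exact Set.inter_subset_left
  set G : ℕ → Set (Eucl n) := fun k => E ∪ ⋃ P ∈ s k, dyadicCube P with hG
  have hGm (k : ℕ) : MeasurableSet (G k) :=
    hE.union ((s k).measurableSet_biUnion fun P _ => measurableSet_dyadicCube P)
  have hGex (x : Eucl n) : ∀ᶠ k in atTop, x ∈ G k := by
    by_cases hx : x ∈ E
    · exact .of_forall fun k => .inl hx
    · simp only [hEdef, Set.mem_compl_iff, not_not, Set.mem_iUnion, exists_prop] at hx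
      obtain ⟨P, hP, hxP⟩ := hx
      filter_upwards [eventually_gt_atTop (Encodable.encode P)] with k hk
      refine .inr (Set.mem_biUnion (x := P) ?_ hxP)
      simp only [hs, Set.Finite.coe_toFinset]
      exact ⟨hP, hk⟩
  have hGf (k : ℕ) : (G k).indicator f =
      E.indicator f + ∑ P ∈ s k, (dyadicCube P).indicator f := by
    rw [hG]
    simp only
    rw [Set.indicator_union_of_disjoint]
    · rw [Finset.indicator_biUnion _ _ fun P hP R hR hPR => hdisj (hsF k hP) (hsF k hR) hPR]
      ext x
      simp [Finset.sum_apply]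
    · exact Set.disjoint_iUnion₂_right.2 fun P hP => hEF P (hsF k hP)
  have hmem (k : ℕ) : MemLp ((G k).indicator f) 2 volume := hf.indicator (hGm k)
  have hbound (k : ℕ) : t * volume {x | t < ‖T.app ((G k).indicator f) x‖ₑ} ≤ W * N := by
    rw [hGf]
    exact T.mul_measure_lt_app_le_of_finset hn hK hH hf hf1 ht0 ht hE
      (hdisj.subset (hsF k)) (fun P hP => hEF P (hsF k hP)) hfE (fun P hP => hfF P (hsF k hP))
      (hvol _ (hsF k))
  obtain ⟨ns, -, hae⟩ := T.exists_subseq_app_tendsto hmem hf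
    (tendsto_eLpNorm_indicator_sub two_ne_zero ENNReal.ofNat_ne_top hf hGm hGex)
  have hnull (h : Eucl n → ℂ) : NullMeasurableSet {x | t < ‖T.app h x‖ₑ} :=
    nullMeasurableSet_lt aemeasurable_const (T.aestronglyMeasurable_app h).enorm
  -- The weak type bound passes to the limit by Fatou's lemma for the indicators of the level sets.
  have hle : volume {x | t < ‖T.app f x‖ₑ} ≤ W * N / t := by
    have key (k : ℕ) : ∫⁻ x, {x | t < ‖T.app ((G (ns k)).indicator f) x‖ₑ}.indicator 1 x ≤
        W * N / t := by
      rw [lintegral_indicator_one₀ (hnull _), ENNReal.le_div_iff_mul_le (.inl ht0) (.inl ht),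
        mul_comm]
      exact hbound _
    have hfreq : ∃ᶠ k in atTop,
        ∫⁻ x, {x | t < ‖T.app ((G (ns k)).indicator f) x‖ₑ}.indicator 1 x ≤ W * N / t :=
      Frequently.of_forall key
    rw [← lintegral_indicator_one₀ (hnull f)]
    refine le_trans (lintegral_mono_ae ?_) ((lintegral_liminf_le' (fun k =>
      (aemeasurable_const (b := (1 : ℝ≥0∞))).indicator₀ (hnull ((G (ns k)).indicator f)))).trans
      (liminf_le_of_frequently_le' hfreq))
    filter_upwards [hae] with x hx
    by_cases hxt : t < ‖T.app f x‖ₑ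
    · have : ∀ᶠ k in atTop, t < ‖T.app ((G (ns k)).indicator f) x‖ₑ :=
        ((continuous_enorm.tendsto _).comp hx).eventually_const_lt hxt
      refine le_liminf_of_le (by isBoundedDefault) ?_
      filter_upwards [this] with k hk
      rw [Set.indicator_of_mem (by exact hxt), Set.indicator_of_mem (by exact hk)]
      rfl
    · rw [Set.indicator_of_notMem (by exact hxt)]
      exact zero_le
  calc t * volume {x | t < ‖T.app f x‖ₑ} ≤ t * (W * N / t) := by gcongr
    _ = W * N := ENNReal.mul_div_cancel ht0 ht

end ThetaCZO

/-! ### Domination by a product of maximal functions -/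

/-- The ball around a dyadic cube on which the function is seen by the cube. -/
def dyadicBall {n : ℕ} (P : ℤ × (Fin n → ℤ)) : Set (Eucl n) :=
  ball (dyadicCorner P) (2 * dyadicRadius P)

theorem measurableSet_dyadicBall {n : ℕ} (P : ℤ × (Fin n → ℤ)) : MeasurableSet (dyadicBall P) :=
  measurableSet_ball

theorem dyadicBall_subset {n : ℕ} {P Q : ℤ × (Fin n → ℤ)} (hPQ : dyadicCube P ⊆ dyadicCube Q)
    (hlt : Q.1 < P.1) : dyadicBall P ⊆ dyadicBall Q := by
  intro y hy
  have h1 := dyadicCube_subset_ball Q (hPQ (dyadicCorner_mem_dyadicCube P))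
  have h2 : 2 * dyadicSide P ≤ dyadicSide Q := by
    have e : 2 * dyadicSide P = (2 : ℝ) ^ (1 + -P.1) := by
      rw [zpow_add₀ two_ne_zero, zpow_one]; rfl
    rw [e]
    exact zpow_le_zpow_right₀ one_le_two (by omega)
  have h3 : 2 * dyadicRadius P ≤ dyadicRadius Q := by
    unfold dyadicRadius
    have : (0 : ℝ) ≤ n + 1 := by positivity
    nlinarith
  simp only [dyadicBall, mem_ball] at hy h1 ⊢
  linarith [dist_triangle y (dyadicCorner P) (dyadicCorner Q)]

namespace ThetaCZO

variable {n : ℕ} {θ : ℝ → ℝ} (T : ThetaCZO n θ)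

/-- The kernel integral of a function vanishing near a cube oscillates little on the cube. -/
theorem enorm_integral_sub_le (hn : 1 ≤ n) (hK : Measurable (Function.uncurry T.kernel)) {H : ℝ≥0}
    (hH : ∀ (c z : Eucl n) (ρ : ℝ), dist z c < ρ → ∀ (u : Eucl n → ℝ≥0∞) (M : ℝ≥0∞),
      (∀ r, ρ < r → ∫⁻ y in ball c r, u y ≤ M * volume (ball c r)) →
      ∫⁻ y in (ball c (2 * ρ))ᶜ, (‖T.kernel c y - T.kernel z y‖ₑ +
        ‖T.kernel y c - T.kernel y z‖ₑ) * u y ≤ H * M)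
    {h : Eucl n → ℂ} (hh : MemLp h 2 volume) {c z : Eucl n} {ρ : ℝ} (hz : dist z c < ρ)
    (h0 : ∀ y ∈ ball c (2 * ρ), h y = 0) {M : ℝ≥0∞}
    (hM : ∀ r, ρ < r → ∫⁻ y in ball c r, ‖h y‖ₑ ≤ M * volume (ball c r)) :
    ‖(∫ y, T.kernel c y * h y) - ∫ y, T.kernel z y * h y‖ₑ ≤ H * M := by
  have hρ : 0 < ρ := dist_nonneg.trans_lt hz
  have hi (x : Eucl n) (hx : dist x c < ρ) : Integrable fun y => T.kernel x y * h y := by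
    refine T.integrable_kernel_mul hn hK hh hρ (.of_forall fun y hy => h0 y ?_)
    rw [mem_ball] at hy ⊢
    linarith [dist_triangle y x c]
  rw [← integral_sub (hi c (by simpa using hρ)) (hi z hz)]
  refine (enorm_integral_le_lintegral_enorm _).trans (le_trans ?_ (hH c z ρ hz _ M hM))
  rw [← lintegral_indicator measurableSet_ball.compl]
  refine lintegral_mono fun y => ?_
  by_cases hy : y ∈ ball c (2 * ρ)
  · simp [h0 y hy]
  · rw [Set.indicator_of_mem (by exact hy), ← sub_mul, enorm_mul]
    gcongr
    exact le_self_add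

/-- One step of the stopping time argument. On a cube `Q`, the function `T f_Q`, where `f_Q` is the
restriction of `f` to the ball around `Q`, is at most a multiple of the average of `|f_Q|`, except
on disjoint smaller cubes `P` of at most half the total measure, where the same bound holds up to
adding `|T f_P|`. -/
theorem exists_stopping_cubes (hn : 1 ≤ n) (hθ : IsDini θ)
    (hK : Measurable (Function.uncurry T.kernel)) :
    ∃ D : ℝ≥0, ∀ f : Eucl n → ℂ, MemLp f 2 volume → ∀ Q : ℤ × (Fin n → ℤ),
      ∃ F : Set (ℤ × (Fin n → ℤ)), F.PairwiseDisjoint dyadicCube ∧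
        (∀ P ∈ F, dyadicCube P ⊆ dyadicCube Q) ∧
        2 * ∑' P : F, volume (dyadicCube P.1) ≤ volume (dyadicCube Q) ∧
        (∀ᵐ x, x ∈ dyadicCube Q → x ∉ ⋃ P ∈ F, dyadicCube P →
          ‖T.app ((dyadicBall Q).indicator f) x‖ₑ * volume (dyadicCube Q) ≤
            D * ∫⁻ y in dyadicBall Q, ‖f y‖ₑ) ∧
        ∀ P ∈ F, ∀ᵐ x, x ∈ dyadicCube P →
          ‖T.app ((dyadicBall Q).indicator f) x‖ₑ * volume (dyadicCube Q) ≤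
            D * (∫⁻ y in dyadicBall Q, ‖f y‖ₑ) +
              ‖T.app ((dyadicBall P).indicator f) x‖ₑ * volume (dyadicCube Q) := by
  obtain ⟨H, hH⟩ := T.isThetaKernel.exists_lintegral_diff_le hθ
  obtain ⟨W, hW⟩ := T.exists_mul_measure_lt_app_le hn hθ hK
  -- `A` makes the exceptional set `E` below small, `B` does the same for `T f_P` on one cube `P`.
  set D₀ : ℝ≥0 := ((4 : ℝ) ^ n).toNNReal
  set A : ℝ≥0 := 2 ^ (n + 3) * (W + D₀ + 1) with hA
  set B : ℝ≥0 := 4 * (W * cubeConst n 2 * A + 1) with hB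
  refine ⟨A + B + 2 * (H * A), fun f hf Q => ?_⟩
  set fQ := (dyadicBall Q).indicator f with hfQ
  have hfQ2 : MemLp fQ 2 volume := hf.indicator (measurableSet_dyadicBall Q)
  have hint (P : ℤ × (Fin n → ℤ)) : Integrable ((dyadicBall P).indicator f) := by
    rw [integrable_indicator_iff (measurableSet_dyadicBall P)]
    have : IsFiniteMeasure (volume.restrict (dyadicBall P)) :=
      ⟨by simpa [dyadicBall] using measure_ball_lt_top⟩
    exact (hf.restrict _).integrable one_le_two
  have hlint (P : ℤ × (Fin n → ℤ)) :
      ∫⁻ y, ‖(dyadicBall P).indicator f y‖ₑ = ∫⁻ y in dyadicBall P, ‖f y‖ₑ := by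
    rw [← lintegral_indicator (measurableSet_dyadicBall P)]
    exact lintegral_congr fun y => by rw [enorm_indicator_eq_indicator_enorm]
  have hQ0 := volume_dyadicCube_ne_zero Q
  have hQt := volume_dyadicCube_ne_top Q
  set α := (∫⁻ y in dyadicBall Q, ‖f y‖ₑ) / volume (dyadicCube Q) with hα
  have hαmul : ∫⁻ y in dyadicBall Q, ‖f y‖ₑ = α * volume (dyadicCube Q) :=
    (ENNReal.div_mul_cancel hQ0 hQt).symm
  have hαt : α ≠ ∞ := by
    refine ENNReal.div_ne_top ?_ hQ0
    rw [← hlint]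
    exact (hint Q).2.ne
  simp only [hαmul, ← mul_assoc, ← add_mul]
  simp only [ENNReal.mul_le_mul_iff_left hQ0 hQt]
  -- If the average vanishes, then so do `f_Q` and `T f_Q`, and no cubes are needed.
  rcases eq_or_ne α 0 with hα0 | hα0
  · refine ⟨∅, Set.pairwiseDisjoint_empty, by simp, by simp, ?_, by simp⟩
    have h0 : fQ =ᵐ[volume] 0 := by
      have h1 := hlint Q
      rw [hαmul, hα0, zero_mul, lintegral_eq_zero_iff' (hint Q).1.enorm] at h1
      exact h1.mono fun x hx => by simpa [hfQ] using hx
    rw [T.app_congr h0]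
    filter_upwards [T.app_zero] with x hx _ _
    simp [hx]
  set E : Set (Eucl n) :=
    {x | A * α < ‖T.app fQ x‖ₑ} ∪ {x | A * α < maxFn volume (fun y => ‖fQ y‖ₑ) x} with hE
  have hEvol : 2 ^ (n + 3) * volume E ≤ volume (dyadicCube Q) := by
    have h1 : A * α * volume E ≤ (W + D₀) * (α * volume (dyadicCube Q)) := by
      calc A * α * volume E ≤ A * α * (volume {x | A * α < ‖T.app fQ x‖ₑ} +
            volume {x | A * α < maxFn volume (fun y => ‖fQ y‖ₑ) x}) := by
            gcongr; exact measure_union_le _ _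
        _ ≤ (W * ∫⁻ y, ‖fQ y‖ₑ) + D₀ * ∫⁻ y, ‖fQ y‖ₑ := by
            rw [mul_add]
            exact add_le_add (hW fQ hfQ2 (hint Q) _)
              ((Eucl.ballDoubling_volume n).mul_measure_lt_maxFn_le _ _)
        _ = _ := by rw [hlint, hαmul]; ring
    have h2 : (W + D₀ + 1 : ℝ≥0∞) * α * (2 ^ (n + 3) * volume E) ≤
        (W + D₀ + 1 : ℝ≥0∞) * α * volume (dyadicCube Q) := by
      calc _ = A * α * volume E := by simp only [hA]; push_cast; ring
        _ ≤ (W + D₀) * (α * volume (dyadicCube Q)) := h1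
        _ ≤ (W + D₀ + 1) * (α * volume (dyadicCube Q)) := mul_le_mul_left le_self_add _
        _ = _ := by ring
    refine (ENNReal.mul_le_mul_iff_right (mul_ne_zero (by simp) hα0) ?_).1 h2
    exact ENNReal.mul_ne_top (by finiteness) hαt
  -- The set `E` need not be open, and dyadic covers exist for open sets only.
  obtain ⟨U, hEU, hUopen, hUlt⟩ := Set.exists_isOpen_lt_of_lt E
      (volume (dyadicCube Q) / 2 ^ (n + 2)) (μ := volume) (by
    rw [ENNReal.lt_div_iff_mul_lt (by simp) (by simp)]
    rcases eq_or_ne (volume E) 0 with h0 | h0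
    · rw [h0, zero_mul]; exact pos_iff_ne_zero.2 hQ0
    · have hEt : volume E ≠ ∞ := by
        intro h
        rw [h, ENNReal.mul_top (by simp), top_le_iff] at hEvol
        exact hQt hEvol
      refine lt_of_lt_of_le ?_ hEvol
      rw [mul_comm]
      refine (ENNReal.mul_lt_mul_iff_left h0 hEt).2 ?_
      exact_mod_cast Nat.pow_lt_pow_right one_lt_two (by omega : n + 2 < n + 3))
  have hUvol : 2 * (2 ^ (n + 1) * volume U) ≤ volume (dyadicCube Q) := by
    rw [ENNReal.lt_div_iff_mul_lt (by simp) (by simp)] at hUlt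
    calc _ = volume U * 2 ^ (n + 2) := by ring
      _ ≤ _ := hUlt.le
  obtain ⟨F, hdisj, hcov, hF⟩ := exists_dyadic_cover hn hUopen hUlt.ne_top
  -- A cube of the cover has at most half the measure of `Q`, so it cannot contain `Q`.
  have hlevel (P) (hP : P ∈ F) {x} (hxP : x ∈ dyadicCube P) (hxQ : x ∈ dyadicCube Q) :
      Q.1 < P.1 := by
    by_contra! hle
    have h1 : volume (dyadicCube Q) ≤ volume (dyadicCube P) :=
      measure_mono (dyadicCube_subset hxQ hxP hle)
    have h2 : 2 * volume (dyadicCube P) ≤ volume (dyadicCube Q) := by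
      refine le_trans ?_ hUvol
      gcongr
      exact (hF P hP).1.trans (by gcongr; exact Set.inter_subset_right)
    rw [two_mul] at h2
    have := (h2.trans h1)
    exact (ENNReal.lt_add_right (volume_dyadicCube_ne_top P) (volume_dyadicCube_ne_zero P)).not_ge
      this
  have hUE (x) (hx : x ∉ U) : ‖T.app fQ x‖ₑ ≤ A * α ∧
      maxFn volume (fun y => ‖fQ y‖ₑ) x ≤ A * α := by
    have : x ∉ E := fun h => hx (hEU h)
    simp only [hE, Set.mem_union, Set.mem_ofPred_eq, not_or, not_lt] at this
    exact this
  refine ⟨{P | P ∈ F ∧ dyadicCube P ⊆ dyadicCube Q}, hdisj.subset fun P hP => hP.1,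
    fun P hP => hP.2, ?_, ?_, ?_⟩
  · set F' := {P | P ∈ F ∧ dyadicCube P ⊆ dyadicCube Q}
    refine le_trans ?_ hUvol
    gcongr
    calc ∑' P : F', volume (dyadicCube P.1)
        ≤ ∑' P : F', 2 ^ (n + 1) * volume (dyadicCube P.1 ∩ U) := by
          gcongr with P; exact (hF P.1 P.2.1).1
      _ = 2 ^ (n + 1) * volume (⋃ P : F', dyadicCube P.1 ∩ U) := by
          rw [ENNReal.tsum_mul_left, measure_iUnion]
          · intro P R hPR
            exact (hdisj P.2.1 R.2.1 (Subtype.coe_ne_coe.2 hPR)).mono Set.inter_subset_left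
              Set.inter_subset_left
          · exact fun P => (measurableSet_dyadicCube P.1).inter hUopen.measurableSet
      _ ≤ _ := by
          gcongr
          exact Set.iUnion_subset fun P => Set.inter_subset_right
  · refine .of_forall fun x hxQ hx => ?_
    have hxU : x ∉ U := by
      intro h
      obtain ⟨P, hP, hxP⟩ := Set.mem_iUnion₂.1 (hcov h)
      exact hx (Set.mem_biUnion (x := P)
        ⟨hP, dyadicCube_subset hxP hxQ (hlevel P hP hxP hxQ).le⟩ hxP)
    refine (hUE x hxU).1.trans ?_
    gcongr
    rw [add_assoc]
    exact le_self_add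
  · rintro P ⟨hP, hPQ⟩
    have hlt : Q.1 < P.1 := hlevel P hP (dyadicCorner_mem_dyadicCube P)
      (hPQ (dyadicCorner_mem_dyadicCube P))
    have hBPQ := dyadicBall_subset hPQ hlt
    have hP0 := volume_dyadicCube_ne_zero P
    have hPt := volume_dyadicCube_ne_top P
    set c := dyadicCorner P
    set ρ := dyadicRadius P
    have hρ : 0 < ρ := dyadicRadius_pos P
    set fP := (dyadicBall P).indicator f with hfP
    have hfP2 : MemLp fP 2 volume := hf.indicator (measurableSet_dyadicBall P)
    set h := fQ - fP with hh
    have hh2 : MemLp h 2 volume := hfQ2.sub hfP2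
    have hh0 (y) (hy : y ∈ ball c (2 * ρ)) : h y = 0 := by
      have hy' : y ∈ dyadicBall P := hy
      simp [hh, hfP, hfQ, hy', hBPQ hy']
    have hhle (y) : ‖h y‖ₑ ≤ ‖fQ y‖ₑ := by
      by_cases hy : y ∈ dyadicBall P
      · rw [hh0 y hy]; simp
      · simp [hh, hfP, hy]
    have hsum : ∀ᵐ x, T.app fQ x = T.app fP x + T.app h x := by
      have e : fQ = fP + h := by rw [hh]; abel
      rw [e]
      exact T.app_add hfP2 hh2
    have hrep : ∀ᵐ x, x ∈ ball c (2 * ρ) → T.app h x = ∫ y, T.kernel x y * h y :=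
      T.app_eq_integral hn hK hh2 isOpen_ball (.of_forall hh0)
    have hsubP : dyadicCube P ⊆ ball c ρ := dyadicCube_subset_ball P
    have hball : ball c ρ ⊆ ball c (2 * ρ) := ball_subset_ball (by linarith)
    obtain ⟨x₀, hx₀P, hx₀U⟩ := exists_mem_dyadicCube_notMem (hF P hP).2
    have hM (r : ℝ) (hr : ρ < r) : ∫⁻ y in ball c r, ‖h y‖ₑ ≤ A * α * volume (ball c r) := by
      calc _ ≤ ∫⁻ y in ball c r, ‖fQ y‖ₑ := lintegral_mono fun y => hhle y
        _ ≤ maxFn volume (fun y => ‖fQ y‖ₑ) x₀ * volume (ball c r) :=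
            (Eucl.ballDoubling_volume n).lintegral_ball_le (ball_subset_ball hr.le (hsubP hx₀P))
        _ ≤ _ := by gcongr; exact (hUE x₀ hx₀U).2
    -- The averages of `|h|` over balls containing `P` are at most `A α`, as `P` has a point outside
    -- of `U`, so the kernel integral of `h` oscillates by at most `2 H A α` on `P`.
    have hosc (x) (hx : x ∈ dyadicCube P) :=
      T.enorm_integral_sub_le hn hK hH hh2 (hsubP hx) hh0 hM
    -- The kernel integral of `h = f_Q - f_P` is small at one point of `P`, outside of `U` and of
    -- the set where `T f_P` is large; together they do not fill `P`.
    have hbad : 4 * volume {x | B * α < ‖T.app fP x‖ₑ} ≤ volume (dyadicCube P) := by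
      have h1 : B * α * volume {x | B * α < ‖T.app fP x‖ₑ} ≤
          W * (cubeConst n 2 * volume (dyadicCube P) * (A * α)) := by
        refine (hW fP hfP2 (hint P) (B * α)).trans ?_
        gcongr
        calc ∫⁻ y, ‖fP y‖ₑ = ∫⁻ y in dyadicBall P, ‖f y‖ₑ := hlint P
          _ = ∫⁻ y in dyadicBall P, ‖fQ y‖ₑ := by
              refine setLIntegral_congr_fun (measurableSet_dyadicBall P) fun y hy => ?_
              simp [hfQ, hBPQ hy]
          _ ≤ cubeConst n 2 * volume (dyadicCube P) * maxFn volume (fun y => ‖fQ y‖ₑ) x₀ :=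
              lintegral_ball_le_maxFn P hx₀P one_le_two
          _ ≤ _ := by gcongr; exact (hUE x₀ hx₀U).2
      have h2 : (W * cubeConst n 2 * A + 1 : ℝ≥0∞) * α *
          (4 * volume {x | B * α < ‖T.app fP x‖ₑ}) ≤
          (W * cubeConst n 2 * A + 1 : ℝ≥0∞) * α * volume (dyadicCube P) := by
        have hBc : (B : ℝ≥0∞) = 4 * (W * cubeConst n 2 * A + 1) := by simp [hB]
        calc _ = 4 * (W * cubeConst n 2 * A + 1) * α * volume {x | B * α < ‖T.app fP x‖ₑ} := by
              generalize volume {x | B * α < ‖T.app fP x‖ₑ} = m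
              ring
          _ = B * α * volume {x | B * α < ‖T.app fP x‖ₑ} := by rw [← hBc]
          _ ≤ W * (cubeConst n 2 * volume (dyadicCube P) * (A * α)) := h1
          _ = (W * cubeConst n 2 * A) * α * volume (dyadicCube P) := by ring
          _ ≤ _ := by gcongr; exact le_self_add
      refine (ENNReal.mul_le_mul_iff_right (mul_ne_zero (by simp) hα0) ?_).1 h2
      exact ENNReal.mul_ne_top (by finiteness) hαt
    have hgood : ∃ x ∈ dyadicCube P, ‖∫ y, T.kernel x y * h y‖ₑ ≤ (A + B) * α := by
      by_contra! hcon
      have hsub : ∀ᵐ x, x ∈ dyadicCube P → x ∈ (dyadicCube P ∩ U) ∪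
          {x | B * α < ‖T.app fP x‖ₑ} := by
        filter_upwards [hsum, hrep] with x hx1 hx2 hxP
        by_contra hx
        simp only [Set.mem_union, Set.mem_inter_iff, hxP, true_and, Set.mem_ofPred_eq, not_or,
          not_lt] at hx
        refine (hcon x hxP).not_ge ?_
        rw [← hx2 (hball (hsubP hxP)), show T.app h x = T.app fQ x - T.app fP x by rw [hx1]; ring,
          add_mul]
        exact enorm_sub_le.trans (add_le_add (hUE x hx.1).1 hx.2)
      have h1 : volume (dyadicCube P) ≤
          volume (dyadicCube P ∩ U) + volume {x | B * α < ‖T.app fP x‖ₑ} :=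
        (measure_mono_ae hsub).trans (measure_union_le _ _)
      have h2 : 4 * volume (dyadicCube P) ≤ 3 * volume (dyadicCube P) := by
        calc 4 * volume (dyadicCube P) ≤ 4 * (volume (dyadicCube P ∩ U) +
              volume {x | B * α < ‖T.app fP x‖ₑ}) := by gcongr
          _ = 2 * (2 * volume (dyadicCube P ∩ U)) + 4 * volume {x | B * α < ‖T.app fP x‖ₑ} := by
              ring
          _ ≤ 2 * volume (dyadicCube P) + volume (dyadicCube P) := by
              gcongr; exact (hF P hP).2
          _ = _ := by ring
      rw [ENNReal.mul_le_mul_iff_left hP0 hPt] at h2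
      norm_num at h2
    obtain ⟨z, hzP, hz⟩ := hgood
    filter_upwards [hsum, hrep] with x hx1 hx2 hxP
    have e1 := hosc x hxP
    have e2 := hosc z hzP
    rw [hx1, add_comm (_ * α) _]
    refine (enorm_add_le _ _).trans (add_le_add le_rfl ?_)
    rw [hx2 (hball (hsubP hxP))]
    set I : Eucl n → ℂ := fun x => ∫ y, T.kernel x y * h y
    change ‖I x‖ₑ ≤ _
    change ‖I c - I x‖ₑ ≤ _ at e1
    change ‖I c - I z‖ₑ ≤ _ at e2
    change ‖I z‖ₑ ≤ _ at hz
    have e3 : I x = I z + ((I c - I z) - (I c - I x)) := by ring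
    calc ‖I x‖ₑ = ‖I z + ((I c - I z) - (I c - I x))‖ₑ := by rw [← e3]
      _ ≤ (A + B) * α + (H * (A * α) + H * (A * α)) :=
          (enorm_add_le _ _).trans (add_le_add hz (enorm_sub_le.trans (add_le_add e2 e1)))
      _ = _ := by push_cast; ring

end ThetaCZO

namespace ThetaCZO

variable {n : ℕ} {θ : ℝ → ℝ} (T : ThetaCZO n θ)

open Filter Topology in
/-- The local form of the domination. Iterating the stopping time argument `k` times proves it
outside of a set of measure at most `2 ^ (-k) |Q|`, with the same constant for all `k`: the average
over `Q` that each step produces is integrated over the part of `Q` outside of the stopping cubes,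
and these parts are disjoint. -/
theorem exists_setLIntegral_app_mul_le (hn : 1 ≤ n) (hθ : IsDini θ)
    (hK : Measurable (Function.uncurry T.kernel)) :
    ∃ D : ℝ≥0, ∀ f : Eucl n → ℂ, MemLp f 2 volume → ∀ g : Eucl n → ℝ≥0∞, AEMeasurable g →
      ∀ Q : ℤ × (Fin n → ℤ),
        ∫⁻ x in dyadicCube Q, ‖T.app ((dyadicBall Q).indicator f) x‖ₑ * g x ≤
          D * ∫⁻ x in dyadicCube Q, maxFn volume (fun y => ‖f y‖ₑ) x * maxFn volume g x := by
  obtain ⟨D, hD⟩ := T.exists_stopping_cubes hn hθ hK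
  set c : ℝ≥0 := cubeConst n 2 * cubeConst n 1
  refine ⟨D * (2 * c), fun f hf g hg => ?_⟩
  set m : Eucl n → ℝ≥0∞ := fun x => maxFn volume (fun y => ‖f y‖ₑ) x * maxFn volume g x with hm
  have hmm : Measurable m := measurable_maxFn.mul measurable_maxFn
  set τ : ℤ × (Fin n → ℤ) → Eucl n → ℝ≥0∞ :=
    fun Q x => ‖T.app ((dyadicBall Q).indicator f) x‖ₑ with hτ
  have hτm (Q) : AEMeasurable (τ Q) := (T.aestronglyMeasurable_app _).enorm
  have iter (k : ℕ) (Q : ℤ × (Fin n → ℤ)) : ∃ R : Set (Eucl n), MeasurableSet R ∧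
      R ⊆ dyadicCube Q ∧ volume R ≤ (1 / 2) ^ k * volume (dyadicCube Q) ∧
      ∫⁻ x in dyadicCube Q \ R, τ Q x * g x ≤
        (D * (2 * c) : ℝ≥0) * ∫⁻ x in dyadicCube Q, m x := by
    induction k generalizing Q with
    | zero => exact ⟨dyadicCube Q, measurableSet_dyadicCube Q, subset_rfl, by simp, by simp⟩
    | succ k ih =>
      obtain ⟨F, hdisj, hsub, hvol, hout, hin⟩ := hD f hf Q
      choose R hRm hRsub hRvol hRint using ih
      have hQ0 := volume_dyadicCube_ne_zero Q
      have hQt := volume_dyadicCube_ne_top Q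
      have hQm := measurableSet_dyadicCube Q
      set β := (∫⁻ y in dyadicBall Q, ‖f y‖ₑ) / volume (dyadicCube Q) with hβ
      have hβmul : ∫⁻ y in dyadicBall Q, ‖f y‖ₑ = β * volume (dyadicCube Q) :=
        (ENNReal.div_mul_cancel hQ0 hQt).symm
      simp only [hβmul, ← mul_assoc, ← add_mul] at hout hin
      simp only [ENNReal.mul_le_mul_iff_left hQ0 hQt] at hout hin
      have hdisj' : Pairwise (Function.onFun Disjoint fun P : F => dyadicCube P.1) :=
        fun P P' h => hdisj P.2 P'.2 (Subtype.coe_ne_coe.2 h)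
      set O : Set (Eucl n) := ⋃ P : F, dyadicCube P.1 with hO
      have hOm : MeasurableSet O := MeasurableSet.iUnion fun P => measurableSet_dyadicCube P.1
      have hOQ : O ⊆ dyadicCube Q := Set.iUnion_subset fun P => hsub P.1 P.2
      have hOvol : 2 * volume O ≤ volume (dyadicCube Q) := by
        rwa [hO, measure_iUnion hdisj' fun P => measurableSet_dyadicCube P.1]
      have hcompl : volume (dyadicCube Q) ≤ 2 * volume (dyadicCube Q \ O) := by
        have h1 : volume (dyadicCube Q) = volume O + volume (dyadicCube Q \ O) := by
          rw [← measure_union Set.disjoint_sdiff_right (hQm.diff hOm), Set.union_sdiff_cancel hOQ]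
        have hOt : volume O ≠ ∞ := ne_top_of_le_ne_top hQt (measure_mono hOQ)
        rw [h1, two_mul] at hOvol
        have h2 := (ENNReal.add_le_add_iff_left hOt).1 hOvol
        rw [h1, two_mul]
        gcongr
      -- The average `β` of `|f|` times the integral of `g` is charged to `Q \ O`, which is at least
      -- half of `Q`: at each point of `Q` both averages are bounded by the maximal functions.
      have hβg : β * ∫⁻ x in dyadicCube Q, g x ≤
          (2 * c : ℝ≥0) * ∫⁻ x in dyadicCube Q \ O, m x := by
        set X := β * ∫⁻ x in dyadicCube Q, g x
        have h1 (x) (hx : x ∈ dyadicCube Q) : X ≤ c * volume (dyadicCube Q) * m x := by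
          have e1 := lintegral_ball_le_maxFn Q (u := fun y => ‖f y‖ₑ) hx one_le_two
          have e2 := lintegral_dyadicCube_le_maxFn Q (u := g) hx
          change ∫⁻ y in dyadicBall Q, ‖f y‖ₑ ≤ _ at e1
          rw [hβmul, mul_right_comm, ENNReal.mul_le_mul_iff_left hQ0 hQt] at e1
          calc X ≤ (cubeConst n 2 * maxFn volume (fun y => ‖f y‖ₑ) x) *
                (cubeConst n 1 * volume (dyadicCube Q) * maxFn volume g x) := by
                simp only [X]; gcongr
            _ = _ := by simp only [c, hm]; push_cast; ring
        have h2 : X * volume (dyadicCube Q) ≤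
            (2 * c : ℝ≥0) * (∫⁻ x in dyadicCube Q \ O, m x) * volume (dyadicCube Q) := by
          calc X * volume (dyadicCube Q) ≤ X * (2 * volume (dyadicCube Q \ O)) := by gcongr
            _ = 2 * ∫⁻ x in dyadicCube Q \ O, X := by rw [setLIntegral_const]; ring
            _ ≤ 2 * ∫⁻ x in dyadicCube Q \ O, c * volume (dyadicCube Q) * m x := by
                gcongr 2 * ?_
                exact setLIntegral_mono' (hQm.diff hOm) fun x hx => h1 x hx.1
            _ = _ := by rw [lintegral_const_mul _ hmm]; push_cast; ring
        exact (ENNReal.mul_le_mul_iff_left hQ0 hQt).1 h2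
      refine ⟨⋃ P : F, R P.1, MeasurableSet.iUnion fun P => hRm P.1,
        Set.iUnion_subset fun P => (hRsub P.1).trans (hsub P.1 P.2), ?_, ?_⟩
      · calc volume (⋃ P : F, R P.1) ≤ ∑' P : F, volume (R P.1) := measure_iUnion_le _
          _ ≤ ∑' P : F, (1 / 2) ^ k * volume (dyadicCube P.1) :=
              ENNReal.tsum_le_tsum fun P => hRvol P.1
          _ = (1 / 2) ^ k * ((1 / 2) * (2 * ∑' P : F, volume (dyadicCube P.1))) := by
              rw [ENNReal.tsum_mul_left, ← mul_assoc (1 / 2), one_div,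
                ENNReal.inv_mul_cancel two_ne_zero ENNReal.ofNat_ne_top, one_mul]
          _ ≤ (1 / 2) ^ k * ((1 / 2) * volume (dyadicCube Q)) := by gcongr
          _ = _ := by ring
      · have hcover : dyadicCube Q \ ⋃ P : F, R P.1 ⊆
            (dyadicCube Q \ O) ∪ ⋃ P : F, (dyadicCube P.1 \ R P.1) := by
          rintro x ⟨hxQ, hxR⟩
          by_cases hxO : x ∈ O
          · obtain ⟨P, hP⟩ := Set.mem_iUnion.1 hxO
            exact .inr (Set.mem_iUnion.2 ⟨P, hP, fun h => hxR (Set.mem_iUnion.2 ⟨P, h⟩)⟩)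
          · exact .inl ⟨hxQ, hxO⟩
        have hPm (P : F) : MeasurableSet (dyadicCube P.1 \ R P.1) :=
          (measurableSet_dyadicCube P.1).diff (hRm P.1)
        calc ∫⁻ x in dyadicCube Q \ ⋃ P : F, R P.1, τ Q x * g x
            ≤ (∫⁻ x in dyadicCube Q \ O, τ Q x * g x) +
                ∫⁻ x in ⋃ P : F, (dyadicCube P.1 \ R P.1), τ Q x * g x :=
              (lintegral_mono_set hcover).trans (lintegral_union_le _ _ _)
          _ ≤ (∫⁻ x in dyadicCube Q \ O, D * β * g x) +
                ∑' P : F, ∫⁻ x in dyadicCube P.1 \ R P.1, τ Q x * g x := by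
              refine add_le_add (lintegral_mono_ae ?_) (lintegral_iUnion_le _ _)
              filter_upwards [ae_restrict_of_ae hout, ae_restrict_mem (hQm.diff hOm)] with x hx hxm
              gcongr
              refine hx hxm.1 ?_
              rw [Set.biUnion_eq_iUnion]
              exact hxm.2
          _ ≤ (∫⁻ x in dyadicCube Q \ O, D * β * g x) +
                ∑' P : F, ((∫⁻ x in dyadicCube P.1, D * β * g x) +
                  ∫⁻ x in dyadicCube P.1 \ R P.1, τ P.1 x * g x) := by
              refine add_le_add le_rfl (ENNReal.tsum_le_tsum fun P => ?_)
              calc ∫⁻ x in dyadicCube P.1 \ R P.1, τ Q x * g x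
                  ≤ ∫⁻ x in dyadicCube P.1 \ R P.1, (D * β * g x + τ P.1 x * g x) := by
                    refine lintegral_mono_ae ?_
                    filter_upwards [ae_restrict_of_ae (hin P.1 P.2), ae_restrict_mem (hPm P)]
                      with x hx hxm
                    rw [← add_mul]
                    gcongr
                    exact hx hxm.1
                _ = (∫⁻ x in dyadicCube P.1 \ R P.1, D * β * g x) +
                    ∫⁻ x in dyadicCube P.1 \ R P.1, τ P.1 x * g x :=
                    lintegral_add_left' (hg.const_mul _).restrict _
                _ ≤ _ := add_le_add (lintegral_mono_set Set.sdiff_subset) le_rfl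
          _ = (∫⁻ x in dyadicCube Q, D * β * g x) +
                ∑' P : F, ∫⁻ x in dyadicCube P.1 \ R P.1, τ P.1 x * g x := by
              rw [ENNReal.tsum_add, ← add_assoc, ← lintegral_iUnion
                (fun P : F => measurableSet_dyadicCube P.1) hdisj',
                ← lintegral_union hOm Set.disjoint_sdiff_left, Set.sdiff_union_of_subset hOQ]
          _ ≤ (D * (2 * c) : ℝ≥0) * (∫⁻ x in dyadicCube Q \ O, m x) +
                ∑' P : F, (D * (2 * c) : ℝ≥0) * ∫⁻ x in dyadicCube P.1, m x := by
              refine add_le_add ?_ (ENNReal.tsum_le_tsum fun P => hRint P.1)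
              rw [lintegral_const_mul'' _ hg.restrict, mul_assoc, ENNReal.coe_mul D, mul_assoc]
              gcongr
          _ = _ := by
              rw [ENNReal.tsum_mul_left, ← mul_add, ← lintegral_iUnion
                (fun P : F => measurableSet_dyadicCube P.1) hdisj',
                ← lintegral_union hOm Set.disjoint_sdiff_left, Set.sdiff_union_of_subset hOQ]
  intro Q
  have iterQ := fun k => iter k Q
  choose R hRm hRsub hRvol hRint using iterQ
  have hQm := measurableSet_dyadicCube Q
  -- By Borel–Cantelli, almost every point leaves the sets `R k`, and Fatou's lemma applies.
  have hsum : ∑' k, volume (R k) ≠ ∞ := by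
    refine ne_top_of_le_ne_top ?_ (ENNReal.tsum_le_tsum hRvol)
    rw [ENNReal.tsum_mul_right, ENNReal.tsum_geometric]
    exact ENNReal.mul_ne_top (by simp) (volume_dyadicCube_ne_top Q)
  have hev : ∀ᵐ x, ∀ᶠ k in atTop, x ∉ R k := ae_eventually_notMem hsum
  calc ∫⁻ x in dyadicCube Q, τ Q x * g x
      ≤ ∫⁻ x, liminf (fun k => (dyadicCube Q \ R k).indicator (fun x => τ Q x * g x) x) atTop := by
        rw [← lintegral_indicator hQm]
        refine lintegral_mono_ae ?_
        filter_upwards [hev] with x hx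
        by_cases hxQ : x ∈ dyadicCube Q
        · rw [Set.indicator_of_mem hxQ]
          refine le_liminf_of_le (by isBoundedDefault) ?_
          filter_upwards [hx] with k hk
          rw [Set.indicator_of_mem (show x ∈ dyadicCube Q \ R k from ⟨hxQ, hk⟩)]
        · rw [Set.indicator_of_notMem hxQ]; exact zero_le
    _ ≤ liminf (fun k => ∫⁻ x, (dyadicCube Q \ R k).indicator (fun x => τ Q x * g x) x) atTop :=
        lintegral_liminf_le' fun k => ((hτm Q).mul hg).indicator (hQm.diff (hRm k))
    _ ≤ _ := by
        have hfreq : ∃ᶠ k in atTop, ∫⁻ x, (dyadicCube Q \ R k).indicator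
            (fun x => τ Q x * g x) x ≤ (D * (2 * c) : ℝ≥0) * ∫⁻ x in dyadicCube Q, m x := by
          refine Frequently.of_forall fun k => ?_
          rw [lintegral_indicator (hQm.diff (hRm k))]
          exact hRint k
        exact liminf_le_of_frequently_le' hfreq

/-- The integral of `|T f|` against `g ≥ 0` is dominated by the integral of the product of the
maximal functions of `f` and `g`. -/
theorem exists_lintegral_app_mul_le (hn : 1 ≤ n) (hθ : IsDini θ)
    (hK : Measurable (Function.uncurry T.kernel)) :
    ∃ D : ℝ≥0, ∀ (f : Eucl n → ℂ) (R : ℝ), MemLp f 2 volume →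
      (∀ x ∉ ball (0 : Eucl n) R, f x = 0) → ∀ g : Eucl n → ℝ≥0∞, AEMeasurable g →
        ∫⁻ x, ‖T.app f x‖ₑ * g x ≤
          D * ∫⁻ x, maxFn volume (fun y => ‖f y‖ₑ) x * maxFn volume g x := by
  obtain ⟨D, hD⟩ := T.exists_setLIntegral_app_mul_le hn hθ hK
  refine ⟨D, fun f R hf hsupp g hg => ?_⟩
  obtain ⟨N, hN⟩ := exists_nat_ge R
  have hmono : Monotone fun j : ℕ => ball (0 : Eucl n) (2 ^ (j + N)) :=
    fun i j hij => ball_subset_ball (pow_le_pow_right₀ one_le_two (by omega))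
  have huniv : ⋃ j : ℕ, ball (0 : Eucl n) (2 ^ (j + N)) = Set.univ := by
    refine Set.eq_univ_of_forall fun x => Set.mem_iUnion.2 ?_
    obtain ⟨j, hj⟩ := exists_nat_gt ‖x‖
    refine ⟨j, mem_ball_zero_iff.2 (hj.trans_le ?_)⟩
    calc (j : ℝ) ≤ 2 ^ j := by exact_mod_cast Nat.lt_two_pow_self.le
      _ ≤ 2 ^ (j + N) := pow_le_pow_right₀ one_le_two (by omega)
  rw [← setLIntegral_univ, ← huniv, setLIntegral_iUnion_of_directed _ hmono.directed_le]
  refine iSup_le fun j => ?_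
  set B := ball (0 : Eucl n) (2 ^ (j + N)) with hB
  -- The cubes of side `2 ^ (j + N)`: the balls around those which meet `B` contain the support of
  -- `f`. They cover `B` whatever the position of the coordinate hyperplanes.
  set Q : (Fin n → ℤ) → ℤ × (Fin n → ℤ) := fun m => (-((j + N : ℕ) : ℤ), m) with hQ
  have hside (m) : dyadicSide (Q m) = 2 ^ (j + N) := by
    simp only [dyadicSide, hQ, neg_neg]
    exact zpow_natCast _ _
  have hRN : R ≤ 2 ^ (j + N) :=
    calc R ≤ N := hN
      _ ≤ 2 ^ N := by exact_mod_cast Nat.lt_two_pow_self.le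
      _ ≤ 2 ^ (j + N) := pow_le_pow_right₀ one_le_two (by omega)
  have key (m) (x) (hx : x ∈ dyadicCube (Q m)) (hxB : x ∈ B) :
      (dyadicBall (Q m)).indicator f = f := by
    rw [Set.indicator_eq_self]
    intro y hy
    have hyR : y ∈ ball (0 : Eucl n) R := by
      by_contra h; exact hy (hsupp y h)
    have h1 := dyadicCube_subset_ball _ hx
    rw [dyadicBall]
    simp only [dyadicRadius, hside, hB, mem_ball] at h1 hxB hyR ⊢
    have hn' : (1 : ℝ) ≤ n := by exact_mod_cast hn
    have h2 : (0 : ℝ) < 2 ^ (j + N) := by positivity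
    have := dist_triangle y x (dyadicCorner (Q m))
    have := dist_triangle_right y x 0
    nlinarith
  calc ∫⁻ x in B, ‖T.app f x‖ₑ * g x
      = ∑' m, ∫⁻ x in dyadicCube (Q m) ∩ B, ‖T.app f x‖ₑ * g x := by
        rw [← lintegral_iUnion (fun m => (measurableSet_dyadicCube _).inter measurableSet_ball),
          ← Set.iUnion_inter, iUnion_dyadicCube, Set.univ_inter]
        exact fun m m' h => ((pairwise_disjoint_dyadicCube _) h).mono Set.inter_subset_left
          Set.inter_subset_left
    _ ≤ ∑' m, D * ∫⁻ x in dyadicCube (Q m),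
          maxFn volume (fun y => ‖f y‖ₑ) x * maxFn volume g x := by
        refine ENNReal.tsum_le_tsum fun m => ?_
        rcases (dyadicCube (Q m) ∩ B).eq_empty_or_nonempty with h | ⟨x, hx, hxB⟩
        · simp [h]
        · have := hD f hf g hg (Q m)
          rw [key m x hx hxB] at this
          exact (lintegral_mono_set Set.inter_subset_left).trans this
    _ = _ := by
        rw [ENNReal.tsum_mul_left, ← lintegral_iUnion (fun m => measurableSet_dyadicCube _)
          (pairwise_disjoint_dyadicCube _), iUnion_dyadicCube, setLIntegral_univ]

end ThetaCZO

/-! ### The weighted bound -/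

namespace IsMuckenhouptPair

variable {n : ℕ} {p q : ℝ} {w σ : Eucl n → ℝ≥0∞} {A : ℝ≥0}

/-- Hölder's inequality for the duality of `L^p(w)` and `L^q(σ)` under the unweighted integral. -/
theorem lintegral_mul_le (h : IsMuckenhouptPair p q w σ A) {u v : Eucl n → ℝ≥0∞}
    (hu : AEMeasurable u) (hv : AEMeasurable v) :
    ∫⁻ x, u x * v x ≤
      (∫⁻ x, u x ^ p * w x) ^ (1 / p) * (∫⁻ x, v x ^ q * σ x) ^ (1 / q) := by
  have hp := h.conj.pos
  have hq := h.conj.symm.pos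
  have h1 := ENNReal.lintegral_mul_le_Lp_mul_Lq volume h.conj
    (f := fun x => u x * w x ^ (1 / p)) (g := fun x => v x * σ x ^ (1 / q))
    (hu.mul (h.aemeasurable_left.pow_const _)) (hv.mul (h.aemeasurable_right.pow_const _))
  refine le_trans (le_of_eq ?_) (h1.trans_eq ?_)
  · refine lintegral_congr_ae (h.mul_eq_one.mono fun x hx => ?_)
    simp only [Pi.mul_apply]
    rw [mul_mul_mul_comm, hx, mul_one]
  · congr 2
    · refine lintegral_congr fun x => ?_
      rw [ENNReal.mul_rpow_of_nonneg _ _ hp.le, ← ENNReal.rpow_mul, one_div_mul_cancel hp.ne',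
        ENNReal.rpow_one]
    · refine lintegral_congr fun x => ?_
      rw [ENNReal.mul_rpow_of_nonneg _ _ hq.le, ← ENNReal.rpow_mul, one_div_mul_cancel hq.ne',
        ENNReal.rpow_one]

/-- The norm of `L^p(w)` by duality with `L^q(σ)`. -/
theorem lintegral_rpow_mul_le_of_forall (h : IsMuckenhouptPair p q w σ A) {τ : Eucl n → ℝ≥0∞}
    (hτ : Measurable τ) (hfin : ∀ x, τ x ≠ ∞) {c : ℝ≥0∞}
    (H : ∀ g : Eucl n → ℝ≥0∞, AEMeasurable g →
      ∫⁻ x, τ x * g x ≤ c * (∫⁻ x, g x ^ q * σ x) ^ (1 / q)) :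
    (∫⁻ x, τ x ^ p * w x) ^ (1 / p) ≤ c := by
  have hp := h.conj.pos
  have hq := h.conj.symm.pos
  have hp1 := h.conj.sub_one_pos
  let G (k : ℕ) : Set (Eucl n) := ball 0 k ∩ {x | τ x ≤ k}
  have hG (k : ℕ) : MeasurableSet (G k) :=
    measurableSet_ball.inter (measurableSet_le hτ measurable_const)
  have hmono : Monotone G := fun i j hij => Set.inter_subset_inter
    (ball_subset_ball (by exact_mod_cast hij))
    fun x (hx : τ x ≤ i) => hx.trans (by exact_mod_cast hij)
  have hU : ⋃ k, G k = Set.univ := by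
    refine Set.eq_univ_of_forall fun x => Set.mem_iUnion.2 ?_
    obtain ⟨k₁, hk₁⟩ := exists_nat_gt ‖x‖
    obtain ⟨k₂, hk₂⟩ := ENNReal.exists_nat_gt (hfin x)
    refine ⟨max k₁ k₂, ?_, ?_⟩
    · rw [mem_ball_zero_iff]; exact hk₁.trans_le (by exact_mod_cast le_max_left _ _)
    · exact hk₂.le.trans (by exact_mod_cast le_max_right _ _)
  have hle (k : ℕ) : ∫⁻ x in G k, τ x ^ p * w x ≤ c ^ p := by
    -- The test function is `τ ^ (p - 1) w` on `G k`, where both sides become powers of the same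
    -- number `X`, which is finite and may be cancelled.
    set X := ∫⁻ x in G k, τ x ^ p * w x with hX
    have hXt : X ≠ ∞ := by
      refine ne_top_of_le_ne_top (b := (k : ℝ≥0∞) ^ p * ∫⁻ x in ball (0 : Eucl n) k, w x)
        (ENNReal.mul_ne_top (ENNReal.rpow_ne_top_of_nonneg hp.le (by simp))
          (h.ne_top_left 0 k)) ?_
      rw [← lintegral_const_mul' _ _ (ENNReal.rpow_ne_top_of_nonneg hp.le (by simp))]
      refine (setLIntegral_mono' (hG k) fun x hx => ?_).trans
        (lintegral_mono_set Set.inter_subset_left)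
      gcongr
      exact hx.2
    have h1 := H ((G k).indicator fun x => τ x ^ (p - 1) * w x)
      ((((hτ.pow_const _).aemeasurable).mul h.aemeasurable_left).indicator (hG k))
    have e1 : ∫⁻ x, τ x * (G k).indicator (fun x => τ x ^ (p - 1) * w x) x = X := by
      rw [hX, ← lintegral_indicator (hG k)]
      refine lintegral_congr fun x => ?_
      by_cases hx : x ∈ G k
      · rw [Set.indicator_of_mem hx, Set.indicator_of_mem hx, ← mul_assoc]
        nth_rw 1 [← ENNReal.rpow_one (τ x)]
        rw [← ENNReal.rpow_add_of_nonneg _ _ zero_le_one hp1.le, add_sub_cancel]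
      · simp [hx]
    have e2 : ∫⁻ x, (G k).indicator (fun x => τ x ^ (p - 1) * w x) x ^ q * σ x = X := by
      rw [hX, ← lintegral_indicator (hG k)]
      refine lintegral_congr_ae (h.mul_eq_one.mono fun x hx => ?_)
      by_cases hxG : x ∈ G k
      · simp only [Set.indicator_of_mem hxG]
        obtain ⟨h0, ht, hs⟩ := ENNReal.pair_aux h.conj hx
        rw [ENNReal.mul_rpow_of_nonneg _ _ hq.le, ← ENNReal.rpow_mul, h.conj.sub_one_mul_conj,
          mul_assoc, ← hs, ← mul_assoc (w x ^ q), ← ENNReal.mul_rpow_of_nonneg _ _ hq.le,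
          ENNReal.mul_inv_cancel h0 ht, ENNReal.one_rpow, one_mul]
      · simp [hxG, hq]
    rw [e1, e2] at h1
    rcases eq_or_ne X 0 with hX0 | hX0
    · simp [hX0]
    have h2 : X ^ (1 / p) * X ^ (1 / q) ≤ c * X ^ (1 / q) := by
      rwa [← ENNReal.rpow_add _ _ hX0 hXt, one_div, one_div, h.conj.inv_add_inv_eq_one,
        ENNReal.rpow_one, ← one_div]
    have h3 : X ^ (1 / p) ≤ c := by
      rwa [ENNReal.mul_le_mul_iff_left (by simp [ENNReal.rpow_eq_zero_iff, hX0, hXt])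
        (ENNReal.rpow_ne_top_of_nonneg (by positivity) hXt)] at h2
    have h4 := ENNReal.rpow_le_rpow h3 hp.le
    rwa [← ENNReal.rpow_mul, one_div_mul_cancel hp.ne', ENNReal.rpow_one] at h4
  have h5 : ∫⁻ x, τ x ^ p * w x ≤ c ^ p := by
    rw [← setLIntegral_univ, ← hU, setLIntegral_iUnion_of_directed _ hmono.directed_le]
    exact iSup_le hle
  have h6 := ENNReal.rpow_le_rpow h5 (one_div_pos.2 hp).le
  rwa [← ENNReal.rpow_mul, mul_one_div_cancel hp.ne', ENNReal.rpow_one] at h6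

end IsMuckenhouptPair

namespace ThetaCZO

variable {n : ℕ} {θ : ℝ → ℝ} (T : ThetaCZO n θ) {p q : ℝ} {w σ : Eucl n → ℝ≥0∞} {A : ℝ≥0}

theorem measurable_app (f : Eucl n → ℂ) : Measurable (T.app f) := by
  by_cases hf : MemLp f 2 volume
  · rw [T.app_eq hf]; exact (Lp.stronglyMeasurable _).measurable
  · rw [app, dif_neg hf]; exact measurable_const

open Filter Topology in
/-- The weighted bound on `L²`. The bilinear bound by maximal functions and Muckenhoupt's theorem,
for the weight and for its dual, give it for functions with bounded support. -/
theorem exists_lintegral_app_rpow_mul_le (hn : 1 ≤ n) (hθ : IsDini θ)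
    (hK : Measurable (Function.uncurry T.kernel)) (h : IsMuckenhouptPair p q w σ A) :
    ∃ C : ℝ≥0, ∀ f : Eucl n → ℂ, MemLp f 2 volume →
      (∫⁻ x, ‖T.app f x‖ₑ ^ p * w x) ^ (1 / p) ≤ C * (∫⁻ x, ‖f x‖ₑ ^ p * w x) ^ (1 / p) := by
  have hp := h.conj.pos
  have hq := h.conj.symm.pos
  have hip : 0 ≤ 1 / p := (one_div_pos.2 hp).le
  have hiq : 0 ≤ 1 / q := (one_div_pos.2 hq).le
  obtain ⟨D, hD⟩ := T.exists_lintegral_app_mul_le hn hθ hK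
  obtain ⟨C₁, hC₁⟩ := h.lintegral_maxFn_rpow_mul_le
  obtain ⟨C₂, hC₂⟩ := h.symm.lintegral_maxFn_rpow_mul_le
  refine ⟨D * C₁ ^ (1 / p) * C₂ ^ (1 / q), ?_⟩
  set C := D * C₁ ^ (1 / p) * C₂ ^ (1 / q) with hC
  have hbdd (f : Eucl n → ℂ) (R : ℝ) (hf : MemLp f 2 volume) (hR : ∀ x ∉ ball 0 R, f x = 0) :
      (∫⁻ x, ‖T.app f x‖ₑ ^ p * w x) ^ (1 / p) ≤ C * (∫⁻ x, ‖f x‖ₑ ^ p * w x) ^ (1 / p) := by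
    refine h.lintegral_rpow_mul_le_of_forall (T.measurable_app f).enorm (fun x => enorm_ne_top)
      fun g hg => ?_
    calc ∫⁻ x, ‖T.app f x‖ₑ * g x
        ≤ D * ∫⁻ x, maxFn volume (fun y => ‖f y‖ₑ) x * maxFn volume g x := hD f R hf hR g hg
      _ ≤ D * ((C₁ * ∫⁻ x, ‖f x‖ₑ ^ p * w x) ^ (1 / p) *
            (C₂ * ∫⁻ x, g x ^ q * σ x) ^ (1 / q)) := by
          refine mul_le_mul_right ((h.lintegral_mul_le measurable_maxFn.aemeasurable
            measurable_maxFn.aemeasurable).trans ?_) _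
          exact mul_le_mul' (ENNReal.rpow_le_rpow (hC₁ _ hf.1.enorm) hip)
            (ENNReal.rpow_le_rpow (hC₂ _ hg) hiq)
      _ = _ := by
          rw [ENNReal.mul_rpow_of_nonneg _ _ hip, ENNReal.mul_rpow_of_nonneg _ _ hiq, hC]
          push_cast [← ENNReal.coe_rpow_of_nonneg _ hip, ← ENNReal.coe_rpow_of_nonneg _ hiq]
          ring
  intro f hf
  have hmem (k : ℕ) : MemLp ((ball (0 : Eucl n) k).indicator f) 2 volume :=
    hf.indicator measurableSet_ball
  -- Fatou's lemma removes the assumption of bounded support.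
  obtain ⟨ns, -, hns⟩ := T.exists_subseq_app_tendsto (f := fun k : ℕ => (ball 0 k).indicator f)
    (g := f) hmem hf (tendsto_eLpNorm_indicator_sub two_ne_zero ENNReal.ofNat_ne_top hf
      (fun _ => measurableSet_ball) fun x => by
        obtain ⟨k, hk⟩ := exists_nat_gt ‖x‖
        filter_upwards [eventually_ge_atTop k] with j hj
        rw [mem_ball_zero_iff]
        exact hk.trans_le (by exact_mod_cast hj))
  set X := ∫⁻ x, ‖f x‖ₑ ^ p * w x with hX
  have hk (k : ℕ) : ∫⁻ x, ‖T.app ((ball (0 : Eucl n) k).indicator f) x‖ₑ ^ p * w x ≤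
      (C * X ^ (1 / p)) ^ p := by
    have h1 := ENNReal.rpow_le_rpow (hbdd ((ball (0 : Eucl n) k).indicator f) k (hmem k)
      fun x hx => Set.indicator_of_notMem hx _) hp.le
    rw [← ENNReal.rpow_mul, one_div_mul_cancel hp.ne', ENNReal.rpow_one] at h1
    refine h1.trans ?_
    refine ENNReal.rpow_le_rpow (mul_le_mul_right (ENNReal.rpow_le_rpow
      (lintegral_mono fun x => ?_) hip) _) hp.le
    simp only
    gcongr
    exact enorm_indicator_le_enorm_self _ _
  have hfin : ∫⁻ x, ‖T.app f x‖ₑ ^ p * w x ≤ (C * X ^ (1 / p)) ^ p := by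
    calc ∫⁻ x, ‖T.app f x‖ₑ ^ p * w x
        ≤ ∫⁻ x, liminf (fun k =>
            ‖T.app ((ball (0 : Eucl n) (ns k : ℕ)).indicator f) x‖ₑ ^ p * w x) atTop := by
          refine lintegral_mono_ae ?_
          filter_upwards [hns, h.mul_eq_one] with x hx hwx
          have hxt := ENNReal.Tendsto.mul_const (b := w x)
            (((ENNReal.continuous_rpow_const (y := p)).tendsto _).comp (hx.enorm))
            (.inr (ENNReal.pair_aux h.conj hwx).2.1)
          exact hxt.liminf_eq.ge
      _ ≤ liminf (fun k => ∫⁻ x,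
            ‖T.app ((ball (0 : Eucl n) (ns k : ℕ)).indicator f) x‖ₑ ^ p * w x) atTop :=
          lintegral_liminf_le' fun k =>
            ((T.measurable_app _).enorm.pow_const _).aemeasurable.mul h.aemeasurable_left
      _ ≤ _ := liminf_le_of_frequently_le' (Frequently.of_forall fun k => hk _)
  have h6 := ENNReal.rpow_le_rpow hfin (one_div_pos.2 hp).le
  rwa [← ENNReal.rpow_mul _ p, mul_one_div_cancel hp.ne', ENNReal.rpow_one] at h6

end ThetaCZO

/-! ### The extension to the weighted space -/

theorem IsWeight.aemeasurable_ofReal {n : ℕ} {w : Eucl n → ℝ} (hw : IsWeight w) :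
    AEMeasurable fun x => ENNReal.ofReal (w x) :=
  hw.locallyIntegrable.aestronglyMeasurable.aemeasurable.ennreal_ofReal

theorem volume_ac_weightMeasure {n : ℕ} {w : Eucl n → ℝ} (hw : IsWeight w) :
    volume ≪ weightMeasure w :=
  withDensity_absolutelyContinuous' hw.aemeasurable_ofReal
    (hw.pos.mono fun x hx => by simpa using hx)

theorem eLpNorm_restrict_weightMeasure {n : ℕ} {p : ℝ} (hp : 0 < p) {w : Eucl n → ℝ}
    (hw : IsWeight w) (f : Eucl n → ℂ) {s : Set (Eucl n)} (hs : MeasurableSet s) :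
    eLpNorm f (ENNReal.ofReal p) ((weightMeasure w).restrict s) =
      (∫⁻ x in s, ‖f x‖ₑ ^ p * ENNReal.ofReal (w x)) ^ (1 / p) := by
  rw [eLpNorm_eq_lintegral_rpow_enorm_toReal (by simpa using hp) (by simp),
    ENNReal.toReal_ofReal hp.le, weightMeasure, restrict_withDensity hs,
    lintegral_withDensity_eq_lintegral_mul_non_measurable₀ _ hw.aemeasurable_ofReal.restrict
      (by simp)]
  simp [mul_comm]

theorem weightedLpNorm_eq {n : ℕ} {p : ℝ} (hp : 0 < p) {w : Eucl n → ℝ} (hw : IsWeight w)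
    (f : Eucl n → ℂ) : weightedLpNorm p w f =
      (∫⁻ x, ‖f x‖ₑ ^ p * ENNReal.ofReal (w x)) ^ (1 / p) := by
  simpa [weightedLpNorm] using eLpNorm_restrict_weightMeasure hp hw f .univ

theorem weightedLpNorm_congr {n : ℕ} (p : ℝ) (w : Eucl n → ℝ) {f g : Eucl n → ℂ}
    (h : f =ᵐ[volume] g) : weightedLpNorm p w f = weightedLpNorm p w g :=
  eLpNorm_congr_ae ((weightMeasure_ac w).ae_le h)

namespace weightedLp

variable {n : ℕ} {p : ℝ} {w : Eucl n → ℝ}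

theorem memLp_coe (f : weightedLp n p w) :
    MemLp (f : Eucl n →ₘ[volume] ℂ) (ENNReal.ofReal p) (weightMeasure w) :=
  ⟨f.1.aestronglyMeasurable.mono_ac (weightMeasure_ac w), f.2⟩

/-- A function with finite weighted norm, as an element of the weighted space. -/
noncomputable def mk (f : Eucl n → ℂ) (hf : AEStronglyMeasurable f volume)
    (hf' : weightedLpNorm p w f < ∞) : weightedLp n p w :=
  ⟨AEEqFun.mk f hf, (weightedLpNorm_congr p w (AEEqFun.coeFn_mk f hf)).trans_lt hf'⟩

theorem coe_mk (f : Eucl n → ℂ) (hf : AEStronglyMeasurable f volume)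
    (hf' : weightedLpNorm p w f < ∞) :
    ((mk f hf hf' : weightedLp n p w) : Eucl n →ₘ[volume] ℂ) =ᵐ[volume] f :=
  AEEqFun.coeFn_mk f hf

/-- The elements of `weightedLp n p w`, as classes modulo null sets of the weighted measure. -/
noncomputable def toLp : weightedLp n p w →ₗ[ℂ] Lp ℂ (ENNReal.ofReal p) (weightMeasure w) where
  toFun f := (memLp_coe f).toLp
  map_add' f g := ((MemLp.toLp_eq_toLp_iff _ ((memLp_coe f).add (memLp_coe g))).2
    ((weightMeasure_ac w).ae_le (AEEqFun.coeFn_add _ _))).trans (MemLp.toLp_add _ _)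
  map_smul' c f := ((MemLp.toLp_eq_toLp_iff _ ((memLp_coe f).const_smul c)).2
    ((weightMeasure_ac w).ae_le (AEEqFun.coeFn_smul _ _))).trans (MemLp.toLp_const_smul _ _)

theorem enorm_toLp (f : weightedLp n p w) :
    ‖toLp f‖ₑ = weightedLpNorm p w (f : Eucl n →ₘ[volume] ℂ) :=
  Lp.enorm_toLp (memLp_coe f)

/-- The inverse of `weightedLp.toLp`. -/
noncomputable def ofLp (hw : IsWeight w) :
    Lp ℂ (ENNReal.ofReal p) (weightMeasure w) →ₗ[ℂ] weightedLp n p w where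
  toFun g := mk g ((Lp.aestronglyMeasurable g).mono_ac (volume_ac_weightMeasure hw))
    (Lp.memLp g).2
  map_add' _ _ := Subtype.ext <| (AEEqFun.mk_eq_mk.2
    ((volume_ac_weightMeasure hw).ae_le (Lp.coeFn_add _ _))).trans (AEEqFun.mk_add_mk _ _ _ _).symm
  map_smul' _ _ := Subtype.ext <| (AEEqFun.mk_eq_mk.2
    ((volume_ac_weightMeasure hw).ae_le (Lp.coeFn_smul _ _))).trans (AEEqFun.smul_mk _ _ _).symm

theorem coe_ofLp (hw : IsWeight w) (g : Lp ℂ (ENNReal.ofReal p) (weightMeasure w)) :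
    (ofLp hw g : Eucl n →ₘ[volume] ℂ) =ᵐ[volume] g :=
  AEEqFun.coeFn_mk _ _

theorem ofLp_toLp (hw : IsWeight w) (f : weightedLp n p w) : ofLp hw (toLp f) = f := by
  refine Subtype.ext (AEEqFun.ext ?_)
  exact (coe_ofLp hw _).trans ((volume_ac_weightMeasure hw).ae_le (memLp_coe f).coeFn_toLp)

theorem weightedLpNorm_ofLp (hw : IsWeight w) (g : Lp ℂ (ENNReal.ofReal p) (weightMeasure w)) :
    weightedLpNorm p w (ofLp hw g : Eucl n →ₘ[volume] ℂ) = ‖g‖ₑ := by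
  rw [Lp.enorm_def]
  exact weightedLpNorm_congr p w (coe_ofLp hw g)

open Filter Topology in
/-- Every function in a weighted space is the limit of its truncations, which are bounded with
bounded support. -/
theorem exists_tendsto_indicator (hp : 0 < p) (f : weightedLp n p w) :
    ∃ G : ℕ → Set (Eucl n), (∀ k, MeasurableSet (G k)) ∧ (∀ x, ∀ᶠ k in atTop, x ∈ G k) ∧
      (∀ k, MemLp ((G k).indicator (f : Eucl n →ₘ[volume] ℂ)) 2 volume) ∧
      (∀ k, weightedLpNorm p w ((G k).indicator (f : Eucl n →ₘ[volume] ℂ)) < ∞) ∧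
      Tendsto (fun k => weightedLpNorm p w ((G k).indicator (f : Eucl n →ₘ[volume] ℂ) -
        (f : Eucl n →ₘ[volume] ℂ))) atTop (𝓝 0) := by
  have hfm : Measurable (f : Eucl n →ₘ[volume] ℂ) := f.1.measurable
  let G (k : ℕ) : Set (Eucl n) := ball 0 k ∩ {x | ‖(f : Eucl n →ₘ[volume] ℂ) x‖ ≤ k}
  have hG (k : ℕ) : MeasurableSet (G k) :=
    measurableSet_ball.inter (measurableSet_le hfm.norm measurable_const)
  have hex (x : Eucl n) : ∀ᶠ k in atTop, x ∈ G k := by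
    obtain ⟨k₁, hk₁⟩ := exists_nat_gt ‖x‖
    obtain ⟨k₂, hk₂⟩ := exists_nat_gt ‖(f : Eucl n →ₘ[volume] ℂ) x‖
    filter_upwards [eventually_ge_atTop k₁, eventually_ge_atTop k₂] with j h1 h2
    refine ⟨?_, ?_⟩
    · rw [mem_ball_zero_iff]; exact hk₁.trans_le (by exact_mod_cast h1)
    · exact hk₂.le.trans (by exact_mod_cast h2)
  refine ⟨G, hG, hex, fun k => ?_, fun k => ((memLp_coe f).indicator (hG k)).2,
    tendsto_eLpNorm_indicator_sub (by simpa using hp) (by simp) (memLp_coe f) hG hex⟩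
  rw [memLp_indicator_iff_restrict (hG k)]
  have : IsFiniteMeasure (volume.restrict (G k)) :=
    ⟨by rw [Measure.restrict_apply_univ]
        exact (measure_mono Set.inter_subset_left).trans_lt measure_ball_lt_top⟩
  refine MemLp.of_bound hfm.aestronglyMeasurable k ?_
  filter_upwards [ae_restrict_mem (hG k)] with x hx using hx.2

end weightedLp

namespace ThetaCZO

variable {n : ℕ} {θ : ℝ → ℝ} (T : ThetaCZO n θ) {p : ℝ} {w : Eucl n → ℝ}

open Filter Topology in
/-- A weighted bound on `L²` extends the operator to the weighted space by density. -/
theorem exists_isWeightedLpExt (hp : 1 < p) (hw : IsWeight w) {C : ℝ≥0}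
    (hC : ∀ f : Eucl n → ℂ, MemLp f 2 volume →
      weightedLpNorm p w (T.app f) ≤ C * weightedLpNorm p w f) :
    ∃ S : weightedLp n p w →ₗ[ℂ] weightedLp n p w, T.IsWeightedLpExt S := by
  have hp0 : 0 < p := by linarith
  have : Fact (1 ≤ ENNReal.ofReal p) := ⟨by simpa using hp.le⟩
  let j : Lp ℂ 2 (volume : Measure (Eucl n)) →ₗ[ℂ] (Eucl n →ₘ[volume] ℂ) :=
    { toFun := Subtype.val
      map_add' := fun _ _ => rfl
      map_smul' := fun _ _ => rfl }
  -- `E` is `L² ∩ L^p(w)`; `L` is the operator on it, `I` the inclusion, with dense range.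
  let E : Submodule ℂ (Lp ℂ 2 (volume : Measure (Eucl n))) := (weightedLp n p w).comap j
  have hL (u : Lp ℂ 2 (volume : Measure (Eucl n))) : weightedLpNorm p w (T.l2Ext u) ≤
      C * weightedLpNorm p w u := by
    rw [← T.app_coe u]
    exact hC u (Lp.memLp u)
  let L : E →ₗ[ℂ] weightedLp n p w :=
    { toFun := fun e => ⟨(T.l2Ext e : Eucl n →ₘ[volume] ℂ),
        (hL e).trans_lt (ENNReal.mul_lt_top ENNReal.coe_lt_top e.2)⟩
      map_add' := fun a b => Subtype.ext <| congrArg j <|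
        map_add T.l2Ext (a : Lp ℂ 2 (volume : Measure (Eucl n))) b
      map_smul' := fun c a => Subtype.ext <| congrArg j <|
        map_smul T.l2Ext c (a : Lp ℂ 2 (volume : Measure (Eucl n))) }
  let I : E →ₗ[ℂ] weightedLp n p w :=
    { toFun := fun e => ⟨j e, e.2⟩
      map_add' := fun _ _ => rfl
      map_smul' := fun _ _ => rfl }
  let e : E →ₗ[ℂ] Lp ℂ (ENNReal.ofReal p) (weightMeasure w) := weightedLp.toLp ∘ₗ I
  let f : E →ₗ[ℂ] Lp ℂ (ENNReal.ofReal p) (weightMeasure w) := weightedLp.toLp ∘ₗ L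
  have hnorm (x : E) : ‖f x‖ ≤ C * ‖e x‖ := by
    have h1 : ‖f x‖ₑ ≤ C * ‖e x‖ₑ := by
      change ‖weightedLp.toLp (L x)‖ₑ ≤ C * ‖weightedLp.toLp (I x)‖ₑ
      rw [weightedLp.enorm_toLp, weightedLp.enorm_toLp]
      exact hL x
    have h2 := ENNReal.toReal_mono (ENNReal.mul_ne_top ENNReal.coe_ne_top enorm_ne_top) h1
    simpa using h2
  have hdense : DenseRange e := by
    intro g
    rw [mem_closure_iff_seq_limit]
    set g' := weightedLp.ofLp hw g with hg'
    obtain ⟨G, hG, hex, h2, hp', hlim⟩ := weightedLp.exists_tendsto_indicator hp0 g'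
    let a (k : ℕ) : E := ⟨(h2 k).toLp, (weightedLp.mk _ (h2 k).1 (hp' k)).2⟩
    refine ⟨fun k => e (a k), fun k => ⟨a k, rfl⟩, ?_⟩
    rw [Lp.tendsto_Lp_iff_tendsto_eLpNorm']
    refine hlim.congr fun k => ?_
    refine eLpNorm_congr_ae ?_
    have e1 : (e (a k) : Eucl n → ℂ) =ᵐ[weightMeasure w]
        (G k).indicator (g' : Eucl n →ₘ[volume] ℂ) :=
      (weightedLp.memLp_coe (I (a k))).coeFn_toLp.trans
        ((weightMeasure_ac w).ae_le (h2 k).coeFn_toLp)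
    have e2 : (g : Eucl n → ℂ) =ᵐ[weightMeasure w] (g' : Eucl n →ₘ[volume] ℂ) :=
      Filter.EventuallyEq.symm ((weightMeasure_ac w).ae_le (weightedLp.coe_ofLp hw g))
    exact (e1.sub e2).symm
  let S₀ := f.extendOfNorm e
  refine ⟨weightedLp.ofLp hw ∘ₗ S₀.toLinearMap ∘ₗ weightedLp.toLp, ⟨C, fun u => ?_⟩,
    fun u hu => ?_⟩
  · have h1 := LinearMap.norm_extendOfNorm_apply_le hdense C hnorm (weightedLp.toLp u)
    have h3 : ‖S₀ (weightedLp.toLp u)‖ₑ ≤ C * ‖weightedLp.toLp u‖ₑ := by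
      rw [← ofReal_norm, ← ofReal_norm, ← ENNReal.ofReal_coe_nnreal,
        ← ENNReal.ofReal_mul C.coe_nonneg]
      exact ENNReal.ofReal_le_ofReal h1
    rw [weightedLp.enorm_toLp, ← weightedLp.weightedLpNorm_ofLp hw] at h3
    exact h3
  · have h1 : S₀ (weightedLp.toLp u) = weightedLp.toLp (L ⟨⟨u, hu⟩, u.2⟩) :=
      LinearMap.extendOfNorm_eq hdense ⟨C, hnorm⟩ ⟨⟨u, hu⟩, u.2⟩
    change ((weightedLp.ofLp hw (S₀ (weightedLp.toLp u)) : weightedLp n p w) :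
      Eucl n →ₘ[volume] ℂ) = _
    rw [h1, weightedLp.ofLp_toLp]
    rfl

end ThetaCZO

namespace IsMuckenhouptPair

variable {n : ℕ} {p q : ℝ} {w : Eucl n → ℝ} {σ : Eucl n → ℝ≥0∞} {A : ℝ≥0}

theorem integrableOn_ball (h : IsMuckenhouptPair p q (fun x => ENNReal.ofReal (w x)) σ A)
    (hw : IsWeight w) {f : Eucl n → ℂ} (hf : AEStronglyMeasurable f volume) {c : Eucl n} {r : ℝ}
    (hfin : eLpNorm f (ENNReal.ofReal p) ((weightMeasure w).restrict (ball c r)) < ∞) :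
    IntegrableOn f (ball c r) := by
  refine ⟨hf.restrict, (h.lintegral_le hf.enorm (ball c r)).trans_lt ?_⟩
  rw [← eLpNorm_restrict_weightMeasure h.conj.pos hw f measurableSet_ball]
  exact ENNReal.mul_lt_top hfin (ENNReal.rpow_lt_top_of_nonneg
    (one_div_pos.2 h.conj.symm.pos).le (h.ne_top_right c r))

end IsMuckenhouptPair

namespace ThetaCZO

variable {n : ℕ} {θ : ℝ → ℝ} (T : ThetaCZO n θ) {p q : ℝ} {w : Eucl n → ℝ} {σ : Eucl n → ℝ≥0∞}
  {A : ℝ≥0} {S : weightedLp n p w →ₗ[ℂ] weightedLp n p w}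

variable {T} in
theorem IsWeightedLpExt.ae_eq_app (hS : T.IsWeightedLpExt S) {g : weightedLp n p w} {f : Eucl n → ℂ}
    (hf : MemLp f 2 volume) (hg : (g : Eucl n →ₘ[volume] ℂ) =ᵐ[volume] f) :
    (S g : Eucl n →ₘ[volume] ℂ) =ᵐ[volume] T.app f := by
  have h1 : MemLp (g : Eucl n →ₘ[volume] ℂ) 2 volume := hf.ae_eq hg.symm
  have h2 := hS.agrees g (Lp.mem_Lp_iff_memLp.2 h1)
  rw [← T.app_congr hg, h2]
  exact .of_eq (T.app_coe ⟨_, Lp.mem_Lp_iff_memLp.2 h1⟩).symm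

/-- Away from the diagonal the kernel is bounded. This dominates the kernel integrals of functions
vanishing near `x`. -/
theorem norm_kernel_mul_le : ∃ C : ℝ, 0 < C ∧ ∀ (f : Eucl n → ℂ) (x : Eucl n) (δ : ℝ), 0 < δ →
    (∀ᵐ y, y ∈ ball x δ → f y = 0) →
    ∀ᵐ y, ‖T.kernel x y * f y‖ ≤ C / δ ^ n * ‖f y‖ := by
  obtain ⟨C, hC, hCK⟩ := T.isThetaKernel.exists_enorm_le
  refine ⟨C, hC, fun f x δ hδ h0 => h0.mono fun y hy => ?_⟩
  by_cases hyb : y ∈ ball x δ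
  · simp [hy hyb]
  have hd : δ ≤ dist x y := by rw [dist_comm]; simpa using hyb
  have hne : x ≠ y := by rintro rfl; simp at hd; linarith
  rw [norm_mul]
  gcongr
  have h1 := hCK x y hne
  rw [← ofReal_norm, ENNReal.ofReal_le_ofReal_iff (by positivity)] at h1
  refine h1.trans ?_
  gcongr

open Filter Topology in
variable {T} in
/-- The extension to the weighted space is represented by the kernel, on balls where the function
vanishes. -/
theorem IsWeightedLpExt.eq_integral (hS : T.IsWeightedLpExt S) (hn : 1 ≤ n)
    (hK : Measurable (Function.uncurry T.kernel))
    (h : IsMuckenhouptPair p q (fun x => ENNReal.ofReal (w x)) σ A) (hw : IsWeight w)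
    (f : weightedLp n p w) {c x₀ : Eucl n} {ρ R : ℝ}
    (hsupp : ∀ᵐ y, y ∉ ball c ρ → (f : Eucl n →ₘ[volume] ℂ) y = 0)
    (h0 : ∀ᵐ y, y ∈ ball x₀ R → (f : Eucl n →ₘ[volume] ℂ) y = 0) :
    ∀ᵐ x, x ∈ ball x₀ R → (S f : Eucl n →ₘ[volume] ℂ) x =
      ∫ y, T.kernel x y * (f : Eucl n →ₘ[volume] ℂ) y := by
  have hp := h.conj.pos
  set F : Eucl n → ℂ := ⇑(f : Eucl n →ₘ[volume] ℂ) with hF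
  have hFi : Integrable F := (h.integrableOn_ball hw f.1.aestronglyMeasurable
    ((eLpNorm_mono_measure _ Measure.restrict_le_self).trans_lt
      (weightedLp.memLp_coe f).2)).integrable_of_ae_notMem_eq_zero hsupp
  obtain ⟨G, hG, hex, h2, hpw, hlim⟩ := weightedLp.exists_tendsto_indicator hp f
  let g (k : ℕ) : weightedLp n p w := weightedLp.mk _ (h2 k).1 (hpw k)
  have hg (k : ℕ) : (g k : Eucl n →ₘ[volume] ℂ) =ᵐ[volume] (G k).indicator F :=
    weightedLp.coe_mk _ _ _
  have hSg (k : ℕ) := hS.ae_eq_app (h2 k) (hg k)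
  obtain ⟨C, hC⟩ := hS.bounded
  have hlim2 : Tendsto (fun k => eLpNorm ((S (g k) : Eucl n →ₘ[volume] ℂ) -
      (S f : Eucl n →ₘ[volume] ℂ) : Eucl n → ℂ) (ENNReal.ofReal p) (weightMeasure w))
      atTop (𝓝 0) := by
    have hb (k : ℕ) : eLpNorm ((S (g k) : Eucl n →ₘ[volume] ℂ) -
        (S f : Eucl n →ₘ[volume] ℂ) : Eucl n → ℂ) (ENNReal.ofReal p) (weightMeasure w) ≤
        C * weightedLpNorm p w ((G k).indicator F - F) := by
      have := hC (g k - f)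
      have e : S (g k - f) = S (g k) - S f := map_sub S _ _
      rw [e] at this
      refine le_trans (le_of_eq ?_) (this.trans_eq ?_)
      · exact weightedLpNorm_congr p w (AEEqFun.coeFn_sub _ _).symm
      · congr 1
        exact weightedLpNorm_congr p w ((AEEqFun.coeFn_sub _ _).trans ((hg k).sub .rfl))
    refine tendsto_of_tendsto_of_tendsto_of_le_of_le tendsto_const_nhds ?_ (fun _ => zero_le) hb
    simpa using ENNReal.Tendsto.const_mul hlim (.inr ENNReal.coe_ne_top)
  obtain ⟨ns, hns, hae⟩ := exists_subseq_ae_tendsto (p := ENNReal.ofReal p)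
    (f := fun k => (S (g k) : Eucl n →ₘ[volume] ℂ)) (g := (S f : Eucl n →ₘ[volume] ℂ))
    (by simpa using hp) (fun k => (weightedLp.memLp_coe (S (g k))).1)
    (weightedLp.memLp_coe (S f)).1 hlim2
  have hrep (k : ℕ) := T.app_eq_integral hn hK (h2 k) (isOpen_ball (x := x₀) (ε := R))
    (h0.mono fun y hy hyb =>
      Set.indicator_apply_eq_zero.2 fun _ => hy hyb)
  obtain ⟨D, hD, hDK⟩ := T.norm_kernel_mul_le
  -- Both sides are limits along the truncations of `f`, for which `S` is the operator on `L²`.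
  filter_upwards [(volume_ac_weightMeasure hw).ae_le hae, ae_all_iff.2 hSg, ae_all_iff.2 hrep]
    with x hx hxS hxr hxb
  refine tendsto_nhds_unique hx ?_
  have e (k : ℕ) : (S (g (ns k)) : Eucl n →ₘ[volume] ℂ) x =
      ∫ y, T.kernel x y * (G (ns k)).indicator F y := (hxS _).trans (hxr _ hxb)
  simp_rw [e]
  have hδ : 0 < R - dist x x₀ := by simpa using hxb
  have hxz : ∀ᵐ y, y ∈ ball x (R - dist x x₀) → F y = 0 := h0.mono fun y hy hyb => hy (by
    rw [mem_ball] at hyb ⊢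
    linarith [dist_triangle y x x₀])
  have hbd := hDK F x _ hδ hxz
  have hKF : AEStronglyMeasurable (fun y => T.kernel x y * F y) volume :=
    (T.measurable_kernel_left hK x).aestronglyMeasurable.mul hFi.1
  have hlim3 : Tendsto (fun k => ∫ y, T.kernel x y * (G k).indicator F y) atTop
      (𝓝 (∫ y, T.kernel x y * F y)) := by
    refine tendsto_integral_of_dominated_convergence
      (fun y => D / (R - dist x x₀) ^ n * ‖F y‖) (fun k => ?_) (hFi.norm.const_mul _) (fun k => ?_)
      (.of_forall fun y => ?_)
    · exact (T.measurable_kernel_left hK x).aestronglyMeasurable.mul (hFi.1.indicator (hG k))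
    · filter_upwards [hbd] with y hy
      by_cases hyG : y ∈ G k
      · simpa [hyG] using hy
      · simp only [Set.indicator_of_notMem hyG, mul_zero, norm_zero]
        positivity
    · refine tendsto_const_nhds.congr' ?_
      filter_upwards [hex y] with k hk
      rw [Set.indicator_of_mem hk]
  exact hlim3.comp hns.tendsto_atTop

end ThetaCZO

/-! ### Morrey norms and the tail of the kernel integral -/

namespace IsMuckenhouptPair

variable {n : ℕ} {p q : ℝ} {w : Eucl n → ℝ} {σ : Eucl n → ℝ≥0∞} {A : ℝ≥0}

theorem weightMeasure_ball_ne_top (h : IsMuckenhouptPair p q (fun x => ENNReal.ofReal (w x)) σ A)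
    (c : Eucl n) (r : ℝ) : weightMeasure w (ball c r) ≠ ∞ := by
  rw [weightMeasure, withDensity_apply _ measurableSet_ball]
  exact h.ne_top_left c r

theorem real_ball_pos (h : IsMuckenhouptPair p q (fun x => ENNReal.ofReal (w x)) σ A)
    (c : Eucl n) {r : ℝ} (hr : 0 < r) : 0 < (weightMeasure w).real (ball c r) := by
  refine ENNReal.toReal_pos ?_ (h.weightMeasure_ball_ne_top c r)
  rw [weightMeasure, withDensity_apply _ measurableSet_ball]
  exact h.lintegral_ball_ne_zero c hr

theorem real_ball_mono (h : IsMuckenhouptPair p q (fun x => ENNReal.ofReal (w x)) σ A)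
    (c : Eucl n) {r s : ℝ} (hrs : r ≤ s) :
    (weightMeasure w).real (ball c r) ≤ (weightMeasure w).real (ball c s) :=
  measureReal_mono (ball_subset_ball hrs) (h.weightMeasure_ball_ne_top c s)

theorem exists_real_ball_two_mul_le
    (h : IsMuckenhouptPair p q (fun x => ENNReal.ofReal (w x)) σ A) :
    ∃ D : ℝ, 0 < D ∧ ∀ (c : Eucl n) (r : ℝ), 0 < r →
      (weightMeasure w).real (ball c (2 * r)) ≤ D * (weightMeasure w).real (ball c r) := by
  obtain ⟨D, hD⟩ := h.ballDoubling
  refine ⟨D + 1, by positivity, fun c r hr => ?_⟩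
  have h1 := ENNReal.toReal_mono (ENNReal.mul_ne_top ENNReal.coe_ne_top
    (h.weightMeasure_ball_ne_top c r)) (hD.doubling c r hr)
  have h2 := h.real_ball_mono c (show 2 * r ≤ 4 * r by linarith)
  rw [ENNReal.toReal_mul, ENNReal.coe_toReal] at h1
  have h3 := h.real_ball_pos c hr
  refine h2.trans (h1.trans ?_)
  change _ * (weightMeasure w).real _ ≤ _
  nlinarith

/-- Reverse doubling: a ball has at most a fixed proportion of the mass of its double, since the
double contains a ball of comparable size outside of it. -/
theorem exists_real_ball_le (hn : 1 ≤ n)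
    (h : IsMuckenhouptPair p q (fun x => ENNReal.ofReal (w x)) σ A) :
    ∃ γ : ℝ, 0 ≤ γ ∧ γ < 1 ∧ ∀ (c : Eucl n) (r : ℝ), 0 < r →
      (weightMeasure w).real (ball c r) ≤ γ * (weightMeasure w).real (ball c (2 * r)) := by
  have hp := h.conj.pos
  set K : ℝ := (A * 4 ^ n) ^ p with hK
  have hK0 : 0 ≤ K := by positivity
  refine ⟨K / (K + 1), by positivity, by rw [div_lt_one (by positivity)]; linarith,
    fun c r hr => ?_⟩
  -- The ball `s` of radius `r / 2` lies between `B(c, r)` and `B(c, 2 r)`, and `w(B(c, 2 r)) ≤ K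
  -- w(s)`.
  let e : Eucl n := EuclideanSpace.single ⟨0, hn⟩ 1
  have he : ‖e‖ = 1 := by simp [e]
  set s := ball (c + (3 / 2 * r) • e) (r / 2) with hs
  have hdc : dist (c + (3 / 2 * r) • e) c = 3 / 2 * r := by
    rw [dist_eq_norm, add_sub_cancel_left, norm_smul, he, mul_one, Real.norm_eq_abs,
      abs_of_pos (by positivity)]
  have hsub : s ⊆ ball c (2 * r) := ball_subset_ball' (by rw [hdc]; linarith)
  have hdisj : Disjoint (ball c r) s :=
    ball_disjoint_ball (by rw [dist_comm, hdc]; linarith)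
  have h1 := h.mul_measure_rpow_le measurableSet_ball (mul_pos two_pos hr) hsub
  set V := volume (ball c (2 * r)) with hV
  have hV0 : V ≠ 0 := (measure_ball_pos volume c (by positivity)).ne'
  have hVt : V ≠ ∞ := measure_ball_lt_top.ne
  have hVs : V = ENNReal.ofReal (4 ^ n) * volume s := by
    rw [hs, Measure.addHaar_ball_center, ← Measure.addHaar_ball_center volume c,
      ← Eucl.volume_ball_mul c four_pos, hV]
    congr 2
    ring
  have hs0 : volume s ≠ 0 := (measure_ball_pos volume _ (by positivity)).ne'
  have hst : volume s ≠ ∞ := measure_ball_lt_top.ne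
  have hm (t : Set (Eucl n)) (ht : MeasurableSet t) : ∫⁻ x in t, ENNReal.ofReal (w x) =
      weightMeasure w t := by rw [weightMeasure, withDensity_apply _ ht]
  rw [hm _ measurableSet_ball, hm _ measurableSet_ball, hVs, ← mul_assoc,
    ENNReal.mul_rpow_of_nonneg _ _ hp.le, mul_comm _ (volume s ^ p), mul_assoc,
    ENNReal.mul_le_mul_iff_right (by simp [ENNReal.rpow_eq_zero_iff, hs0, hst])
      (ENNReal.rpow_ne_top_of_nonneg hp.le hst)] at h1
  have hst' : weightMeasure w s ≠ ∞ := h.weightMeasure_ball_ne_top _ _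
  have h2 := ENNReal.toReal_mono (ENNReal.mul_ne_top (by finiteness) hst') h1
  rw [ENNReal.toReal_mul, ← ENNReal.toReal_rpow, ENNReal.toReal_mul, ENNReal.coe_toReal,
    ENNReal.toReal_ofReal (by positivity), ← hK] at h2
  have h3 : (weightMeasure w).real (ball c r) + (weightMeasure w).real s ≤
      (weightMeasure w).real (ball c (2 * r)) := by
    rw [← measureReal_union hdisj measurableSet_ball (h.weightMeasure_ball_ne_top c r) hst']
    exact measureReal_mono (Set.union_subset (ball_subset_ball (by linarith)) hsub)
      (h.weightMeasure_ball_ne_top c _)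
  change (weightMeasure w).real (ball c (2 * r)) ≤ K * (weightMeasure w).real s at h2
  rw [div_mul_eq_mul_div, le_div_iff₀ (by positivity)]
  have h4 : 0 ≤ (weightMeasure w).real s := measureReal_nonneg
  nlinarith

end IsMuckenhouptPair

theorem weightMeasure_real_ball_le_pow {n : ℕ} {w : Eucl n → ℝ} {γ : ℝ}
    (hγ : 0 ≤ γ) (hγ' : ∀ (c : Eucl n) (r : ℝ), 0 < r →
      (weightMeasure w).real (ball c r) ≤ γ * (weightMeasure w).real (ball c (2 * r)))
    (c : Eucl n) {r : ℝ} (hr : 0 < r) (j : ℕ) :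
    (weightMeasure w).real (ball c r) ≤ γ ^ j * (weightMeasure w).real (ball c (2 ^ j * r)) := by
  induction j with
  | zero => simp
  | succ j ih =>
    refine ih.trans ?_
    rw [pow_succ γ, mul_assoc, pow_succ', mul_assoc]
    gcongr
    exact hγ' c _ (by positivity)

namespace IsGrowth

variable {κ : ℝ} {ψ : ℝ → ℝ}

/-- The `D_κ` condition, with a constant which also serves equal arguments. -/
theorem exists_le_mul (hψ : IsGrowth κ ψ) : ∃ C : ℝ, 0 < C ∧ ∀ s t : ℝ, 0 < s → s ≤ t →
    ψ t ≤ C * (t / s) ^ κ * ψ s := by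
  obtain ⟨C, hC, h⟩ := hψ.dcond
  refine ⟨max C 1, by positivity, fun s t hs hst => ?_⟩
  have ht := hs.trans_le hst
  have hs1 := hψ.pos s hs
  rcases hst.eq_or_lt with rfl | hlt
  · rw [div_self hs.ne', Real.one_rpow, mul_one]
    exact le_mul_of_one_le_left hs1.le (le_max_right _ _)
  have h1 := h s t hs hlt
  have htk : 0 < t ^ κ := Real.rpow_pos_of_pos ht κ
  have hsk : 0 < s ^ κ := Real.rpow_pos_of_pos hs κ
  rw [div_le_iff₀ htk] at h1
  rw [Real.div_rpow ht.le hs.le]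
  calc ψ t ≤ C * (ψ s / s ^ κ) * t ^ κ := h1
    _ = C * (t ^ κ / s ^ κ) * ψ s := by ring
    _ ≤ _ := by gcongr; exact le_max_left _ _

/-- The decay of `ψ(t) / t`. -/
theorem exists_div_le_mul (hψ : IsGrowth κ ψ) (hκ : κ < 1) : ∃ C : ℝ, 0 < C ∧
    ∀ s t a : ℝ, 0 < s → s ≤ t → 0 ≤ a → s ≤ a * t → ψ t / t ≤ C * a ^ (1 - κ) * (ψ s / s) := by
  obtain ⟨C, hC, h⟩ := hψ.exists_le_mul
  refine ⟨C, hC, fun s t a hs hst ha hat => ?_⟩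
  have ht := hs.trans_le hst
  have hs1 := hψ.pos s hs
  have hsa : s / t ≤ a := (div_le_iff₀ ht).2 hat
  calc ψ t / t ≤ C * (t / s) ^ κ * ψ s / t := by gcongr; exact h s t hs hst
    _ = C * ((s / t) * (t / s) ^ κ) * (ψ s / s) := by field_simp
    _ = C * (s / t) ^ (1 - κ) * (ψ s / s) := by
        have e : (t / s) ^ κ = (s / t) ^ (-κ) := by
          rw [Real.rpow_neg (by positivity), ← Real.inv_rpow (by positivity), inv_div]
        rw [e, sub_eq_add_neg, Real.rpow_add (by positivity), Real.rpow_one]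
    _ ≤ _ := by
        have := div_pos hs1 hs
        gcongr

end IsGrowth

section Morrey

variable {n : ℕ} {p : ℝ} {ψ : ℝ → ℝ} {w : Eucl n → ℝ}

theorem eLpNorm_ball_le_morreyNorm (hp : 0 < p) (f : Eucl n → ℂ) (c : Eucl n) {r : ℝ}
    (hr : 0 < r) (hψ : 0 < ψ ((weightMeasure w).real (ball c r))) :
    eLpNorm f (ENNReal.ofReal p) ((weightMeasure w).restrict (ball c r)) ≤
      morreyNorm p ψ w f *
        ENNReal.ofReal (ψ ((weightMeasure w).real (ball c r))) ^ (1 / p) := by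
  have h0 : ENNReal.ofReal (ψ ((weightMeasure w).real (ball c r))) ≠ 0 := by simpa using hψ
  have hip : 0 ≤ 1 / p := (one_div_pos.2 hp).le
  rw [← ENNReal.div_le_iff_le_mul (.inl (by simp [ENNReal.rpow_eq_zero_iff, h0]))
    (.inl (ENNReal.rpow_ne_top_of_nonneg hip ENNReal.ofReal_ne_top))]
  exact le_iSup_of_le c (le_iSup_of_le r (le_iSup_of_le hr le_rfl))

theorem morreyNorm_le (hp : 0 < p) {f : Eucl n → ℂ} {M : ℝ≥0∞}
    (h : ∀ (c : Eucl n) (r : ℝ), 0 < r → 0 < ψ ((weightMeasure w).real (ball c r)) ∧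
      eLpNorm f (ENNReal.ofReal p) ((weightMeasure w).restrict (ball c r)) ≤
        M * ENNReal.ofReal (ψ ((weightMeasure w).real (ball c r))) ^ (1 / p)) :
    morreyNorm p ψ w f ≤ M := by
  refine iSup_le fun c => iSup_le fun r => iSup_le fun hr => ?_
  obtain ⟨h1, h2⟩ := h c r hr
  have h0 : ENNReal.ofReal (ψ ((weightMeasure w).real (ball c r))) ≠ 0 := by simpa using h1
  have hip : 0 ≤ 1 / p := (one_div_pos.2 hp).le
  rwa [ENNReal.div_le_iff_le_mul (.inl (by simp [ENNReal.rpow_eq_zero_iff, h0]))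
    (.inl (ENNReal.rpow_ne_top_of_nonneg hip ENNReal.ofReal_ne_top))]

end Morrey

namespace ThetaCZO

variable {n : ℕ} {θ : ℝ → ℝ} (T : ThetaCZO n θ) {p q : ℝ} {w : Eucl n → ℝ} {σ : Eucl n → ℝ≥0∞}
  {A : ℝ≥0} {κ : ℝ} {ψ : ℝ → ℝ}

/-- The tail of the kernel integral, for `x ∈ B`: the average of `|f|` over `2^j B` is controlled by
the Morrey norm, with geometric decay in `j` by the `D_κ` condition and reverse doubling. -/
theorem exists_lintegral_tail_le (hn : 1 ≤ n)
    (h : IsMuckenhouptPair p q (fun x => ENNReal.ofReal (w x)) σ A) (hw : IsWeight w)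
    (hκ : κ < 1) (hψ : IsGrowth κ ψ) :
    ∃ C : ℝ≥0, ∀ (f : Eucl n → ℂ), AEStronglyMeasurable f volume → ∀ (c : Eucl n) (r : ℝ), 0 < r →
      ∀ x ∈ ball c r, ∫⁻ y in (ball c (2 * r))ᶜ, ‖T.kernel x y * f y‖ₑ ≤
        C * morreyNorm p ψ w f * ENNReal.ofReal (ψ ((weightMeasure w).real (ball c r)) /
          (weightMeasure w).real (ball c r)) ^ (1 / p) := by
  have hp := h.conj.pos
  have hip : 0 < 1 / p := one_div_pos.2 hp
  obtain ⟨C, hC, hCK⟩ := T.isThetaKernel.exists_enorm_le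
  obtain ⟨γ, hγ0, hγ1, hγ⟩ := h.exists_real_ball_le hn
  obtain ⟨C', hC', hdiv⟩ := hψ.exists_div_le_mul hκ
  set β : ℝ≥0∞ := ENNReal.ofReal (γ ^ (1 - κ)) ^ (1 / p) with hβ
  have hβ1 : β < 1 := by
    refine ENNReal.rpow_lt_one ?_ hip
    rw [← ENNReal.ofReal_one, ENNReal.ofReal_lt_ofReal_iff one_pos]
    exact Real.rpow_lt_one hγ0 hγ1 (by linarith)
  -- One factor `2 ^ n` comes from `|y - c| ≤ 2 |x - y|`, one from doubling the radius of the ball.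
  set L : ℝ≥0∞ := ENNReal.ofReal (C * 2 ^ n * 2 ^ n) * volume (ball (0 : Eucl n) 1) with hL
  have hLt : L ≠ ∞ := ENNReal.mul_ne_top ENNReal.ofReal_ne_top measure_ball_lt_top.ne
  set E : ℝ≥0∞ := A * L * ENNReal.ofReal C' ^ (1 / p) * (1 - β)⁻¹ with hE
  have hEt : E ≠ ∞ := by
    refine ENNReal.mul_ne_top (ENNReal.mul_ne_top (ENNReal.mul_ne_top ENNReal.coe_ne_top hLt)
      (ENNReal.rpow_ne_top_of_nonneg hip.le ENNReal.ofReal_ne_top)) ?_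
    exact ENNReal.inv_ne_top.2 (tsub_pos_of_lt hβ1).ne'
  refine ⟨E.toNNReal, fun f hf c r hr x hx => ?_⟩
  rw [ENNReal.coe_toNNReal hEt]
  set N := morreyNorm p ψ w f with hN
  set μ := weightMeasure w with hμ
  set Q := ENNReal.ofReal (ψ (μ.real (ball c r)) / μ.real (ball c r)) ^ (1 / p) with hQ
  have hterm (j : ℕ) : ENNReal.ofReal (C * 2 ^ n / (2 ^ j * (2 * r)) ^ n) *
      ∫⁻ y in ball c (2 ^ (j + 1) * (2 * r)), ‖f y‖ₑ ≤
      A * L * ENNReal.ofReal C' ^ (1 / p) * N * Q * β ^ j := by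
    set ρ := 2 ^ (j + 1) * (2 * r) with hρ
    have hρ0 : 0 < ρ := by positivity
    have hρe : ρ = 2 ^ (j + 2) * r := by rw [hρ, pow_succ 2 (j + 1)]; ring
    set t := μ.real (ball c ρ) with ht
    have ht0 : 0 < t := h.real_ball_pos c hρ0
    have hψt := hψ.pos t ht0
    have hs0 : 0 < μ.real (ball c r) := h.real_ball_pos c hr
    have hψs := hψ.pos _ hs0
    have h1 := h.lintegral_ball_mul_le hf.enorm c hρ0
    rw [← eLpNorm_restrict_weightMeasure hp hw f measurableSet_ball] at h1
    have hmt : ∫⁻ x in ball c ρ, ENNReal.ofReal (w x) = ENNReal.ofReal t := by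
      rw [ht, hμ, measureReal_def, ENNReal.ofReal_toReal (h.weightMeasure_ball_ne_top c ρ),
        weightMeasure, withDensity_apply _ measurableSet_ball]
    rw [hmt] at h1
    have h2 := h1.trans (mul_le_mul_right (eLpNorm_ball_le_morreyNorm hp f c hρ0 hψt) _)
    have ht1 : ENNReal.ofReal t ^ (1 / p) ≠ 0 := by
      simp [ENNReal.rpow_eq_zero_iff, ht0]
    have ht2 : ENNReal.ofReal t ^ (1 / p) ≠ ∞ :=
      ENNReal.rpow_ne_top_of_nonneg hip.le ENNReal.ofReal_ne_top
    rw [← ENNReal.le_div_iff_mul_le (.inl ht1) (.inl ht2), mul_div_assoc, mul_div_assoc,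
      ← ENNReal.div_rpow_of_nonneg _ _ hip.le, ← ENNReal.ofReal_div_of_pos ht0] at h2
    have h3 : ψ t / t ≤ C' * (γ ^ (1 - κ)) ^ j * (ψ (μ.real (ball c r)) / μ.real (ball c r)) := by
      refine (hdiv _ t (γ ^ j) hs0 (h.real_ball_mono c ?_) (by positivity) ?_).trans_eq ?_
      · rw [hρe]
        exact le_mul_of_one_le_left hr.le (one_le_pow₀ one_le_two)
      · refine (weightMeasure_real_ball_le_pow hγ0 hγ c hr j).trans ?_
        gcongr
        refine h.real_ball_mono c ?_
        rw [hρe]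
        gcongr
        · exact one_le_two
        · omega
      · rw [← Real.rpow_natCast, ← Real.rpow_natCast, ← Real.rpow_mul hγ0, ← Real.rpow_mul hγ0,
          mul_comm (1 - κ)]
    have h4 : ENNReal.ofReal (ψ t / t) ^ (1 / p) ≤ ENNReal.ofReal C' ^ (1 / p) * β ^ j * Q := by
      have h5 := ENNReal.rpow_le_rpow (ENNReal.ofReal_le_ofReal h3) hip.le
      have hγκ : 0 ≤ γ ^ (1 - κ) := Real.rpow_nonneg hγ0 _
      rw [ENNReal.ofReal_mul (by positivity), ENNReal.ofReal_mul hC'.le,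
        ENNReal.mul_rpow_of_nonneg _ _ hip.le, ENNReal.mul_rpow_of_nonneg _ _ hip.le,
        ENNReal.ofReal_pow hγκ] at h5
      rwa [hβ, ← ENNReal.rpow_natCast, ← ENNReal.rpow_mul, mul_comm (1 / p), ENNReal.rpow_mul,
        ENNReal.rpow_natCast]
    have hvol := ofReal_div_mul_volume_ball c (show 0 ≤ C * 2 ^ n by positivity)
      (show 0 < 2 * r by positivity) j
    calc _ ≤ ENNReal.ofReal (C * 2 ^ n / (2 ^ j * (2 * r)) ^ n) * (A * volume (ball c ρ) *
          (N * (ENNReal.ofReal C' ^ (1 / p) * β ^ j * Q))) := by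
          refine mul_le_mul_right (h2.trans ?_) _
          gcongr
      _ = A * (ENNReal.ofReal (C * 2 ^ n / (2 ^ j * (2 * r)) ^ n) * volume (ball c ρ)) *
          ENNReal.ofReal C' ^ (1 / p) * N * Q * β ^ j := by ring
      _ = _ := by rw [hvol]
  calc ∫⁻ y in (ball c (2 * r))ᶜ, ‖T.kernel x y * f y‖ₑ
      = ∫⁻ y in (ball c (2 * r))ᶜ, ‖T.kernel x y‖ₑ * ‖f y‖ₑ := by simp_rw [enorm_mul]
    _ ≤ ∑' j : ℕ, ENNReal.ofReal (C * 2 ^ n / (2 ^ j * (2 * r)) ^ n) *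
          ∫⁻ y in ball c (2 ^ (j + 1) * (2 * r)), ‖f y‖ₑ := by
        refine lintegral_compl_ball_mul_le c (by positivity) (fun _ => ENNReal.ofReal_ne_top)
          fun j y hy _ => ?_
        have h2r : 2 * r ≤ dist y c :=
          (le_mul_of_one_le_left (by positivity) (one_le_pow₀ one_le_two)).trans hy
        have hxc : dist x c < r := hx
        have hxy : dist y c ≤ 2 * dist x y := by
          have := dist_triangle y x c
          rw [dist_comm y x] at this
          linarith
        have hne : x ≠ y := by rintro rfl; linarith
        refine (hCK x y hne).trans (ENNReal.ofReal_le_ofReal ?_)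
        have hd : 2 ^ j * (2 * r) / 2 ≤ dist x y := by linarith
        calc C / dist x y ^ n ≤ C / (2 ^ j * (2 * r) / 2) ^ n := by gcongr
          _ = _ := by rw [div_pow]; field_simp
    _ ≤ ∑' j : ℕ, A * L * ENNReal.ofReal C' ^ (1 / p) * N * Q * β ^ j :=
        ENNReal.tsum_le_tsum hterm
    _ = _ := by
        rw [ENNReal.tsum_mul_left, ENNReal.tsum_geometric, hE]
        ring

end ThetaCZO

/-! ### The action on the Morrey space -/

namespace IsMuckenhouptPair

variable {n : ℕ} {p q : ℝ} {w : Eucl n → ℝ} {σ : Eucl n → ℝ≥0∞} {A : ℝ≥0} {κ : ℝ} {ψ : ℝ → ℝ}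

theorem weightedLpNorm_indicator_lt_top
    (h : IsMuckenhouptPair p q (fun x => ENNReal.ofReal (w x)) σ A) (hψ : IsGrowth κ ψ)
    (f : morreySpace n p ψ w) (c : Eucl n) (r : ℝ) :
    weightedLpNorm p w ((ball c r).indicator (f : Eucl n →ₘ[volume] ℂ)) < ∞ := by
  rw [weightedLpNorm, eLpNorm_indicator_eq_eLpNorm_restrict measurableSet_ball]
  rcases le_or_gt r 0 with hr | hr
  · simp [ball_eq_empty.2 hr]
  · refine (eLpNorm_ball_le_morreyNorm h.conj.pos _ c hr
      (hψ.pos _ (h.real_ball_pos c hr))).trans_lt (ENNReal.mul_lt_top f.2.2 ?_)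
    exact ENNReal.rpow_lt_top_of_nonneg (one_div_pos.2 h.conj.pos).le ENNReal.ofReal_ne_top

/-- The restriction of functions in the Morrey space to a ball. -/
noncomputable def restrictBall
    (h : IsMuckenhouptPair p q (fun x => ENNReal.ofReal (w x)) σ A) (hψ : IsGrowth κ ψ)
    (c : Eucl n) (r : ℝ) : morreySpace n p ψ w →ₗ[ℂ] weightedLp n p w where
  toFun f := weightedLp.mk ((ball c r).indicator (f : Eucl n →ₘ[volume] ℂ))
    (f.1.aestronglyMeasurable.indicator measurableSet_ball)
    (h.weightedLpNorm_indicator_lt_top hψ f c r)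
  map_add' f g := Subtype.ext <| AEEqFun.ext <| (weightedLp.coe_mk _ _ _).trans <| by
    refine Filter.EventuallyEq.trans ?_ ((AEEqFun.coeFn_add _ _).trans
      ((weightedLp.coe_mk _ _ _).add (weightedLp.coe_mk _ _ _))).symm
    filter_upwards [AEEqFun.coeFn_add (f : Eucl n →ₘ[volume] ℂ) (g : Eucl n →ₘ[volume] ℂ)]
      with x hx
    by_cases hxb : x ∈ ball c r
    · simpa [hxb] using hx
    · simp [hxb]
  map_smul' a f := Subtype.ext <| AEEqFun.ext <| (weightedLp.coe_mk _ _ _).trans <| by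
    refine Filter.EventuallyEq.trans ?_ ((AEEqFun.coeFn_smul _ _).trans
      ((weightedLp.coe_mk _ _ _).const_smul a)).symm
    filter_upwards [AEEqFun.coeFn_smul a (f : Eucl n →ₘ[volume] ℂ)] with x hx
    by_cases hxb : x ∈ ball c r
    · simpa [hxb] using hx
    · simp [hxb]

theorem coe_restrictBall (h : IsMuckenhouptPair p q (fun x => ENNReal.ofReal (w x)) σ A)
    (hψ : IsGrowth κ ψ) (c : Eucl n) (r : ℝ) (f : morreySpace n p ψ w) :
    (h.restrictBall hψ c r f : Eucl n →ₘ[volume] ℂ) =ᵐ[volume]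
      (ball c r).indicator (f : Eucl n →ₘ[volume] ℂ) :=
  AEEqFun.coeFn_mk _ _

end IsMuckenhouptPair

namespace ThetaCZO

variable {n : ℕ} {θ : ℝ → ℝ} (T : ThetaCZO n θ) {p q : ℝ} {w : Eucl n → ℝ} {σ : Eucl n → ℝ≥0∞}
  {A : ℝ≥0} {κ : ℝ} {ψ : ℝ → ℝ} (S : weightedLp n p w →ₗ[ℂ] weightedLp n p w)

theorem integrableOn_tail (hn : 1 ≤ n) (hK : Measurable (Function.uncurry T.kernel))
    (h : IsMuckenhouptPair p q (fun x => ENNReal.ofReal (w x)) σ A) (hw : IsWeight w)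
    (hκ : κ < 1) (hψ : IsGrowth κ ψ) (f : morreySpace n p ψ w) {c x : Eucl n} {r : ℝ} (hr : 0 < r)
    (hx : x ∈ ball c r) :
    IntegrableOn (fun y => T.kernel x y * (f : Eucl n →ₘ[volume] ℂ) y) (ball c (2 * r))ᶜ := by
  obtain ⟨C, hC⟩ := T.exists_lintegral_tail_le hn h hw hκ hψ
  refine ⟨((T.measurable_kernel_left hK x).aestronglyMeasurable.mul
    f.1.aestronglyMeasurable).restrict, ?_⟩
  refine (hC _ f.1.aestronglyMeasurable c r hr x hx).trans_lt ?_
  exact ENNReal.mul_lt_top (ENNReal.mul_lt_top ENNReal.coe_lt_top f.2.2)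
    (ENNReal.rpow_lt_top_of_nonneg (one_div_pos.2 h.conj.pos).le ENNReal.ofReal_ne_top)

/-- The function `S (f χ_{2B}) + ∫_{(2B)ᶜ} K(·, y) f(y) dy`, which is meant to be used in the ball
`B` of center `c` and radius `r`. -/
noncomputable def localAct (h : IsMuckenhouptPair p q (fun x => ENNReal.ofReal (w x)) σ A)
    (hψ : IsGrowth κ ψ) (f : morreySpace n p ψ w) (c : Eucl n) (r : ℝ) (x : Eucl n) : ℂ :=
  (S (h.restrictBall hψ c (2 * r) f) : Eucl n →ₘ[volume] ℂ) x +
    ∫ y in (ball c (2 * r))ᶜ, T.kernel x y * (f : Eucl n →ₘ[volume] ℂ) y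

theorem measurable_localAct (hK : Measurable (Function.uncurry T.kernel))
    (h : IsMuckenhouptPair p q (fun x => ENNReal.ofReal (w x)) σ A)
    (hψ : IsGrowth κ ψ) (f : morreySpace n p ψ w) (c : Eucl n) (r : ℝ) :
    Measurable (T.localAct S h hψ f c r) := by
  refine (AEEqFun.measurable _).add (StronglyMeasurable.integral_prod_right ?_).measurable
  exact (hK.mul ((AEEqFun.measurable _).comp measurable_snd)).stronglyMeasurable

variable {T S}

/-- The difference of the local actions on two balls is `S` applied to a function vanishing near the
smaller ball, minus its kernel integral. -/
theorem localAct_ae_eq_of_subset (hS : T.IsWeightedLpExt S) (hn : 1 ≤ n)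
    (hK : Measurable (Function.uncurry T.kernel))
    (h : IsMuckenhouptPair p q (fun x => ENNReal.ofReal (w x)) σ A) (hw : IsWeight w)
    (hκ : κ < 1) (hψ : IsGrowth κ ψ) (f : morreySpace n p ψ w) {c c' : Eucl n} {r r' : ℝ}
    (hr : 0 < r) (hsub : ball c (2 * r) ⊆ ball c' (2 * r')) :
    ∀ᵐ x, x ∈ ball c r → x ∈ ball c' r' →
      T.localAct S h hψ f c r x = T.localAct S h hψ f c' r' x := by
  set g := h.restrictBall hψ c' (2 * r') f - h.restrictBall hψ c (2 * r) f with hg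
  have hgc : (g : Eucl n →ₘ[volume] ℂ) =ᵐ[volume]
      (ball c' (2 * r') \ ball c (2 * r)).indicator (f : Eucl n →ₘ[volume] ℂ) := by
    filter_upwards [AEEqFun.coeFn_sub (h.restrictBall hψ c' (2 * r') f : Eucl n →ₘ[volume] ℂ)
      (h.restrictBall hψ c (2 * r) f : Eucl n →ₘ[volume] ℂ),
      h.coe_restrictBall hψ c' (2 * r') f, h.coe_restrictBall hψ c (2 * r) f] with x hx h1 h2
    have hx' : (g : Eucl n →ₘ[volume] ℂ) x = _ := hx
    rw [hx', Pi.sub_apply, h1, h2, Set.indicator_sdiff hsub, Pi.sub_apply]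
  have hgS : (S g : Eucl n →ₘ[volume] ℂ) =ᵐ[volume]
      (S (h.restrictBall hψ c' (2 * r') f) : Eucl n →ₘ[volume] ℂ) -
      (S (h.restrictBall hψ c (2 * r) f) : Eucl n →ₘ[volume] ℂ) := by
    have e : S g = S (h.restrictBall hψ c' (2 * r') f) - S (h.restrictBall hψ c (2 * r) f) :=
      map_sub S _ _
    rw [e]
    exact AEEqFun.coeFn_sub _ _
  have hrep := hS.eq_integral hn hK h hw g (c := c') (ρ := 2 * r') (x₀ := c) (R := 2 * r)
    (hgc.mono fun y hy hyb => by
      rw [hy, Set.indicator_of_notMem fun hm => hyb hm.1])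
    (hgc.mono fun y hy hyb => by
      rw [hy, Set.indicator_of_notMem fun hm => hm.2 hyb])
  filter_upwards [hgS, hrep] with x hx hxr hxc hxc'
  have h1 := hxr (ball_subset_ball (by linarith) hxc)
  have hmd : MeasurableSet (ball c' (2 * r') \ ball c (2 * r)) :=
    measurableSet_ball.diff measurableSet_ball
  have e1 : ∫ y, T.kernel x y * (g : Eucl n →ₘ[volume] ℂ) y =
      ∫ y in ball c' (2 * r') \ ball c (2 * r),
        T.kernel x y * (f : Eucl n →ₘ[volume] ℂ) y := by
    rw [← integral_indicator hmd]
    refine integral_congr_ae (hgc.mono fun y hy => ?_)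
    simp only [hy]
    by_cases hyd : y ∈ ball c' (2 * r') \ ball c (2 * r)
    · rw [Set.indicator_of_mem hyd, Set.indicator_of_mem hyd]
    · rw [Set.indicator_of_notMem hyd, Set.indicator_of_notMem hyd, mul_zero]
  have hi := T.integrableOn_tail hn hK h hw hκ hψ f hr hxc
  have hU : (ball c (2 * r))ᶜ = (ball c' (2 * r') \ ball c (2 * r)) ∪ (ball c' (2 * r'))ᶜ := by
    ext y
    have := @hsub y
    simp only [Set.mem_compl_iff, Set.mem_union, Set.mem_sdiff]
    tauto
  have e2 : ∫ y in (ball c (2 * r))ᶜ, T.kernel x y * (f : Eucl n →ₘ[volume] ℂ) y =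
      (∫ y in ball c' (2 * r') \ ball c (2 * r), T.kernel x y * (f : Eucl n →ₘ[volume] ℂ) y) +
      ∫ y in (ball c' (2 * r'))ᶜ, T.kernel x y * (f : Eucl n →ₘ[volume] ℂ) y := by
    rw [hU] at hi ⊢
    exact setIntegral_union (Set.disjoint_left.2 fun y hy hy' => hy' hy.1)
      measurableSet_ball.compl (hi.mono_set Set.subset_union_left)
      (hi.mono_set Set.subset_union_right)
  rw [hx, e1, Pi.sub_apply] at h1
  rw [localAct, localAct, e2, ← h1]
  ring

variable (T S) in
/-- The action on the Morrey space, glued from the local actions on the balls around the origin with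
integer radius. -/
noncomputable def morreyAct (h : IsMuckenhouptPair p q (fun x => ENNReal.ofReal (w x)) σ A)
    (hψ : IsGrowth κ ψ) (f : morreySpace n p ψ w) (x : Eucl n) : ℂ :=
  T.localAct S h hψ f 0 ((⌊‖x‖⌋₊ + 1 : ℕ) : ℝ) x

theorem measurable_apply_floor_norm {F : ℕ → Eucl n → ℂ} (hF : ∀ k, Measurable (F k)) :
    Measurable fun x => F ⌊‖x‖⌋₊ x := by
  have h1 : Measurable (Function.uncurry F) := measurable_from_prod_countable_right hF
  have h2 : Measurable fun x : Eucl n => (⌊‖x‖⌋₊, x) :=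
    (Nat.measurable_floor.comp (measurable_norm (α := Eucl n))).prodMk measurable_id
  exact h1.comp h2

variable (T S) in
theorem measurable_morreyAct (hK : Measurable (Function.uncurry T.kernel))
    (h : IsMuckenhouptPair p q (fun x => ENNReal.ofReal (w x)) σ A)
    (hψ : IsGrowth κ ψ) (f : morreySpace n p ψ w) : Measurable (T.morreyAct S h hψ f) :=
  measurable_apply_floor_norm (F := fun k => T.localAct S h hψ f 0 ((k + 1 : ℕ) : ℝ))
    fun _ => T.measurable_localAct S hK h hψ f 0 _

theorem mem_ball_floor_norm (x : Eucl n) : x ∈ ball (0 : Eucl n) ((⌊‖x‖⌋₊ + 1 : ℕ) : ℝ) := by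
  rw [mem_ball_zero_iff]
  push_cast
  exact Nat.lt_floor_add_one _

theorem morreyAct_ae_eq (hS : T.IsWeightedLpExt S) (hn : 1 ≤ n)
    (hK : Measurable (Function.uncurry T.kernel))
    (h : IsMuckenhouptPair p q (fun x => ENNReal.ofReal (w x)) σ A) (hw : IsWeight w)
    (hκ : κ < 1) (hψ : IsGrowth κ ψ) (f : morreySpace n p ψ w) (c : Eucl n) {r : ℝ}
    (hr : 0 < r) : ∀ᵐ x, x ∈ ball c r → T.morreyAct S h hψ f x = T.localAct S h hψ f c r x := by
  have key (k : ℕ) : ∀ᵐ x, x ∈ ball c r → x ∈ ball (0 : Eucl n) ((k + 1 : ℕ) : ℝ) →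
      T.localAct S h hψ f 0 ((k + 1 : ℕ) : ℝ) x = T.localAct S h hψ f c r x := by
    -- Both local actions agree with the one on a large ball containing the two balls.
    set R : ℝ := k + 1 + ‖c‖ + r with hR
    have hc := norm_nonneg c
    have hk : (0 : ℝ) ≤ k := k.cast_nonneg
    have h1 := localAct_ae_eq_of_subset hS hn hK h hw hκ hψ f (c := 0) (c' := 0)
      (r := ((k + 1 : ℕ) : ℝ)) (r' := R) (by positivity)
      (ball_subset_ball (by push_cast; linarith))
    have h2 := localAct_ae_eq_of_subset hS hn hK h hw hκ hψ f (c := c) (c' := 0)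
      (r := r) (r' := R) hr
      (ball_subset_ball' (by rw [dist_zero_right]; linarith))
    filter_upwards [h1, h2] with x hx1 hx2 hxc hx0
    have hxR : x ∈ ball (0 : Eucl n) R := by
      refine ball_subset_ball ?_ hx0
      push_cast
      linarith
    rw [hx1 hx0 hxR, hx2 hxc hxR]
  filter_upwards [ae_all_iff.2 key] with x hx hxc
  exact hx _ hxc (mem_ball_floor_norm x)

/-- The bound for the action on a ball `B`: the local part is controlled by the weighted bound and
doubling, and the tail is bounded on `B`. -/
theorem exists_eLpNorm_morreyAct_le (hS : T.IsWeightedLpExt S) (hn : 1 ≤ n)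
    (hK : Measurable (Function.uncurry T.kernel))
    (h : IsMuckenhouptPair p q (fun x => ENNReal.ofReal (w x)) σ A) (hw : IsWeight w)
    (hκ₀ : 0 ≤ κ) (hκ : κ < 1) (hψ : IsGrowth κ ψ) :
    ∃ C : ℝ≥0, ∀ (f : morreySpace n p ψ w) (c : Eucl n) (r : ℝ), 0 < r →
      eLpNorm (T.morreyAct S h hψ f) (ENNReal.ofReal p) ((weightMeasure w).restrict (ball c r)) ≤
        C * morreyNorm p ψ w (f : Eucl n →ₘ[volume] ℂ) *
          ENNReal.ofReal (ψ ((weightMeasure w).real (ball c r))) ^ (1 / p) := by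
  have hp := h.conj.pos
  have hip : 0 ≤ 1 / p := (one_div_pos.2 hp).le
  have hp1 : 1 ≤ ENNReal.ofReal p := by simpa using h.conj.lt.le
  obtain ⟨C₁, hC₁⟩ := hS.bounded
  obtain ⟨C₂, hC₂⟩ := T.exists_lintegral_tail_le hn h hw hκ hψ
  obtain ⟨D, hD, hdoub⟩ := h.exists_real_ball_two_mul_le
  obtain ⟨C₃, hC₃, hgrow⟩ := hψ.exists_le_mul
  set E : ℝ≥0∞ := C₁ * ENNReal.ofReal (C₃ * D ^ κ) ^ (1 / p) + C₂ with hE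
  have hEt : E ≠ ∞ := by
    rw [hE]
    finiteness
  refine ⟨E.toNNReal, fun f c r hr => ?_⟩
  rw [ENNReal.coe_toNNReal hEt]
  set N := morreyNorm p ψ w (f : Eucl n →ₘ[volume] ℂ) with hN
  set μ := weightMeasure w with hμ
  have hs0 : 0 < μ.real (ball c r) := h.real_ball_pos c hr
  have ht0 : 0 < μ.real (ball c (2 * r)) := h.real_ball_pos c (by positivity)
  have hψs := hψ.pos _ hs0
  set g := h.restrictBall hψ c (2 * r) f with hg
  set tail : Eucl n → ℂ :=
    fun x => ∫ y in (ball c (2 * r))ᶜ, T.kernel x y * (f : Eucl n →ₘ[volume] ℂ) y with htail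
  have htm : Measurable tail := (StronglyMeasurable.integral_prod_right (by
    exact (hK.mul ((AEEqFun.measurable _).comp measurable_snd)).stronglyMeasurable)).measurable
  have h1 : T.morreyAct S h hψ f =ᵐ[μ.restrict (ball c r)]
      (S g : Eucl n →ₘ[volume] ℂ) + tail := by
    rw [Filter.EventuallyEq, ae_restrict_iff' measurableSet_ball]
    exact (weightMeasure_ac w).ae_le (morreyAct_ae_eq hS hn hK h hw hκ hψ f c hr)
  have h2 : eLpNorm (S g : Eucl n →ₘ[volume] ℂ) (ENNReal.ofReal p) (μ.restrict (ball c r)) ≤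
      C₁ * ENNReal.ofReal (C₃ * D ^ κ) ^ (1 / p) * N *
        ENNReal.ofReal (ψ (μ.real (ball c r))) ^ (1 / p) := by
    have h3 : weightedLpNorm p w (g : Eucl n →ₘ[volume] ℂ) =
        eLpNorm (f : Eucl n →ₘ[volume] ℂ) (ENNReal.ofReal p) (μ.restrict (ball c (2 * r))) := by
      rw [weightedLpNorm_congr p w (h.coe_restrictBall hψ c (2 * r) f), weightedLpNorm,
        eLpNorm_indicator_eq_eLpNorm_restrict measurableSet_ball]
    have h4 : ψ (μ.real (ball c (2 * r))) ≤ C₃ * D ^ κ * ψ (μ.real (ball c r)) := by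
      refine (hgrow _ _ hs0 (h.real_ball_mono c (by linarith))).trans ?_
      gcongr
      rw [div_le_iff₀ hs0]
      exact hdoub c r hr
    have h5 : ENNReal.ofReal (ψ (μ.real (ball c (2 * r)))) ^ (1 / p) ≤
        ENNReal.ofReal (C₃ * D ^ κ) ^ (1 / p) *
          ENNReal.ofReal (ψ (μ.real (ball c r))) ^ (1 / p) := by
      rw [← ENNReal.mul_rpow_of_nonneg _ _ hip, ← ENNReal.ofReal_mul (by positivity)]
      gcongr
    -- Doubling of `w dx` and the growth condition compare `ψ(w(2B))` with `ψ(w(B))`.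
    calc _ ≤ weightedLpNorm p w (S g : Eucl n →ₘ[volume] ℂ) :=
          eLpNorm_mono_measure _ Measure.restrict_le_self
      _ ≤ C₁ * (N * ENNReal.ofReal (ψ (μ.real (ball c (2 * r)))) ^ (1 / p)) := by
          refine (hC₁ g).trans (mul_le_mul_right ?_ _)
          rw [h3]
          exact eLpNorm_ball_le_morreyNorm hp _ c (by positivity) (hψ.pos _ ht0)
      _ ≤ C₁ * (N * (ENNReal.ofReal (C₃ * D ^ κ) ^ (1 / p) *
            ENNReal.ofReal (ψ (μ.real (ball c r))) ^ (1 / p))) := by gcongr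
      _ = _ := by ring
  have h6 : eLpNorm tail (ENNReal.ofReal p) (μ.restrict (ball c r)) ≤
      C₂ * N * ENNReal.ofReal (ψ (μ.real (ball c r))) ^ (1 / p) := by
    set M := C₂ * N * ENNReal.ofReal (ψ (μ.real (ball c r)) / μ.real (ball c r)) ^ (1 / p) with hM
    have hMb (x : Eucl n) (hx : x ∈ ball c r) : ‖tail x‖ₑ ≤ M :=
      (enorm_integral_le_lintegral_enorm _).trans
        (hC₂ _ f.1.aestronglyMeasurable c r hr x hx)
    calc _ ≤ (∫⁻ x in ball c r, M ^ p ∂μ) ^ (1 / p) := by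
          rw [eLpNorm_eq_lintegral_rpow_enorm_toReal (by simpa using hp) (by simp),
            ENNReal.toReal_ofReal hp.le]
          refine ENNReal.rpow_le_rpow (setLIntegral_mono' measurableSet_ball fun x hx => ?_) hip
          exact ENNReal.rpow_le_rpow (hMb x hx) hp.le
      _ = M * μ (ball c r) ^ (1 / p) := by
          rw [setLIntegral_const, ENNReal.mul_rpow_of_nonneg _ _ hip, ← ENNReal.rpow_mul,
            mul_one_div_cancel hp.ne', ENNReal.rpow_one]
      _ = _ := by
          have e : μ (ball c r) = ENNReal.ofReal (μ.real (ball c r)) := by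
            rw [measureReal_def, ENNReal.ofReal_toReal (h.weightMeasure_ball_ne_top c r)]
          rw [hM, mul_assoc, e, ← ENNReal.mul_rpow_of_nonneg _ _ hip,
            ← ENNReal.ofReal_mul (by positivity), div_mul_cancel₀ _ hs0.ne']
  calc _ = eLpNorm (⇑(S g : Eucl n →ₘ[volume] ℂ) + tail) (ENNReal.ofReal p)
        (μ.restrict (ball c r)) := eLpNorm_congr_ae h1
    _ ≤ _ + _ := eLpNorm_add_le (AEEqFun.measurable _).aestronglyMeasurable
        htm.aestronglyMeasurable hp1
    _ ≤ _ := add_le_add h2 h6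
    _ = _ := by rw [hE]; ring

end ThetaCZO

namespace ThetaCZO

variable {n : ℕ} {θ : ℝ → ℝ} {T : ThetaCZO n θ} {p q : ℝ} {w : Eucl n → ℝ} {σ : Eucl n → ℝ≥0∞}
  {A : ℝ≥0} {κ : ℝ} {ψ : ℝ → ℝ} {S : weightedLp n p w →ₗ[ℂ] weightedLp n p w}

theorem localAct_add_ae_eq (hn : 1 ≤ n) (hK : Measurable (Function.uncurry T.kernel))
    (h : IsMuckenhouptPair p q (fun x => ENNReal.ofReal (w x)) σ A) (hw : IsWeight w)
    (hκ : κ < 1) (hψ : IsGrowth κ ψ) (f g : morreySpace n p ψ w) (c : Eucl n) {r : ℝ}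
    (hr : 0 < r) : ∀ᵐ x, x ∈ ball c r → T.localAct S h hψ (f + g) c r x =
      T.localAct S h hψ f c r x + T.localAct S h hψ g c r x := by
  have e : S (h.restrictBall hψ c (2 * r) (f + g)) =
      S (h.restrictBall hψ c (2 * r) f) + S (h.restrictBall hψ c (2 * r) g) := by
    rw [map_add]
    exact map_add S _ _
  filter_upwards [AEEqFun.coeFn_add (S (h.restrictBall hψ c (2 * r) f) : Eucl n →ₘ[volume] ℂ)
    (S (h.restrictBall hψ c (2 * r) g) : Eucl n →ₘ[volume] ℂ)] with x hx hxc
  have hi : ∫ y in (ball c (2 * r))ᶜ, T.kernel x y * ((f + g : morreySpace n p ψ w) :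
      Eucl n →ₘ[volume] ℂ) y =
      (∫ y in (ball c (2 * r))ᶜ, T.kernel x y * (f : Eucl n →ₘ[volume] ℂ) y) +
        ∫ y in (ball c (2 * r))ᶜ, T.kernel x y * (g : Eucl n →ₘ[volume] ℂ) y := by
    rw [← integral_add (T.integrableOn_tail hn hK h hw hκ hψ f hr hxc)
      (T.integrableOn_tail hn hK h hw hκ hψ g hr hxc)]
    refine integral_congr_ae (ae_restrict_of_ae ?_)
    filter_upwards [AEEqFun.coeFn_add (f : Eucl n →ₘ[volume] ℂ) (g : Eucl n →ₘ[volume] ℂ)]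
      with y hy
    have hy' : ((f + g : morreySpace n p ψ w) : Eucl n →ₘ[volume] ℂ) y = _ := hy
    rw [hy', Pi.add_apply, mul_add]
  have hx' : ((S (h.restrictBall hψ c (2 * r) f) + S (h.restrictBall hψ c (2 * r) g) :
    weightedLp n p w) : Eucl n →ₘ[volume] ℂ) x = _ := hx
  rw [localAct, localAct, localAct, hi, e, hx', Pi.add_apply]
  ring

theorem localAct_smul_ae_eq
    (h : IsMuckenhouptPair p q (fun x => ENNReal.ofReal (w x)) σ A) (hψ : IsGrowth κ ψ) (a : ℂ)
    (f : morreySpace n p ψ w) (c : Eucl n) (r : ℝ) : ∀ᵐ x, T.localAct S h hψ (a • f) c r x =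
      a * T.localAct S h hψ f c r x := by
  have e : S (h.restrictBall hψ c (2 * r) (a • f)) = a • S (h.restrictBall hψ c (2 * r) f) := by
    rw [map_smul]
    exact map_smul S _ _
  filter_upwards [AEEqFun.coeFn_smul a
    (S (h.restrictBall hψ c (2 * r) f) : Eucl n →ₘ[volume] ℂ)] with x hx
  have hi : ∫ y in (ball c (2 * r))ᶜ, T.kernel x y * ((a • f : morreySpace n p ψ w) :
      Eucl n →ₘ[volume] ℂ) y =
      a * ∫ y in (ball c (2 * r))ᶜ, T.kernel x y * (f : Eucl n →ₘ[volume] ℂ) y := by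
    rw [← integral_const_mul]
    refine integral_congr_ae (ae_restrict_of_ae ?_)
    filter_upwards [AEEqFun.coeFn_smul a (f : Eucl n →ₘ[volume] ℂ)] with y hy
    have hy' : ((a • f : morreySpace n p ψ w) : Eucl n →ₘ[volume] ℂ) y = _ := hy
    rw [hy', Pi.smul_apply, smul_eq_mul]
    ring
  have hx' : ((a • S (h.restrictBall hψ c (2 * r) f) : weightedLp n p w) :
    Eucl n →ₘ[volume] ℂ) x = _ := hx
  rw [localAct, localAct, hi, e, hx', Pi.smul_apply, smul_eq_mul]
  ring

/-- On square integrable functions, the local action is the operator itself. -/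
theorem localAct_ae_eq_app (hS : T.IsWeightedLpExt S) (hn : 1 ≤ n)
    (hK : Measurable (Function.uncurry T.kernel))
    (h : IsMuckenhouptPair p q (fun x => ENNReal.ofReal (w x)) σ A)
    (hψ : IsGrowth κ ψ) {f : morreySpace n p ψ w}
    (hf : MemLp (f : Eucl n →ₘ[volume] ℂ) 2 volume) (c : Eucl n) {r : ℝ} (hr : 0 < r) :
    ∀ᵐ x, x ∈ ball c r →
      T.localAct S h hψ f c r x = T.app (f : Eucl n →ₘ[volume] ℂ) x := by
  set F : Eucl n → ℂ := ⇑(f : Eucl n →ₘ[volume] ℂ) with hF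
  have h1 : MemLp ((ball c (2 * r)).indicator F) 2 volume := hf.indicator measurableSet_ball
  have h2 : MemLp ((ball c (2 * r))ᶜ.indicator F) 2 volume :=
    hf.indicator measurableSet_ball.compl
  have h3 := T.app_add h1 h2
  rw [Set.indicator_self_add_compl] at h3
  have h4 := T.app_eq_integral hn hK h2 (isOpen_ball (x := c) (ε := 2 * r))
    (.of_forall fun y hy => Set.indicator_of_notMem (Set.notMem_compl_iff.2 hy) _)
  filter_upwards [h3, h4, hS.ae_eq_app h1 (h.coe_restrictBall hψ c (2 * r) f)] with x hx hx4 hxS hxc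
  rw [hx, Pi.add_apply, hx4 (ball_subset_ball (by linarith) hxc), localAct, hxS,
    ← integral_indicator measurableSet_ball.compl]
  simp_rw [Set.indicator_mul_right, hF]

theorem ae_of_forall_ball {P : Eucl n → Prop}
    (h : ∀ k : ℕ, ∀ᵐ x, x ∈ ball (0 : Eucl n) ((k + 1 : ℕ) : ℝ) → P x) : ∀ᵐ x, P x := by
  filter_upwards [ae_all_iff.2 h] with x hx using hx _ (mem_ball_floor_norm x)

/-- The extension of the operator to the Morrey space. -/
theorem exists_isMorreyExt (hS : T.IsWeightedLpExt S) (hn : 1 ≤ n)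
    (hK : Measurable (Function.uncurry T.kernel))
    (h : IsMuckenhouptPair p q (fun x => ENNReal.ofReal (w x)) σ A) (hw : IsWeight w)
    (hκ₀ : 0 ≤ κ) (hκ : κ < 1) (hψ : IsGrowth κ ψ) :
    ∃ U : morreySpace n p ψ w →ₗ[ℂ] morreySpace n p ψ w, T.IsMorreyExt S U ∧
      ∃ C : ℝ≥0, ∀ f : morreySpace n p ψ w,
        morreyNorm p ψ w (U f : Eucl n →ₘ[volume] ℂ) ≤
          C * morreyNorm p ψ w (f : Eucl n →ₘ[volume] ℂ) := by
  obtain ⟨C, hC⟩ := exists_eLpNorm_morreyAct_le hS hn hK h hw hκ₀ hκ hψ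
  have hm (f : morreySpace n p ψ w) := T.measurable_morreyAct S hK h hψ f
  have hnorm (f : morreySpace n p ψ w) : morreyNorm p ψ w (T.morreyAct S h hψ f) ≤
      C * morreyNorm p ψ w (f : Eucl n →ₘ[volume] ℂ) :=
    morreyNorm_le h.conj.pos fun c r hr => ⟨hψ.pos _ (h.real_ball_pos c hr), hC f c r hr⟩
  have hloc (f : morreySpace n p ψ w) : LocallyIntegrable (T.morreyAct S h hψ f) := by
    refine fun x => ⟨ball x 1, ball_mem_nhds x one_pos, ?_⟩
    refine h.integrableOn_ball hw (hm f).aestronglyMeasurable ((hC f x 1 one_pos).trans_lt ?_)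
    exact ENNReal.mul_lt_top (ENNReal.mul_lt_top ENNReal.coe_lt_top f.2.2)
      (ENNReal.rpow_lt_top_of_nonneg (one_div_pos.2 h.conj.pos).le ENNReal.ofReal_ne_top)
  let V (f : morreySpace n p ψ w) : morreySpace n p ψ w :=
    ⟨AEEqFun.mk (T.morreyAct S h hψ f) (hm f).aestronglyMeasurable,
      (hloc f).congr (AEEqFun.coeFn_mk _ _).symm,
      (morreyNorm_congr p ψ w (AEEqFun.coeFn_mk _ _)).trans_lt
        ((hnorm f).trans_lt (ENNReal.mul_lt_top ENNReal.coe_lt_top f.2.2))⟩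
  have hV (f : morreySpace n p ψ w) :
      (V f : Eucl n →ₘ[volume] ℂ) =ᵐ[volume] T.morreyAct S h hψ f := AEEqFun.coeFn_mk _ _
  have hact (f : morreySpace n p ψ w) (c : Eucl n) {r : ℝ} (hr : 0 < r) :=
    morreyAct_ae_eq hS hn hK h hw hκ hψ f c hr
  have hpos (k : ℕ) : (0 : ℝ) < ((k + 1 : ℕ) : ℝ) := by positivity
  let U : morreySpace n p ψ w →ₗ[ℂ] morreySpace n p ψ w :=
    { toFun := V
      map_add' := fun f g => Subtype.ext <| AEEqFun.ext <| by
        refine Filter.EventuallyEq.trans ?_ (AEEqFun.coeFn_add _ _).symm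
        refine ae_of_forall_ball fun k => ?_
        filter_upwards [hV (f + g), hV f, hV g, hact (f + g) 0 (hpos k), hact f 0 (hpos k),
          hact g 0 (hpos k), localAct_add_ae_eq hn hK h hw hκ hψ f g 0 (hpos k)]
          with x h1 h2 h3 h4 h5 h6 h7 hx
        rw [h1, Pi.add_apply, h2, h3, h4 hx, h5 hx, h6 hx, h7 hx]
      map_smul' := fun a f => Subtype.ext <| AEEqFun.ext <| by
        refine Filter.EventuallyEq.trans ?_ (AEEqFun.coeFn_smul _ _).symm
        refine ae_of_forall_ball fun k => ?_
        filter_upwards [hV (a • f), hV f, hact (a • f) 0 (hpos k), hact f 0 (hpos k),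
          localAct_smul_ae_eq h hψ a f 0 ((k + 1 : ℕ) : ℝ)] with x h1 h2 h4 h5 h7 hx
        rw [h1, Pi.smul_apply, h2, h4 hx, h5 hx, h7, smul_eq_mul, RingHom.id_apply] }
  refine ⟨U, ⟨fun f hf => AEEqFun.ext ?_, fun f x₀ r hr => ?_⟩, C, fun f => ?_⟩
  · refine ae_of_forall_ball fun k => ?_
    have hf' : MemLp (f : Eucl n →ₘ[volume] ℂ) 2 volume := Lp.mem_Lp_iff_memLp.1 hf
    have e : T.app (f : Eucl n →ₘ[volume] ℂ) = T.l2Ext ⟨f, hf⟩ := T.app_coe ⟨f, hf⟩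
    rw [← e]
    filter_upwards [hV f, hact f 0 (hpos k), localAct_ae_eq_app hS hn hK h hψ hf' 0 (hpos k)]
      with x h1 h2 h3 hx
    exact h1.trans ((h2 hx).trans (h3 hx))
  · refine ⟨h.restrictBall hψ x₀ (2 * r) f, h.coe_restrictBall hψ x₀ (2 * r) f, ?_⟩
    filter_upwards [hV f, hact f x₀ hr] with x h1 h2 hx
    exact ⟨T.integrableOn_tail hn hK h hw hκ hψ f hr hx, h1.trans (h2 hx)⟩
  · exact (morreyNorm_congr p ψ w (hV f)).trans_le (hnorm f)

/-! ### The values of the kernel on the diagonal -/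

variable (T) in
/-- The same operator, with the kernel set to zero on the diagonal. This makes the kernel measurable
on the whole product. -/
noncomputable def offDiag : ThetaCZO n θ where
  toLin := T.toLin
  l2Ext := T.l2Ext
  l2Ext_eq := T.l2Ext_eq
  kernel x y := open Classical in if x = y then 0 else T.kernel x y
  isThetaKernel := by
    obtain ⟨hm, C, hC, h1, h2⟩ := T.isThetaKernel
    refine ⟨?_, C, hC, fun x y hxy => ?_, fun x y z hxz hlt => ?_⟩
    · convert hm using 2 with z
      rw [if_neg z.2]
    · rw [if_neg hxy]
      exact h1 x y hxy
    · have hxy : x ≠ y := by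
        rintro rfl
        simp only [sub_self, norm_zero, zero_div] at hlt
        exact hlt.not_ge (norm_nonneg _)
      have hzy : z ≠ y := by
        rintro rfl
        have := norm_nonneg (x - z)
        linarith
      rw [if_neg hxy, if_neg hzy, if_neg hxy.symm, if_neg hzy.symm]
      exact h2 x y z hxz hlt
  eq_integral f hf := by
    filter_upwards [T.eq_integral f hf] with x hx hxs
    rw [hx hxs]
    refine integral_congr_ae (.of_forall fun y => ?_)
    by_cases hxy : x = y
    · subst hxy
      simp [image_eq_zero_of_notMem_tsupport hxs]
    · simp [hxy]

theorem offDiag_kernel {x y : Eucl n} (h : x ≠ y) : T.offDiag.kernel x y = T.kernel x y :=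
  if_neg h

theorem measurable_offDiag_kernel : Measurable (Function.uncurry T.offDiag.kernel) := by
  have hs : MeasurableSet {z : Eucl n × Eucl n | z.1 ≠ z.2} :=
    (measurableSet_eq_fun measurable_fst measurable_snd).compl
  refine measurable_of_restrict_of_restrict_compl hs ?_ ?_
  · have e : Set.domRestrict {z : Eucl n × Eucl n | z.1 ≠ z.2}
        (Function.uncurry T.offDiag.kernel) = fun z => T.kernel z.1.1 z.1.2 :=
      funext fun z => offDiag_kernel z.2
    rw [e]
    exact T.isThetaKernel.measurable
  · have e : Set.domRestrict {z : Eucl n × Eucl n | z.1 ≠ z.2}ᶜ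
        (Function.uncurry T.offDiag.kernel) = fun _ => 0 :=
      funext fun z => if_pos (not_not.1 z.2)
    rw [e]
    exact measurable_const

theorem IsMorreyExt.of_offDiag {U : morreySpace n p ψ w →ₗ[ℂ] morreySpace n p ψ w}
    (h : T.offDiag.IsMorreyExt S U) : T.IsMorreyExt S U where
  agrees := h.agrees
  local_eq f x₀ r hr := by
    obtain ⟨g, hg, hU⟩ := h.local_eq f x₀ r hr
    refine ⟨g, hg, hU.mono fun x hx hxr => ?_⟩
    have e : Set.EqOn (fun y => T.offDiag.kernel x y * (f : Eucl n →ₘ[volume] ℂ) y)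
        (fun y => T.kernel x y * (f : Eucl n →ₘ[volume] ℂ) y) (ball x₀ (2 * r))ᶜ := by
      intro y hy
      have hne : x ≠ y := by
        rintro rfl
        exact hy (ball_subset_ball (by linarith) hxr)
      simp only [offDiag_kernel hne]
    obtain ⟨h1, h2⟩ := hx hxr
    rw [setIntegral_congr_fun measurableSet_ball.compl e] at h2
    exact ⟨h1.congr_fun e measurableSet_ball.compl, h2⟩

end ThetaCZO

theorem theorem2p1 {n : ℕ} (hn : 1 ≤ n) {θ : ℝ → ℝ} (hθ : IsDini θ) (T : ThetaCZO n θ)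
    {p : ℝ} (hp : 1 < p) {w : Eucl n → ℝ} (hw : IsMuckenhoupt p w)
    {κ : ℝ} (hκ₀ : 0 ≤ κ) (hκ₁ : κ < 1) {ψ : ℝ → ℝ} (hψ : IsGrowth κ ψ) :
    ∃ (S : weightedLp n p w →ₗ[ℂ] weightedLp n p w)
      (U : morreySpace n p ψ w →ₗ[ℂ] morreySpace n p ψ w),
      T.IsWeightedLpExt S ∧ T.IsMorreyExt S U ∧
      ∃ C : ℝ≥0, ∀ f : morreySpace n p ψ w,
        morreyNorm p ψ w (U f : Eucl n →ₘ[volume] ℂ) ≤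
          C * morreyNorm p ψ w (f : Eucl n →ₘ[volume] ℂ) := by
  obtain ⟨A, h⟩ := hw.exists_pair hp
  have hK := T.measurable_offDiag_kernel
  obtain ⟨C, hC⟩ := T.offDiag.exists_lintegral_app_rpow_mul_le hn hθ hK h
  obtain ⟨S, hS⟩ := T.offDiag.exists_isWeightedLpExt hp hw.toIsWeight (C := C) fun f hf => by
    rw [weightedLpNorm_eq h.conj.pos hw.toIsWeight, weightedLpNorm_eq h.conj.pos hw.toIsWeight]
    exact hC f hf
  obtain ⟨U, hU, hbdd⟩ := ThetaCZO.exists_isMorreyExt hS hn hK h hw.toIsWeight hκ₀ hκ₁ hψ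
  exact ⟨S, U, ⟨hS.bounded, hS.agrees⟩, hU.of_offDiag, hbdd⟩
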